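/- For a finite alphabet $\Sigma$ and a word $w\in\Sigma^*$, the Parikh image of $w$ is the vector $\mathrm{par}(w)\in\mathbb N^{\Sigma}$ that counts the occurrences of every letter in $w$. For a language acceptor $\mathcal A$ over $\Sigma$ (a nondeterministic finite automaton, NFA, or a context-free grammar, CFG) and $p\in\mathbb N^{\Sigma}$ let $$N(\mathcal A,p)=\#\{w\in L(\mathcal A) : \mathrm{par}(w)=p\}.$$ The problem PosParikh has as input two acceptors $\mathcal A,\mathcal B$ over $\Sigma$ of the same kind and a vector $p\in\mathbb N^{\Sigma}$, and asks whether $N(\mathcal A,p)>N(\mathcal B,p)$. Let PP (respectively, PEXP) be the class of all languages $L$ for which there is a nondeterministic Turing machine running in polynomial time (respectively, in time $2^{q(n)}$ for a polynomial $q$) such that an input $x$ belongs to $L$ if and only if more than half of all computation paths of the machine on $x$ are accepting. Let PSPACE be the class of all languages decided by deterministic Turing machines in polynomial space. Hardness of a problem for a class means that every language of the class, over any finite alphabet, is reducible to the problem by a many-one reduction that is computable in logarithmic space. **Proposition.** For the fixed two-letter alphabet $\Sigma=\{0,1\}$, PosParikh is 1. PP-hard for NFA and vectors $p$ whose entries are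 encoded in unary; 2. PSPACE-hard for NFA and vectors $p$ whose entries are encoded in binary; 3. PEXP-hard for CFG and vectors $p$ whose entries are encoded in binary. -/

import Mathlib

namespace PosParikhHardness

/-! ## Nondeterministic Turing machines and the classes PP, PSPACE, PEXP -/

/-- A head movement. -/
inductive Move where
  | left
  | stay
  | right

/-- The displacement of a head. -/
def Move.toInt : Move → ℤ
  | .left => -1
  | .stay => 0
  | .right => 1

/-- A nondeterministic one-tape Turing machine with input alphabet `α`. The tape is infinite in
both directions. Its alphabet consists of the blank `none`, the input letters `some (inl a)` and
finitely many further letters `some (inr g)`. The machine halts when no transition applies, and it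
accepts if it halts in an accepting state. -/
structure NTM (α : Type) where
  /-- control states -/
  Q : Type
  /-- tape letters other than the blank and the input letters -/
  Γ : Type
  finite_Q : Finite Q
  finite_Γ : Finite Γ
  /-- initial state -/
  start : Q
  /-- accepting states -/
  accept : Set Q
  /-- the possible (new state, letter to write, head movement) for a state and a letter read -/
  δ : Q → Option (α ⊕ Γ) → Set (Q × Option (α ⊕ Γ) × Move)

namespace NTM

variable {α : Type}

/-- A configuration: control state, head position, tape contents. -/
@[ext]
structure Cfg (M : NTM α) where
  state : M.Q
  head : ℤ
  tape : ℤ → Option (α ⊕ M.Γ)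

/-- The initial configuration: the input `x` is in cells `0, …, |x| - 1`, all other cells are
blank, and the head is at cell `0`. -/
def init (M : NTM α) (x : List α) : M.Cfg where
  state := M.start
  head := 0
  tape := fun i => if 0 ≤ i then (x[i.toNat]?).map Sum.inl else none

/-- One computation step. -/
def Step (M : NTM α) (c c' : M.Cfg) : Prop :=
  ∃ t ∈ M.δ c.state (c.tape c.head),
    c' = ⟨t.1, c.head + t.2.2.toInt, Function.update c.tape c.head t.2.1⟩

/-- No transition applies. -/
def Halted (M : NTM α) (c : M.Cfg) : Prop := M.δ c.state (c.tape c.head) = ∅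

/-- `c` can be reached on input `x`. -/
def Reachable (M : NTM α) (x : List α) (c : M.Cfg) : Prop :=
  Relation.ReflTransGen M.Step (M.init x) c

/-- The partial computations on input `x`, as sequences of configurations. -/
def partialPaths (M : NTM α) (x : List α) : Set (List M.Cfg) :=
  {l | l.head? = some (M.init x) ∧ l.IsChain M.Step}

/-- The computation paths on input `x`: the partial computations that end in a halting
configuration. -/
def paths (M : NTM α) (x : List α) : Set (List M.Cfg) :=
  {l ∈ M.partialPaths x | ∃ c, l.getLast? = some c ∧ M.Halted c}

/-- The accepting computation paths on input `x`. -/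
def acceptingPaths (M : NTM α) (x : List α) : Set (List M.Cfg) :=
  {l ∈ M.partialPaths x | ∃ c, l.getLast? = some c ∧ M.Halted c ∧ c.state ∈ M.accept}

/-- Every computation of `M` on an input of length `n` makes at most `T n` steps (a sequence of
`m + 1` configurations makes `m` steps). -/
def TimeBounded (M : NTM α) (T : ℕ → ℕ) : Prop :=
  ∀ x, ∀ l ∈ M.partialPaths x, l.length ≤ T x.length + 1

/-- On an input of length `n`, the head of `M` never leaves the cells `-S n, …, S n`. -/
def SpaceBounded (M : NTM α) (S : ℕ → ℕ) : Prop :=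
  ∀ x c, M.Reachable x c → |c.head| ≤ S x.length

/-- At most one transition applies in every situation. -/
def Deterministic (M : NTM α) : Prop := ∀ q a, (M.δ q a).Subsingleton

/-- `M` accepts `x` by majority: more than half of all computation paths accept. -/
def MajorityAccepts (M : NTM α) (x : List α) : Prop :=
  (M.paths x).ncard < 2 * (M.acceptingPaths x).ncard

/-- `M` halts on input `x`. -/
def HaltsOn (M : NTM α) (x : List α) : Prop := ∃ c, M.Reachable x c ∧ M.Halted c

/-- `M` reaches an accepting halting configuration on input `x`. -/
def Accepts (M : NTM α) (x : List α) : Prop :=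
  ∃ c, M.Reachable x c ∧ M.Halted c ∧ c.state ∈ M.accept

end NTM

/-- PP over the input alphabet `α`: majority acceptance in nondeterministic polynomial time. -/
def PP (α : Type) : Set (Language α) :=
  {L | ∃ (M : NTM α) (p : Polynomial ℕ), M.TimeBounded (fun n => p.eval n) ∧
    ∀ x, x ∈ L ↔ M.MajorityAccepts x}

/-- PEXP over the input alphabet `α`: majority acceptance in nondeterministic time
`2 ^ p n` for a polynomial `p`. -/
def PEXP (α : Type) : Set (Language α) :=
  {L | ∃ (M : NTM α) (p : Polynomial ℕ), M.TimeBounded (fun n => 2 ^ p.eval n) ∧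
    ∀ x, x ∈ L ↔ M.MajorityAccepts x}

/-- PSPACE over the input alphabet `α`: decided by a deterministic machine in polynomial space. -/
def PSPACE (α : Type) : Set (Language α) :=
  {L | ∃ (M : NTM α) (p : Polynomial ℕ), M.Deterministic ∧ M.SpaceBounded (fun n => p.eval n) ∧
    (∀ x, M.HaltsOn x) ∧ ∀ x, x ∈ L ↔ M.Accepts x}

/-! ## Logspace computable functions and logspace reductions -/

/-- What the head on the input tape reads: the input is enclosed in two end markers. -/
inductive InputSymbol (α : Type) where
  | leftEnd
  | letter (a : α)
  | rightEnd

/-- The symbol at position `i` of the input tape `⊢ x ⊣`, where `0 ≤ i ≤ |x| + 1`. -/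
def inputAt {α : Type} (x : List α) : ℕ → InputSymbol α
  | 0 => .leftEnd
  | i + 1 => match x[i]? with
    | some a => .letter a
    | none => .rightEnd

/-- Movement of the head on the input tape, which cannot pass the end markers. -/
def Move.onInput (n : ℕ) : Move → ℕ → ℕ
  | .left, i => i - 1
  | .stay, i => i
  | .right, i => min (i + 1) (n + 1)

/-- A deterministic Turing machine with a two-way read-only input tape, `k` work tapes (infinite in
both directions, `none` is the blank) and a write-only output tape. It halts if `δ` is undefined
(`none`). -/
structure Transducer (α β : Type) where
  /-- number of work tapes -/
  k : ℕ
  /-- control states -/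
  Q : Type
  /-- letters of the work tapes other than the blank -/
  Γ : Type
  finite_Q : Finite Q
  finite_Γ : Finite Γ
  /-- initial state -/
  start : Q
  /-- the new state, the movement on the input tape, the letter to write and the movement on each
  work tape, and the letter, if any, that is appended to the output -/
  δ : Q → InputSymbol α → (Fin k → Option Γ) →
    Option (Q × Move × (Fin k → Option Γ × Move) × Option β)

namespace Transducer

variable {α β : Type}

/-- A configuration. -/
@[ext]
structure Cfg (M : Transducer α β) where
  state : M.Q
  inputHead : ℕ
  heads : Fin M.k → ℤ
  tapes : Fin M.k → ℤ → Option M.Γ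
  output : List β

/-- The initial configuration: input head on the left end marker, all work tapes and the output
tape empty. -/
def init (M : Transducer α β) : M.Cfg where
  state := M.start
  inputHead := 0
  heads := fun _ => 0
  tapes := fun _ _ => none
  output := []

/-- One computation step on input `x`. -/
def step (M : Transducer α β) (x : List α) (c : M.Cfg) : Option M.Cfg :=
  (M.δ c.state (inputAt x c.inputHead) (fun j => c.tapes j (c.heads j))).map fun t =>
    { state := t.1
      inputHead := t.2.1.onInput x.length c.inputHead
      heads := fun j => c.heads j + (t.2.2.1 j).2.toInt
      tapes := fun j => Function.update (c.tapes j) (c.heads j) (t.2.2.1 j).1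
      output := c.output ++ t.2.2.2.toList }

/-- `c` can be reached on input `x`. -/
def Reachable (M : Transducer α β) (x : List α) (c : M.Cfg) : Prop :=
  Relation.ReflTransGen (fun c c' => M.step x c = some c') M.init c

/-- On every input `x` the machine halts with output `f x`. -/
def Computes (M : Transducer α β) (f : List α → List β) : Prop :=
  ∀ x, ∃ c, M.Reachable x c ∧ M.step x c = none ∧ c.output = f x

/-- On inputs of length `n` the heads on the work tapes stay within distance `O(log n)` of the
origin. The input and the output tape do not count. -/
def LogspaceBounded (M : Transducer α β) : Prop :=
  ∃ C : ℕ, ∀ x c, M.Reachable x c → ∀ j, |c.heads j| ≤ C * (Nat.log 2 x.length + 1)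

end Transducer

/-- `f` is computable in logarithmic space. -/
def LogspaceComputable {α β : Type} (f : List α → List β) : Prop :=
  ∃ M : Transducer α β, M.LogspaceBounded ∧ M.Computes f

/-- `P` is hard for the class `C` under logspace many-one reductions: every language in `C`, over
any finite alphabet, is reducible to `P`. -/
def LogspaceHard (C : (α : Type) → Set (Language α)) {β : Type} (P : Language β) : Prop :=
  ∀ (α : Type) [Finite α] (L : Language α), L ∈ C α →
    ∃ f : List α → List β, LogspaceComputable f ∧ ∀ x, x ∈ L ↔ f x ∈ P

/-! ## Parikh images -/

/-- The Parikh image of a word. -/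
def parikh {α : Type} [DecidableEq α] (w : List α) : α → ℕ := fun a => w.count a

/-- `N(L, p)`: the number of words in `L` with Parikh image `p`. -/
noncomputable def parikhCount {α : Type} [DecidableEq α] (L : Language α) (p : α → ℕ) : ℕ :=
  {w | w ∈ L ∧ parikh w = p}.ncard

/-! ## Automata and grammars over the alphabet `Bool` (the letters are 0 and 1) as finite data -/

/-- States of automata and nonterminals of grammars are named by binary words. -/
abbrev Name := List Bool

/-- An NFA: initial state, list of the final states, list of the transitions. The (finite) set of
states consists of the names that occur. -/
structure NFAData where
  init : Name
  final : List Name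
  trans : List (Name × Bool × Name)

/-- The automaton that is described. -/
def NFAData.toNFA (A : NFAData) : NFA Bool Name where
  step q a := {q' | (q, a, q') ∈ A.trans}
  start := {A.init}
  accept := {q | q ∈ A.final}

/-- The accepted language. -/
def NFAData.language (A : NFAData) : Language Bool := A.toNFA.accepts

/-- A context-free grammar: start symbol and list of the productions. The (finite) set of
nonterminals consists of the names that occur. -/
structure CFGData where
  start : Name
  prods : List (ContextFreeRule Bool Name)

/-- The grammar that is described. -/
def CFGData.toGrammar (G : CFGData) : ContextFreeGrammar Bool where
  NT := Name
  initial := G.start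
  rules := G.prods.toFinset

/-- The generated language. -/
def CFGData.language (G : CFGData) : Language Bool := G.toGrammar.language

/-! ## Encoding of instances as words -/

/-- The alphabet in which instances are written. -/
inductive Token where
  /-- a bit of a name or of a number -/
  | bit (b : Bool)
  /-- a letter of the alphabet of the automaton or grammar -/
  | letter (a : Bool)
  /-- end of a name or number -/
  | comma
  /-- end of a list -/
  | semi
deriving DecidableEq, Fintype

/-- A name or numeral. -/
def encodeName (w : Name) : List Token := w.map Token.bit ++ [Token.comma]

/-- A transition. -/
def encodeTrans (t : Name × Bool × Name) : List Token :=
  encodeName t.1 ++ [Token.letter t.2.1] ++ encodeName t.2.2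

/-- A list, item by item, with end mark. -/
def encodeList {X : Type} (enc : X → List Token) (l : List X) : List Token :=
  l.flatMap enc ++ [Token.semi]

/-- An NFA. -/
def encodeNFA (A : NFAData) : List Token :=
  encodeName A.init ++ encodeList encodeName A.final ++ encodeList encodeTrans A.trans

/-- A terminal or nonterminal. -/
def encodeSymbol : Symbol Bool Name → List Token
  | .terminal a => [Token.letter a]
  | .nonterminal A => encodeName A

/-- A production. -/
def encodeProd (r : ContextFreeRule Bool Name) : List Token :=
  encodeName r.input ++ encodeList encodeSymbol r.output

/-- A context-free grammar. -/
def encodeCFG (G : CFGData) : List Token :=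
  encodeName G.start ++ encodeList encodeProd G.prods

/-- The unary numeral `1 … 1` of length `n`. -/
def unary (n : ℕ) : List Bool := List.replicate n true

/-- The binary numeral of `n` without superfluous zeros, least significant bit first. -/
def binary (n : ℕ) : List Bool := n.bits

/-- A Parikh vector, with its two entries written by `num`. -/
def encodeVector (num : ℕ → List Bool) (p : Bool → ℕ) : List Token :=
  encodeName (num (p false)) ++ encodeName (num (p true))

/-- The problem PosParikh over a two-letter alphabet, for acceptors from the type `X` (written
by `enc`, accepting `lang`) and Parikh vectors with numbers written by `num`: given acceptors `A`,
`B` and a Parikh vector `p`, is `N(A, p) > N(B, p)`? -/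
def PosParikh {X : Type} (enc : X → List Token) (lang : X → Language Bool)
    (num : ℕ → List Bool) : Language Token :=
  {w | ∃ (A B : X) (p : Bool → ℕ), w = enc A ++ enc B ++ encodeVector num p ∧
    parikhCount (lang A) p > parikhCount (lang B) p}

/-! ## The encodings are unambiguous -/

/-- An encoding that can be decoded from left to right. -/
def PrefixFree {X : Type} (enc : X → List Token) : Prop :=
  ∀ a b r s, enc a ++ r = enc b ++ s → a = b ∧ r = s

theorem prefixFree_encodeName : PrefixFree encodeName := by
  intro a
  induction a with
  | nil => intro b r s h; cases b <;> simp_all [encodeName]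
  | cons x a ih =>
    intro b r s h
    cases b with
    | nil => simp [encodeName] at h
    | cons y b =>
      simp only [encodeName, List.map_cons, List.cons_append, List.cons.injEq, Token.bit.injEq] at h
      obtain ⟨rfl, h⟩ := h
      have := ih b r s (by simpa [encodeName] using h)
      simp [this]

theorem encodeName_ne (w : Name) (r t : List Token) : encodeName w ++ r ≠ Token.semi :: t := by
  cases w <;> simp [encodeName]

theorem PrefixFree.list {X : Type} {enc : X → List Token} (h : PrefixFree enc)
    (h' : ∀ a r t, enc a ++ r ≠ Token.semi :: t) : PrefixFree (encodeList enc) := by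
  intro a
  induction a with
  | nil =>
    intro b r s e
    cases b with
    | nil => simpa [encodeList] using e
    | cons y b => exact absurd e.symm (by simpa [encodeList] using h' y _ _)
  | cons x a ih =>
    intro b r s e
    cases b with
    | nil => exact absurd e (by simpa [encodeList] using h' x _ _)
    | cons y b =>
      obtain ⟨rfl, e_1⟩ := h x y (encodeList enc a ++ r) (encodeList enc b ++ s)
        (by simpa [encodeList] using e)
      have := ih b r s e_1
      simp [this]

theorem prefixFree_encodeNFA : PrefixFree encodeNFA := by
  rintro ⟨a, b, c⟩ ⟨a', b', c'⟩ r s e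
  simp only [encodeNFA, List.append_assoc] at e
  obtain ⟨rfl, e_2⟩ := prefixFree_encodeName _ _ _ _ e
  obtain ⟨rfl, e_3⟩ := prefixFree_encodeName.list encodeName_ne _ _ _ _ e_2
  have ht : PrefixFree encodeTrans := by
    rintro ⟨a, b, c⟩ ⟨a', b', c'⟩ r s e
    simp only [encodeTrans, List.append_assoc] at e
    obtain ⟨rfl, e_4⟩ := prefixFree_encodeName _ _ _ _ e
    simp only [List.cons_append, List.nil_append, List.cons.injEq, Token.letter.injEq] at e_4
    obtain ⟨rfl, e_5⟩ := e_4
    obtain ⟨rfl, e_6⟩ := prefixFree_encodeName _ _ _ _ e_5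
    simp [e_6]
  obtain ⟨rfl, e_7⟩ := ht.list (fun a r t => by
    simpa [encodeTrans] using encodeName_ne a.1 _ t) _ _ _ _ e_3
  simp [e_7]

theorem prefixFree_encodeCFG : PrefixFree encodeCFG := by
  have hs : PrefixFree encodeSymbol := by
    rintro (a | a) (b | b) r s e
    · simpa [encodeSymbol] using e
    · cases b <;> simp [encodeSymbol, encodeName] at e
    · cases a <;> simp [encodeSymbol, encodeName] at e
    · obtain ⟨rfl, e_8⟩ := prefixFree_encodeName _ _ _ _ e
      simp [e_8]
  have hs' := hs.list (fun a r t => by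
    cases a with
    | terminal a => simp [encodeSymbol]
    | nonterminal a => exact encodeName_ne _ _ _)
  have hp : PrefixFree encodeProd := by
    rintro ⟨a, b⟩ ⟨a', b'⟩ r s e
    simp only [encodeProd, List.append_assoc] at e
    obtain ⟨rfl, e_9⟩ := prefixFree_encodeName _ _ _ _ e
    obtain ⟨rfl, e_10⟩ := hs' _ _ _ _ e_9
    simp [e_10]
  rintro ⟨a, b⟩ ⟨a', b'⟩ r s e
  simp only [encodeCFG, List.append_assoc] at e
  obtain ⟨rfl, e_11⟩ := prefixFree_encodeName _ _ _ _ e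
  obtain ⟨rfl, e_12⟩ := hp.list (fun a r t => by
    simpa [encodeProd] using encodeName_ne a.1 _ t) _ _ _ _ e_11
  simp [e_12]

/-- Reading a word as an instance is unambiguous. -/
theorem mem_posParikh_iff {X : Type} {enc : X → List Token} (h : PrefixFree enc)
    (lang : X → Language Bool) {num : ℕ → List Bool} (hn : Function.Injective num)
    (A B : X) (p : Bool → ℕ) :
    enc A ++ enc B ++ encodeVector num p ∈ PosParikh enc lang num ↔
      parikhCount (lang A) p > parikhCount (lang B) p := by
  refine ⟨?_, fun hc => ⟨A, B, p, rfl, hc⟩⟩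
  rintro ⟨A', B', p', e, hc⟩
  simp only [List.append_assoc] at e
  obtain ⟨rfl, e_13⟩ := h _ _ _ _ e
  obtain ⟨rfl, e_14⟩ := h _ _ _ _ e_13
  obtain ⟨e1, e_15⟩ := prefixFree_encodeName _ _ _ _ e_14
  obtain ⟨e2, e_16⟩ := prefixFree_encodeName _ _ [] [] (by simpa using e_15)
  have : p = p' := by
    funext b
    cases b
    · exact hn e1
    · exact hn e2
  rwa [this]

theorem unary_injective : Function.Injective unary := by
  intro a b h
  simpa [unary] using congrArg List.length h

theorem binary_injective : Function.Injective binary := by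
  intro a b h
  have key : ∀ n, (binary n).foldr (fun b m => Nat.bit b m) 0 = n := by
    intro n
    induction n using Nat.binaryRec' with
    | zero => simp [binary]
    | bit b n hb ih =>
      simp only [binary] at ih ⊢
      rw [Nat.bits_append_bit _ _ hb]
      simp [ih]
  rw [← key a, ← key b, h]

end PosParikhHardness

/-!
Each of the three reductions turns the computations of a Turing machine `M` on an input `x` into
words and lets the acceptors look for errors.

A computation is written as a word over the finite alphabet `M.Cell`: the tape contents at times
`0, 1, 2, …` are concatenated in rows of equal length, and the cell under the head also shows the
state and the next transition. A word of the right length is the record of a computation if and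
only if it begins with the input and every cell is compatible with the three cells above it. Since
the end of a row is glued to the beginning of the next, the cell below the middle one of three
consecutive cells always comes after a gap of the same length, and no row boundaries have to be
checked. Once a computation has halted its configuration is repeated, so for all long enough words
of a given length, correct words and computations correspond to each other (`NTM.ncard_valid`).
The letters of `M.Cell` are coded by binary words of equal length with a single `1`; hence the
Parikh image of a code word tells the length of the word and nothing else
(`parikhCount_codeVector`).

The acceptor `𝒜` accepts the words that violate a rule or contain an accepting halted
configuration, and `ℬ` the words that violate a rule or contain a rejecting halted configuration.
The numbers of the remaining words are the numbers of rejecting and of accepting computations, so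
that `𝒜` accepts more words than `ℬ` if and only if more computations accept than reject
(`parikhCount_gt_iff`). A violation is guessed and verified; the only thing to be counted is the
gap between a cell and the one below it. An NFA of polynomial size does this for rows of
polynomial length (`mem_language_searchNFA`), a grammar of polynomial size for rows of exponential
length (`mem_language_searchCFG`), by repeated doubling. The acceptors do not depend on the number
of rows, which enters only into the length of the words and hence into the Parikh vector. So
polynomial time needs polynomial numbers, written in unary, while exponential time needs
exponential numbers, written in binary; this includes the time of a deterministic machine with
polynomial space (`NTM.Deterministic.halted_of_space`).

The instances are uniform: their text consists of constantly many lists with one item for each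
index `i < b ^ s`, where `2 ^ s` is linear in the length of `x` and `b` depends on `M` and its
bounds only. Each item mentions the names of `i` and `i + 1` and depends on one input symbol. A
program that counts `i` in base `b` writes such lists in logarithmic space
(`logspaceComputable_loops`); programs with conditionals and loops are compiled to transducers
(`logspaceComputable_of_exec`).
-/

namespace PosParikhHardness

/-! ### Structured programs for logspace transducers -/

/-- The part of a configuration of a one-tape transducer other than the control state. -/
structure Store (Γ β : Type) where
  ih : ℕ
  hd : ℤ
  tape : ℤ → Option Γ
  out : List β

/-- The effect of an elementary step, together with an exit code. -/
structure Act (Γ β : Type) where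
  exit : Option Bool
  imove : Move
  write : Option Γ
  wmove : Move
  emit : Option β

/-- Structured programs. An atom is one step of the machine. `ite P Q R` runs `P` and continues with
`Q` or `R` if the exit code of `P` is `some true` or `some false`; the exit code `none` means
"next round" and is passed on to the enclosing `loop`, which then restarts its body. -/
inductive Prog (α Γ β : Type) where
  | atom (f : InputSymbol α → Option Γ → Act Γ β)
  | ite (P Q R : Prog α Γ β)
  | loop (P : Prog α Γ β)

variable {α Γ β : Type}

namespace Prog

/-- The control states of a program. -/
def Q : Prog α Γ β → Type
  | atom _ => Unit
  | ite P P' P'' => P.Q ⊕ (P'.Q ⊕ P''.Q)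
  | loop P => P.Q

theorem finite_Q : (P : Prog α Γ β) → Finite P.Q
  | atom _ => inferInstanceAs (Finite Unit)
  | ite P P' P'' => by
    have := P.finite_Q
    have := P'.finite_Q
    have := P''.finite_Q
    exact inferInstanceAs (Finite (P.Q ⊕ (P'.Q ⊕ P''.Q)))
  | loop P => P.finite_Q

/-- The entry point of a program. -/
def start : (P : Prog α Γ β) → P.Q
  | atom _ => ()
  | ite P _ _ => Sum.inl P.start
  | loop P => P.start

/-- The step function of a program: the next control state or an exit code, and the action. -/
def δ : (P : Prog α Γ β) → P.Q → InputSymbol α → Option Γ → (P.Q ⊕ Option Bool) × Act Γ β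
  | atom f, _, a, g => (Sum.inr (f a g).exit, f a g)
  | ite P P' P'', Sum.inl q, a, g =>
    ((P.δ q a g).1.elim (fun q' => Sum.inl (Sum.inl q')) (fun e => match e with
      | some true => Sum.inl (Sum.inr (Sum.inl P'.start))
      | some false => Sum.inl (Sum.inr (Sum.inr P''.start))
      | none => Sum.inr none), (P.δ q a g).2)
  | ite _ P' _, Sum.inr (Sum.inl q), a, g =>
    ((P'.δ q a g).1.elim (fun q' => Sum.inl (Sum.inr (Sum.inl q'))) Sum.inr, (P'.δ q a g).2)
  | ite _ _ P'', Sum.inr (Sum.inr q), a, g =>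
    ((P''.δ q a g).1.elim (fun q' => Sum.inl (Sum.inr (Sum.inr q'))) Sum.inr, (P''.δ q a g).2)
  | loop P, q, a, g =>
    ((P.δ q a g).1.elim Sum.inl (fun e => match e with
      | some b => Sum.inr (some b)
      | none => Sum.inl P.start), (P.δ q a g).2)

end Prog

/-- The store after an action. -/
def Store.act (σ : Store Γ β) (n : ℕ) (a : Act Γ β) : Store Γ β where
  ih := a.imove.onInput n σ.ih
  hd := σ.hd + a.wmove.toInt
  tape := Function.update σ.tape σ.hd a.write
  out := σ.out ++ a.emit.toList

/-- Big-step semantics on input `x`, with all positions of the work head bounded by `S`. -/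
inductive Exec (x : List α) (S : ℤ) :
    Prog α Γ β → Store Γ β → Option Bool → Store Γ β → Prop
  | atom {f σ} (h : |σ.hd| ≤ S) :
      Exec x S (.atom f) σ (f (inputAt x σ.ih) (σ.tape σ.hd)).exit
        (σ.act x.length (f (inputAt x σ.ih) (σ.tape σ.hd)))
  | ite_true {P Q R σ σ₁ e σ₂} : Exec x S P σ (some true) σ₁ → Exec x S Q σ₁ e σ₂ →
      Exec x S (.ite P Q R) σ e σ₂
  | ite_false {P Q R σ σ₁ e σ₂} : Exec x S P σ (some false) σ₁ → Exec x S R σ₁ e σ₂ →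
      Exec x S (.ite P Q R) σ e σ₂
  | ite_none {P Q R σ σ₁} : Exec x S P σ none σ₁ → Exec x S (.ite P Q R) σ none σ₁
  | loop_exit {P σ b σ₁} : Exec x S P σ (some b) σ₁ → Exec x S (.loop P) σ (some b) σ₁
  | loop_next {P σ σ₁ e σ₂} : Exec x S P σ none σ₁ → Exec x S (.loop P) σ₁ e σ₂ →
      Exec x S (.loop P) σ e σ₂

/-- The transducer that executes a program; the additional state `none` is the halting state. -/
def Prog.toTransducer [Finite Γ] (P : Prog α Γ β) : Transducer α β where
  k := 1
  Q := Option P.Q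
  Γ := Γ
  finite_Q := by
    have := P.finite_Q
    infer_instance
  finite_Γ := inferInstance
  start := some P.start
  δ q a g := q.map fun q =>
    let t := P.δ q a (g 0)
    (t.1.elim some fun _ => none, t.2.imove, fun _ => (t.2.write, t.2.wmove), t.2.emit)

/-- A configuration of the transducer of a program. -/
def Prog.cfg [Finite Γ] (P : Prog α Γ β) (q : Option P.Q) (σ : Store Γ β) :
    P.toTransducer.Cfg where
  state := q
  inputHead := σ.ih
  heads := fun _ => σ.hd
  tapes := fun _ => σ.tape
  output := σ.out

/-- From configuration `c`, the transducer halts with output `o`, and no work head leaves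
`[-S, S]` on the way. -/
inductive Transducer.HaltsWith (M : Transducer α β) (x : List α) (S : ℤ) (o : List β) :
    M.Cfg → Prop
  | halt {c} : M.step x c = none → (∀ j, |c.heads j| ≤ S) → c.output = o → HaltsWith M x S o c
  | next {c c'} : M.step x c = some c' → (∀ j, |c.heads j| ≤ S) → HaltsWith M x S o c' →
      HaltsWith M x S o c

theorem Transducer.HaltsWith.bound {M : Transducer α β} {x : List α} {S : ℤ} {o : List β}
    {c : M.Cfg} (h : M.HaltsWith x S o c) : ∀ j, |c.heads j| ≤ S := by
  cases h <;> assumption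

theorem Transducer.HaltsWith.of_reach {M : Transducer α β} {x : List α} {S : ℤ} {o : List β}
    {c c' : M.Cfg} (h : M.HaltsWith x S o c)
    (r : Relation.ReflTransGen (fun c c' => M.step x c = some c') c c') :
    M.HaltsWith x S o c' := by
  induction r with
  | refl => exact h
  | tail _ hs ih =>
    cases ih with
    | halt h1 => simp [h1] at hs
    | next h1 _ h3 =>
      rw [h1] at hs
      cases hs
      exact h3

theorem Transducer.HaltsWith.exists_final {M : Transducer α β} {x : List α} {S : ℤ} {o : List β}
    {c : M.Cfg} (h : M.HaltsWith x S o c) :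
    ∃ c', Relation.ReflTransGen (fun c c' => M.step x c = some c') c c' ∧
      M.step x c' = none ∧ c'.output = o := by
  induction h with
  | halt h1 _ h3 => exact ⟨_, .refl, h1, h3⟩
  | next h1 _ _ ih =>
    obtain ⟨c', r, h⟩ := ih
    exact ⟨c', .head h1 r, h⟩

/-- A subprogram is simulated correctly wherever it is embedded in a program `P₀`: `e` embeds its
control states and `k` says where its exits lead. -/
theorem Exec.haltsWith [Finite Γ] {P₀ : Prog α Γ β} {x : List α} {S : ℤ} {o : List β}
    {P : Prog α Γ β} {σ σ' : Store Γ β} {ex : Option Bool} (h : Exec x S P σ ex σ') :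
    ∀ (e : P.Q → P₀.Q) (k : Option Bool → Option P₀.Q),
      (∀ q a g, P₀.δ (e q) a g = ((P₀.δ (e q) a g).1, (P.δ q a g).2) ∧
        ((P₀.δ (e q) a g).1.elim some fun _ => none) =
          (P.δ q a g).1.elim (fun q' => some (e q')) k) →
      P₀.toTransducer.HaltsWith x S o (P₀.cfg (k ex) σ') →
      P₀.toTransducer.HaltsWith x S o (P₀.cfg (some (e P.start)) σ) := by
  induction h with
  | @atom f σ hb =>
    intro e k hk hh
    refine .next (c' := P₀.cfg _ _) ?_ (fun _ => hb) hh
    obtain ⟨h1, h2⟩ := hk () (inputAt x σ.ih) (σ.tape σ.hd)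
    simp only [Prog.δ, Sum.elim_inr] at h1 h2
    simp only [Transducer.step, Prog.toTransducer, Prog.cfg, Prog.start, Option.map_some,
      Option.some.injEq]
    rw [h1]
    simp only [h2]
    rfl
  | ite_true _ _ ih1 ih2 =>
    intro e k hk hh
    refine ih1 (fun q => e (Sum.inl q)) (fun c => match c with
      | some true => some (e (Sum.inr (Sum.inl (Prog.start _))))
      | some false => some (e (Sum.inr (Sum.inr (Prog.start _))))
      | none => k none) (fun q a g => ⟨(hk (Sum.inl q) a g).1, ?_⟩)
      (ih2 (fun q => e (Sum.inr (Sum.inl q))) k (fun q a g =>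
        ⟨(hk (Sum.inr (Sum.inl q)) a g).1, ?_⟩)
        hh)
    · rw [(hk (Sum.inl q) a g).2]
      simp only [Prog.δ]
      rcases (Prog.δ _ q a g).1 with q' | (_ | _ | _) <;> rfl
    · rw [(hk (Sum.inr (Sum.inl q)) a g).2]
      simp only [Prog.δ]
      rcases (Prog.δ _ q a g).1 with q' | (_ | _ | _) <;> rfl
  | ite_false _ _ ih1 ih2 =>
    intro e k hk hh
    refine ih1 (fun q => e (Sum.inl q)) (fun c => match c with
      | some true => some (e (Sum.inr (Sum.inl (Prog.start _))))
      | some false => some (e (Sum.inr (Sum.inr (Prog.start _))))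
      | none => k none) (fun q a g => ⟨(hk (Sum.inl q) a g).1, ?_⟩)
      (ih2 (fun q => e (Sum.inr (Sum.inr q))) k (fun q a g =>
        ⟨(hk (Sum.inr (Sum.inr q)) a g).1, ?_⟩)
        hh)
    · rw [(hk (Sum.inl q) a g).2]
      simp only [Prog.δ]
      rcases (Prog.δ _ q a g).1 with q' | (_ | _ | _) <;> rfl
    · rw [(hk (Sum.inr (Sum.inr q)) a g).2]
      simp only [Prog.δ]
      rcases (Prog.δ _ q a g).1 with q' | (_ | _ | _) <;> rfl
  | ite_none _ ih1 =>
    intro e k hk hh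
    refine ih1 (fun q => e (Sum.inl q)) (fun c => match c with
      | some true => some (e (Sum.inr (Sum.inl (Prog.start _))))
      | some false => some (e (Sum.inr (Sum.inr (Prog.start _))))
      | none => k none) (fun q a g => ⟨(hk (Sum.inl q) a g).1, ?_⟩) hh
    rw [(hk (Sum.inl q) a g).2]
    simp only [Prog.δ]
    rcases (Prog.δ _ q a g).1 with q' | (_ | _ | _) <;> rfl
  | loop_exit _ ih1 =>
    intro e k hk hh
    refine ih1 e (fun c => match c with
      | some b => k (some b)
      | none => some (e (Prog.start _))) (fun q a g => ⟨(hk q a g).1, ?_⟩) hh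
    rw [(hk q a g).2]
    simp only [Prog.δ]
    rcases (Prog.δ _ q a g).1 with q' | (_ | _) <;> rfl
  | loop_next _ _ ih1 ih2 =>
    intro e k hk hh
    refine ih1 e (fun c => match c with
      | some b => k (some b)
      | none => some (e (Prog.start _))) (fun q a g => ⟨(hk q a g).1, ?_⟩) (ih2 e k hk hh)
    rw [(hk q a g).2]
    simp only [Prog.δ]
    rcases (Prog.δ _ q a g).1 with q' | (_ | _) <;> rfl

/-- A function is computable in logarithmic space if a program computes it while its work head stays
in logarithmic distance from the origin. -/
theorem logspaceComputable_of_exec [Finite Γ] (P : Prog α Γ β) (f : List α → List β) (C : ℕ)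
    (h : ∀ x, ∃ e σ, Exec x (C * (Nat.log 2 x.length + 1)) P ⟨0, 0, fun _ => none, []⟩ e σ ∧
      |σ.hd| ≤ C * (Nat.log 2 x.length + 1) ∧ σ.out = f x) :
    LogspaceComputable f := by
  have key : ∀ x, P.toTransducer.HaltsWith x (C * (Nat.log 2 x.length + 1)) (f x)
      P.toTransducer.init := by
    intro x
    obtain ⟨e, σ, h1, h2, h3⟩ := h x
    refine h1.haltsWith (P₀ := P) id (fun _ => none) (fun q a g => ⟨rfl, rfl⟩)
      (.halt rfl (fun _ => h2) h3)
  refine ⟨P.toTransducer, ⟨C, fun x c r => ((key x).of_reach r).bound⟩, fun x => ?_⟩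
  exact (key x).exists_final

end PosParikhHardness

namespace PosParikhHardness

/-! ### Loops over counters with logarithmically many digits -/

variable {α : Type}

/-- The first `s` digits of `i` in base `b`, least significant digit first. -/
def digitList (b : ℕ) : ℕ → ℕ → List ℕ
  | 0, _ => []
  | s + 1, i => (i % b) :: digitList b s (i / b)

/-- Digits written as a binary word, in a prefix code: `d` is written `1ᵈ0`. -/
def digitCode (l : List ℕ) : List Bool := l.flatMap fun d => List.replicate d true ++ [false]

/-- The name of an index `i < b ^ s`; the index `b ^ s` and all larger ones have an empty name. -/
def indexCode (b s i : ℕ) : List Bool := if i < b ^ s then digitCode (digitList b s i) else []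

/-- Adding one to a numeral in base `b` with a fixed number of digits, with an overflow flag. -/
def incDigits (b : ℕ) : List ℕ → Bool × List ℕ
  | [] => (true, [])
  | d :: l => if d + 1 < b then (false, (d + 1) :: l) else
    ((incDigits b l).1, 0 :: (incDigits b l).2)

/-- Adding one to a binary numeral, which may grow. -/
def growDigits : List ℕ → List ℕ
  | [] => [1]
  | d :: l => if d = 0 then 1 :: l else 0 :: growDigits l

/-- A loop in which an index `i` runs through all `i < base ^ s`. In round `i` it writes, if the
guard admits the symbol at position `i` of the input tape, the tokens of `pre` and `post`, where
`none` stands for the name of `i` in `pre` and for the name of `i + 1` in `post`. -/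
structure Loop (α : Type) where
  base : ℕ
  guard : InputSymbol α → Bool
  pre : List (Option Token)
  post : List (Option Token)

/-- The tokens of a template, in which `none` stands for the word `w`. -/
def fillTemplate (w : List Bool) (l : List (Option Token)) : List Token :=
  l.flatMap fun o => o.elim (w.map Token.bit) fun t => [t]

/-- The output of a loop. -/
def Loop.output (l : Loop α) (x : List α) (s : ℕ) : List Token :=
  (List.range (l.base ^ s)).flatMap fun i => if l.guard (inputAt x i) then
    fillTemplate (indexCode l.base s i) l.pre ++ fillTemplate (indexCode l.base s (i + 1)) l.post
    else []

theorem digitList_length (b s i : ℕ) : (digitList b s i).length = s := by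
  induction s generalizing i with
  | zero => rfl
  | succ s ih => simp [digitList, ih]

theorem digitList_zero (b s : ℕ) : digitList b s 0 = List.replicate s 0 := by
  induction s with
  | zero => rfl
  | succ s ih => simp [digitList, ih, List.replicate_succ]

theorem digitList_lt {b : ℕ} (hb : 0 < b) (s i : ℕ) : ∀ d ∈ digitList b s i, d < b := by
  induction s generalizing i with
  | zero => simp [digitList]
  | succ s ih =>
    intro d hd
    simp only [digitList, List.mem_cons] at hd
    rcases hd with rfl | hd
    · exact Nat.mod_lt _ hb
    · exact ih _ _ hd

theorem digitList_injOn {b : ℕ} (s : ℕ) : ∀ {i j : ℕ}, i < b ^ s → j < b ^ s →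
    digitList b s i = digitList b s j → i = j := by
  induction s with
  | zero => intro i j hi hj _; simp at hi hj; omega
  | succ s ih =>
    intro i j hi hj h
    simp only [digitList, List.cons.injEq] at h
    rw [pow_succ'] at hi hj
    have := ih (Nat.div_lt_of_lt_mul hi) (Nat.div_lt_of_lt_mul hj) h.2
    rw [← Nat.div_add_mod i b, ← Nat.div_add_mod j b, this, h.1]

theorem replicate_append_cons_inj {X : Type} {a b : X} (hab : a ≠ b) {m m' : ℕ} {r r' : List X}
    (h : List.replicate m a ++ b :: r = List.replicate m' a ++ b :: r') : m = m' ∧ r = r' := by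
  induction m generalizing m' with
  | zero =>
    cases m' with
    | zero => simpa using h
    | succ m' => simp [List.replicate_succ, hab.symm] at h
  | succ m ih =>
    cases m' with
    | zero => simp [List.replicate_succ, hab] at h
    | succ m' =>
      simp only [List.replicate_succ, List.cons_append, List.cons.injEq, true_and] at h
      obtain ⟨rfl, h'⟩ := ih h
      exact ⟨rfl, h'⟩

theorem digitCode_injective : Function.Injective digitCode := by
  intro l
  induction l with
  | nil => intro l' h; cases l' <;> simp_all [digitCode]
  | cons d l ih =>
    intro l' h
    cases l' with
    | nil => simp [digitCode] at h
    | cons d' l' =>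
      simp only [digitCode, List.flatMap_cons, List.append_assoc, List.cons_append,
        List.nil_append] at h
      obtain ⟨rfl, h'⟩ := replicate_append_cons_inj (by simp) h
      rw [ih h']

theorem indexCode_injOn {b s : ℕ} (hs : 0 < s) {i j : ℕ} (hi : i ≤ b ^ s) (hj : j ≤ b ^ s)
    (h : indexCode b s i = indexCode b s j) : i = j := by
  have hne : ∀ i, digitCode (digitList b s i) ≠ [] := by
    intro i
    obtain ⟨s, rfl⟩ := Nat.exists_eq_succ_of_ne_zero hs.ne'
    simp [digitList, digitCode]
  unfold indexCode at h
  split_ifs at h with h1 h2 h2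
  · exact digitList_injOn s h1 h2 (digitCode_injective h)
  · exact absurd h (hne i)
  · exact absurd h.symm (hne j)
  · omega

/-- Incrementing the digits of `i` gives those of `i + 1`, with an overflow at `b ^ s`. -/
theorem incDigits_digitList {b : ℕ} (hb : 0 < b) (s : ℕ) : ∀ {i : ℕ}, i < b ^ s →
    incDigits b (digitList b s i) =
      if i + 1 < b ^ s then (false, digitList b s (i + 1)) else (true, List.replicate s 0) := by
  induction s with
  | zero => intro i hi; simp [digitList, incDigits]
  | succ s ih =>
    intro i hi
    rw [pow_succ'] at hi ⊢
    simp only [digitList, incDigits]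
    have hd := Nat.div_add_mod i b
    have hlt := Nat.mod_lt i hb
    have hq : i / b < b ^ s := Nat.div_lt_of_lt_mul hi
    split_ifs with h1 h2 h2
    · have e1 : (i + 1) / b = i / b := by
        rw [show i + 1 = (i % b + 1) + b * (i / b) by omega, Nat.add_mul_div_left _ _ hb,
          Nat.div_eq_of_lt h1, zero_add]
      have e2 : (i + 1) % b = i % b + 1 := by
        have := Nat.div_add_mod (i + 1) b
        rw [e1] at this
        omega
      rw [e1, e2]
    · exfalso
      apply h2
      calc i + 1 < b * (i / b) + b := by omega
        _ = b * (i / b + 1) := by ring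
        _ ≤ b * b ^ s := Nat.mul_le_mul_left _ hq
    · have e0 : i + 1 = b * (i / b + 1) := by rw [mul_add]; omega
      have e1 : (i + 1) / b = i / b + 1 := by rw [e0, Nat.mul_div_cancel_left _ hb]
      have e2 : (i + 1) % b = 0 := by rw [e0, Nat.mul_mod_right]
      have h3 : i / b + 1 < b ^ s := by
        rw [e0] at h2
        exact Nat.lt_of_mul_lt_mul_left h2
      rw [ih hq, if_pos h3, e1, e2]
    · have e0 : i + 1 = b * (i / b + 1) := by rw [mul_add]; omega
      have h3 : ¬ i / b + 1 < b ^ s := by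
        intro h3
        apply h2
        rw [e0]
        exact Nat.mul_lt_mul_of_pos_left h3 hb
      rw [ih hq, if_neg h3]
      simp [List.replicate_succ]

theorem incDigits_length (b : ℕ) (l : List ℕ) : (incDigits b l).2.length = l.length := by
  induction l with
  | nil => rfl
  | cons d l ih => simp only [incDigits]; split_ifs <;> simp [ih]

theorem iterate_growDigits (m : ℕ) :
    growDigits^[m] [] = (Nat.bits m).map fun c => if c then 1 else 0 := by
  have key : ∀ m, growDigits ((Nat.bits m).map fun c => if c then 1 else 0) =
      (Nat.bits (m + 1)).map fun c => if c then 1 else 0 := by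
    intro m
    induction m using Nat.strong_induction_on with
    | _ m ih =>
      rcases Nat.even_or_odd' m with ⟨k, rfl | rfl⟩
      · rcases Nat.eq_zero_or_pos k with rfl | hk
        · simp [growDigits]
        · rw [Nat.bit0_bits k hk.ne', Nat.bit1_bits]
          simp [growDigits]
      · rw [Nat.bit1_bits, show 2 * k + 1 + 1 = 2 * (k + 1) by ring, Nat.bit0_bits _ (by omega)]
        simp [growDigits, ih k (by omega)]
  induction m with
  | zero => simp
  | succ m ih => rw [Function.iterate_succ_apply', ih, key]

/-! ### Programs for loops -/

section Programs

set_option linter.unusedSectionVars false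

variable {B : ℕ} [NeZero B]

/-- The work tape with the digits `l` in the cells `0, 1, …`. -/
def digitTape (B : ℕ) [NeZero B] (l : List ℕ) : ℤ → Option (Fin B) :=
  fun i => if 0 ≤ i then (l[i.toNat]?).map (Fin.ofNat B) else none

theorem digitTape_at (p r : List ℕ) (d : ℕ) :
    digitTape B (p ++ d :: r) p.length = some (Fin.ofNat B d) := by
  simp [digitTape]

theorem digitTape_end (p : List ℕ) : digitTape B p p.length = none := by
  simp [digitTape]

theorem digitTape_neg (p : List ℕ) : digitTape B p (-1) = none := by
  simp [digitTape]

theorem digitTape_update (p r : List ℕ) (d d' : ℕ) :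
    Function.update (digitTape B (p ++ d :: r)) p.length (some (Fin.ofNat B d')) =
      digitTape B (p ++ d' :: r) := by
  funext i
  rcases eq_or_ne i p.length with rfl | h
  · simp [digitTape]
  · rw [Function.update_of_ne h]
    simp only [digitTape]
    split_ifs with h0
    · lift i to ℕ using h0
      have hi : i ≠ p.length := by exact_mod_cast h
      congr 1
      simp only [Int.toNat_natCast]
      rcases lt_or_gt_of_ne hi with h1 | h1
      · rw [List.getElem?_append_left h1, List.getElem?_append_left h1]
      · rw [List.getElem?_append_right h1.le, List.getElem?_append_right h1.le]
        obtain ⟨k, hk⟩ : ∃ k, i - p.length = k + 1 := ⟨i - p.length - 1, by omega⟩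
        rw [hk]
        simp
    · rfl

theorem digitTape_append (p : List ℕ) (d : ℕ) :
    Function.update (digitTape B p) p.length (some (Fin.ofNat B d)) = digitTape B (p ++ [d]) := by
  funext i
  rcases eq_or_ne i p.length with rfl | h
  · simp [digitTape]
  · rw [Function.update_of_ne h]
    simp only [digitTape]
    split_ifs with h0
    · lift i to ℕ using h0
      have hi : i ≠ p.length := by exact_mod_cast h
      congr 1
      simp only [Int.toNat_natCast]
      rcases lt_or_gt_of_ne hi with h1 | h1
      · rw [List.getElem?_append_left h1]
      · rw [List.getElem?_eq_none h1.le, List.getElem?_eq_none]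
        simp
        omega
    · rfl

theorem Exec.atom_of_eq {Γ β : Type} {x : List α} {S : ℤ}
    {f : InputSymbol α → Option Γ → Act Γ β} {i : ℕ} {hd : ℤ} {t : ℤ → Option Γ} {o : List β}
    {a : Act Γ β} {ex : Option Bool} {σ' : Store Γ β} (h : |hd| ≤ S)
    (hf : f (inputAt x i) (t hd) = a) (hex : a.exit = ex)
    (h' : (⟨i, hd, t, o⟩ : Store Γ β).act x.length a = σ') :
    Exec x S (.atom f) ⟨i, hd, t, o⟩ ex σ' := by
  subst hf hex h'
  exact .atom h

/-- Sequential composition. -/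
def Prog.seq {Γ β : Type} (P P' : Prog α Γ β) : Prog α Γ β := .ite P P' P'

theorem Exec.seq {Γ β : Type} {x : List α} {S : ℤ} {P P' : Prog α Γ β} {σ σ₁ σ₂ : Store Γ β}
    {b : Bool} {e : Option Bool} (h : Exec x S P σ (some b) σ₁) (h' : Exec x S P' σ₁ e σ₂) :
    Exec x S (P.seq P') σ e σ₂ := by
  cases b
  · exact .ite_false h h'
  · exact .ite_true h h'

/-- No effect, exit code `e`. -/
def Prog.leave {Γ β : Type} (e : Option Bool) : Prog α Γ β :=
  .atom fun _ g => ⟨e, .stay, g, .stay, none⟩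

theorem Exec.leave {Γ β : Type} {x : List α} {S : ℤ} {e : Option Bool} {i : ℕ} {hd : ℤ}
    {t : ℤ → Option Γ} {o : List β} (h : |hd| ≤ S) :
    Exec x S (.leave e) ⟨i, hd, t, o⟩ e ⟨i, hd, t, o⟩ :=
  .atom_of_eq h rfl rfl (by simp [Store.act, Move.onInput, Move.toInt])

/-- Move the work head from the digits to the first digit. -/
def rewindTape : Prog α (Fin B) Token :=
  .loop (.atom fun _ g => if g.isSome then ⟨none, .stay, g, .left, none⟩
    else ⟨some true, .stay, g, .right, none⟩)

theorem exec_rewindTape {x : List α} {S : ℕ} {i : ℕ} {l : List ℕ} {o : List Token}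
    (hS : l.length + 1 ≤ S) : ∀ j : ℕ, j ≤ l.length →
    Exec x S rewindTape ⟨i, (j : ℤ) - 1, digitTape B l, o⟩ (some true)
      ⟨i, 0, digitTape B l, o⟩ := by
  intro j
  induction j with
  | zero =>
    intro _
    refine .loop_exit (.atom_of_eq (by simp; omega) rfl ?_ ?_) <;>
      simp [digitTape_neg, Store.act, Move.onInput, Move.toInt]
  | succ j ih =>
    intro hj
    have h : (digitTape B l j).isSome := by
      simp [digitTape]
      omega
    have ih := ih (by omega)
    refine .loop_next (σ₁ := ⟨i, (j : ℤ) - 1, digitTape B l, o⟩)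
      (.atom_of_eq (a := ⟨none, .stay, digitTape B l j, .left, none⟩) ?_ ?_ rfl ?_) ih
    · rw [abs_le]; push_cast; constructor <;> omega
    · simp [h]
    · simp [Store.act, Move.onInput, Move.toInt]
      omega

/-- Move the input head to the left end. -/
def rewindInput : Prog α (Fin B) Token :=
  .loop (.atom fun a g => match a with
    | .leftEnd => ⟨some true, .stay, g, .stay, none⟩
    | _ => ⟨none, .left, g, .stay, none⟩)

theorem inputAt_succ_ne (x : List α) (i : ℕ) : inputAt x (i + 1) ≠ .leftEnd := by
  simp only [inputAt]
  split <;> simp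

theorem exec_rewindInput {x : List α} {S : ℤ} {l : List ℕ} {o : List Token} (hS : 0 ≤ S) (i : ℕ) :
    Exec x S rewindInput ⟨i, 0, digitTape B l, o⟩ (some true) ⟨0, 0, digitTape B l, o⟩ := by
  induction i with
  | zero =>
    exact .loop_exit (.atom_of_eq (by simpa using hS) rfl rfl
      (by simp [Store.act, Move.onInput, Move.toInt, inputAt]))
  | succ i ih =>
    refine .loop_next (.atom_of_eq (a := ⟨none, .left, digitTape B l 0, .stay, none⟩)
      (by simpa using hS) ?_ rfl ?_) ih
    · have := inputAt_succ_ne x i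
      split <;> simp_all
    · simp [Store.act, Move.onInput, Move.toInt]

theorem exec_skip {x : List α} {S : ℕ} {i : ℕ} {t : ℤ → Option (Fin B)} (o : List Token) :
    Exec x S (.leave (some true)) ⟨i, 0, t, o⟩ (some true)
      ⟨i, 0, t, o ++ ([] : List Bool).map .bit⟩ := by
  simpa using Exec.leave (by simp)

/-- Write a token. -/
def writeToken (t : Token) : Prog α (Fin B) Token :=
  .atom fun _ g => ⟨some true, .stay, g, .stay, some t⟩

theorem exec_writeToken {x : List α} {S : ℤ} {i : ℕ} {hd : ℤ} {t : ℤ → Option (Fin B)}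
    {o : List Token} (h : |hd| ≤ S) (a : Token) :
    Exec x S (writeToken a) ⟨i, hd, t, o⟩ (some true) ⟨i, hd, t, o ++ [a]⟩ :=
  .atom_of_eq h rfl rfl (by simp [Store.act, Move.onInput, Move.toInt])

/-- Write the bits `1` for all `r < m` that are below the digit that is read. -/
def writeOnes : ℕ → Prog α (Fin B) Token
  | 0 => .leave (some true)
  | m + 1 => (writeOnes m).seq (.atom fun _ g => ⟨some true, .stay, g, .stay,
      g.bind fun d => if m < d.val then some (.bit true) else none⟩)

theorem exec_writeOnes {x : List α} {S : ℤ} {i : ℕ} {hd : ℤ} {t : ℤ → Option (Fin B)}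
    {o : List Token} (h : |hd| ≤ S) {d : Fin B} (hd' : t hd = some d) (m : ℕ) :
    Exec x S (writeOnes m) ⟨i, hd, t, o⟩ (some true)
      ⟨i, hd, t, o ++ List.replicate (min m d) (.bit true)⟩ := by
  induction m with
  | zero => simpa [writeOnes] using Exec.leave h
  | succ m ih =>
    refine .seq ih (.atom_of_eq h rfl rfl ?_)
    simp only [Store.act, Move.onInput, Move.toInt, hd', add_zero, Option.bind_some,
      List.append_assoc, Store.mk.injEq, List.append_cancel_left_eq, true_and]
    refine ⟨by rw [← hd']; exact Function.update_eq_self _ _, ?_⟩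
    split_ifs with hm
    · rw [min_eq_left hm.le, min_eq_left hm, List.replicate_succ']
      rfl
    · rw [min_eq_right (by omega), min_eq_right (by omega)]
      simp

/-- Write the digits on the work tape. -/
def writeDigits : Prog α (Fin B) Token :=
  (Prog.loop (.ite (.atom fun _ g => ⟨some g.isSome, .stay, g, .stay, none⟩)
    ((writeOnes B).seq (.atom fun _ g => ⟨none, .stay, g, .right, some (.bit false)⟩))
    (.atom fun _ g => ⟨some true, .stay, g, .left, none⟩))).seq rewindTape

theorem exec_writeDigits {x : List α} {S : ℕ} {i : ℕ} {l : List ℕ} {o : List Token}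
    (hS : l.length + 1 ≤ S) (hl : ∀ d ∈ l, d < B) :
    Exec x S writeDigits ⟨i, 0, digitTape B l, o⟩ (some true)
      ⟨i, 0, digitTape B l, o ++ (digitCode l).map .bit⟩ := by
  have key : ∀ (r p : List ℕ) (o : List Token), p.length + r.length + 1 ≤ S →
      (∀ d ∈ r, d < B) →
      Exec x S (Prog.loop (.ite (.atom fun _ g => ⟨some g.isSome, .stay, g, .stay, none⟩)
        ((writeOnes B).seq (.atom fun _ g => ⟨none, .stay, g, .right, some (.bit false)⟩))
        (.atom fun _ g => ⟨some true, .stay, g, .left, none⟩)))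
        ⟨i, p.length, digitTape B (p ++ r), o⟩ (some true)
        ⟨i, ((p ++ r).length : ℤ) - 1, digitTape B (p ++ r), o ++ (digitCode r).map .bit⟩ := by
    intro r
    induction r with
    | nil =>
      intro p o h1 _
      have hb : |(p.length : ℤ)| ≤ (S : ℤ) := by simp at h1 ⊢; omega
      refine .loop_exit (.ite_false (σ₁ := ⟨i, p.length, digitTape B (p ++ []), o⟩)
        (.atom_of_eq hb rfl ?_ ?_) (.atom_of_eq hb rfl rfl ?_))
      · simp [digitTape_end]
      · simp [Store.act, Move.onInput, Move.toInt]
      · simp [Store.act, Move.onInput, Move.toInt, digitCode]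
        rfl
    | cons d r ih =>
      intro p o h1 h2
      have hb : |(p.length : ℤ)| ≤ (S : ℤ) := by simp at h1 ⊢; omega
      have ih := ih (p ++ [d]) (o ++ (List.replicate d (.bit true)) ++ [.bit false])
        (by simp at h1 ⊢; omega) (fun d hd => h2 d (by simp [hd]))
      have hd : d < B := h2 d (by simp)
      have e : (Fin.ofNat B d).val = d := Nat.mod_eq_of_lt hd
      have hw := exec_writeOnes (x := x) (i := i) (o := o) hb (digitTape_at (B := B) p r d) B
      rw [e, min_eq_right hd.le] at hw
      have e1 : p ++ [d] ++ r = p ++ d :: r := by simp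
      rw [e1] at ih
      refine .loop_next (.ite_true (σ₁ := ⟨i, p.length, digitTape B (p ++ d :: r), o⟩)
        (.atom_of_eq hb rfl ?_ ?_) (.seq hw (.atom_of_eq hb rfl rfl rfl))) ?_
      · simp [digitTape_at]
      · simp [Store.act, Move.onInput, Move.toInt]
      · convert ih using 1
        · simp [Store.act, Move.onInput, Move.toInt]
        · simp [digitCode]
  have h := key l [] o (by simpa using hS) hl
  exact .seq (by simpa using h) (exec_rewindTape hS _ le_rfl)

/-- Increment the number in base `b` on the work tape; the exit code tells if there is an
overflow. -/
def incTape (b : ℕ) : Prog α (Fin B) Token :=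
  .ite (.loop (.atom fun _ g => match g with
    | none => ⟨some true, .stay, none, .left, none⟩
    | some d => if d.val + 1 < b then
      ⟨some false, .stay, some (Fin.ofNat B (d.val + 1)), .stay, none⟩
      else ⟨none, .stay, some (Fin.ofNat B 0), .right, none⟩))
    (rewindTape.seq (.leave (some true))) (rewindTape.seq (.leave (some false)))

theorem exec_incTape {x : List α} {S : ℕ} {i : ℕ} {b : ℕ} {l : List ℕ} {o : List Token}
    (hS : l.length + 1 ≤ S) (hl : ∀ d ∈ l, d < B) :
    Exec x S (incTape b) ⟨i, 0, digitTape B l, o⟩ (some (incDigits b l).1)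
      ⟨i, 0, digitTape B (incDigits b l).2, o⟩ := by
  have key : ∀ (r p : List ℕ), p.length + r.length + 1 ≤ S → (∀ d ∈ r, d < B) →
      ∃ j : ℕ, j ≤ (p ++ r).length ∧
      Exec x S (Prog.loop (.atom fun _ g => match g with
        | none => ⟨some true, .stay, none, .left, none⟩
        | some d => if d.val + 1 < b then
          ⟨some false, .stay, some (Fin.ofNat B (d.val + 1)), .stay, none⟩
          else ⟨none, .stay, some (Fin.ofNat B 0), .right, none⟩))
        ⟨i, p.length, digitTape B (p ++ r), o⟩ (some (incDigits b r).1)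
        ⟨i, (j : ℤ) - 1, digitTape B (p ++ (incDigits b r).2), o⟩ := by
    intro r
    induction r with
    | nil =>
      intro p h1 _
      have hb : |(p.length : ℤ)| ≤ (S : ℤ) := by simp at h1 ⊢; omega
      refine ⟨p.length, by simp, .loop_exit (.atom_of_eq
        (a := ⟨some true, .stay, none, .left, none⟩) hb ?_ rfl ?_)⟩
      · simp [digitTape_end]
      · simp only [Store.act, Move.onInput, Move.toInt, incDigits, List.append_nil,
          Option.toList_none, Store.mk.injEq, true_and, and_true]
        refine ⟨rfl, ?_⟩
        rw [Function.update_eq_self_iff, digitTape_end]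
    | cons d r ih =>
      intro p h1 h2
      have hb : |(p.length : ℤ)| ≤ (S : ℤ) := by simp at h1 ⊢; omega
      have hd : d < B := h2 d (by simp)
      have e : (Fin.ofNat B d).val = d := Nat.mod_eq_of_lt hd
      by_cases hdb : d + 1 < b
      · refine ⟨p.length + 1, by simp, .loop_exit (.atom_of_eq
          (a := ⟨some false, .stay, some (Fin.ofNat B (d + 1)), .stay, none⟩) hb ?_ ?_ ?_)⟩
        · rw [digitTape_at]
          simp only [e, hdb, if_true]
        · simp [incDigits, hdb]
        · simp [Store.act, Move.onInput, Move.toInt, incDigits, hdb, digitTape_update,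
            -Fin.ofNat_eq_cast]
      · obtain ⟨j, hj, ih⟩ := ih (p ++ [0]) (by simp at h1 ⊢; omega)
          (fun d hd => h2 d (by simp [hd]))
        refine ⟨j, by simpa using hj, ?_⟩
        have e1 : ∀ r : List ℕ, p ++ [0] ++ r = p ++ 0 :: r := by simp
        rw [e1, e1] at ih
        have e2 : incDigits b (d :: r) = ((incDigits b r).1, 0 :: (incDigits b r).2) := by
          simp [incDigits, hdb]
        rw [e2]
        refine .loop_next (.atom_of_eq
          (a := ⟨none, .stay, some (Fin.ofNat B 0), .right, none⟩) hb ?_ rfl ?_) ih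
        · rw [digitTape_at]
          simp only [e, hdb, if_false]
        · simp only [Store.act, digitTape_update]
          simp [Move.onInput, Move.toInt]
  obtain ⟨j, hj, h⟩ := key l [] (by simpa using hS) hl
  have hr : Exec x S rewindTape ⟨i, (j : ℤ) - 1, digitTape B (incDigits b l).2, o⟩ (some true)
      ⟨i, 0, digitTape B (incDigits b l).2, o⟩ :=
    exec_rewindTape (by rw [incDigits_length]; exact hS) j
      (by rw [incDigits_length]; simpa using hj)
  have h := by simpa using h
  unfold incTape
  cases hc : (incDigits b l).1 <;> rw [hc] at h
  · exact .ite_false h (.seq hr (.leave (by simp)))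
  · exact .ite_true h (.seq hr (.leave (by simp)))

/-- Write a template; `none` stands for the word that `P` writes. -/
def writeTemplate (P : Prog α (Fin B) Token) : List (Option Token) → Prog α (Fin B) Token
  | [] => .leave (some true)
  | none :: l => P.seq (writeTemplate P l)
  | some t :: l => (writeToken t).seq (writeTemplate P l)

theorem exec_writeTemplate {x : List α} {S : ℕ} {i : ℕ} {t : ℤ → Option (Fin B)}
    {P : Prog α (Fin B) Token} {w : List Bool}
    (hP : ∀ o, Exec x S P ⟨i, 0, t, o⟩ (some true) ⟨i, 0, t, o ++ w.map .bit⟩)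
    (l : List (Option Token)) : ∀ o, Exec x S (writeTemplate P l) ⟨i, 0, t, o⟩ (some true)
      ⟨i, 0, t, o ++ fillTemplate w l⟩ := by
  induction l with
  | nil => intro o; simpa [fillTemplate, writeTemplate] using Exec.leave (by simp)
  | cons a l ih =>
    intro o
    cases a with
    | none =>
      have := Exec.seq (hP o) (ih _)
      simpa [fillTemplate, writeTemplate] using this
    | some a =>
      have := Exec.seq (exec_writeToken (by simp) a) (ih (o ++ [a]))
      simpa [fillTemplate, writeTemplate] using this

/-- Run `P` if the guard admits the symbol on the input tape. -/
def Prog.guarded (g : InputSymbol α → Bool) (P : Prog α (Fin B) Token) : Prog α (Fin B) Token :=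
  .ite (.atom fun a c => ⟨some (g a), .stay, c, .stay, none⟩) P (.leave (some true))

theorem Exec.guarded {x : List α} {S : ℕ} {i : ℕ} {t : ℤ → Option (Fin B)} {o w : List Token}
    {P : Prog α (Fin B) Token} {g : InputSymbol α → Bool}
    (hP : Exec x S P ⟨i, 0, t, o⟩ (some true) ⟨i, 0, t, o ++ w⟩) :
    Exec x S (P.guarded g) ⟨i, 0, t, o⟩ (some true)
      ⟨i, 0, t, o ++ if g (inputAt x i) then w else []⟩ := by
  have h : ∀ b, g (inputAt x i) = b →
      Exec x S (.atom fun a c => ⟨some (g a), .stay, c, .stay, none⟩) ⟨i, 0, t, o⟩ (some b)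
      ⟨i, 0, t, o⟩ := fun b hb => .atom_of_eq (by simp) rfl (by simp [hb])
        (by simp [Store.act, Move.onInput, Move.toInt])
  cases hb : g (inputAt x i)
  · simpa [Prog.guarded] using Exec.ite_false (h _ hb) (.leave (by simp))
  · simpa [Prog.guarded] using Exec.ite_true (h _ hb) hP

/-- The program of a loop. -/
def Loop.prog (l : Loop α) : Prog α (Fin B) Token :=
  (Prog.loop (((writeTemplate writeDigits l.pre).guarded l.guard).seq (.ite (incTape l.base)
    ((writeTemplate (.leave (some true)) l.post).guarded l.guard)
    (((writeTemplate writeDigits l.post).guarded l.guard).seq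
      (.atom fun _ g => ⟨none, .right, g, .stay, none⟩))))).seq rewindInput

theorem inputAt_min (x : List α) (i : ℕ) : inputAt x (min i (x.length + 1)) = inputAt x i := by
  rcases le_total i (x.length + 1) with h | h
  · rw [min_eq_left h]
  · rw [min_eq_right h]
    obtain ⟨j, rfl⟩ : ∃ j, i = j + 1 := ⟨i - 1, by omega⟩
    simp only [inputAt]
    rw [List.getElem?_eq_none (by omega), List.getElem?_eq_none (by omega)]

theorem Loop.exec {x : List α} {S s : ℕ} (hS : s + 1 ≤ S) (l : Loop α) (h0 : 0 < l.base)
    (hB : l.base ≤ B) (o : List Token) :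
    Exec x S (l.prog (B := B)) ⟨0, 0, digitTape B (List.replicate s 0), o⟩ (some true)
      ⟨0, 0, digitTape B (List.replicate s 0), o ++ l.output x s⟩ := by
  let f : ℕ → List Token := fun i => if l.guard (inputAt x i) then
    fillTemplate (indexCode l.base s i) l.pre ++ fillTemplate (indexCode l.base s (i + 1)) l.post
    else []
  have hpos : 0 < l.base ^ s := Nat.pow_pos h0
  -- The rounds are followed backwards from the last one; `m` rounds are still to come.
  have key : ∀ m i o, i + m + 1 = l.base ^ s → ∃ i',
      Exec x S (Prog.loop (((writeTemplate writeDigits l.pre).guarded l.guard).seq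
        (.ite (incTape l.base) ((writeTemplate (.leave (some true)) l.post).guarded l.guard)
        (((writeTemplate writeDigits l.post).guarded l.guard).seq
        (.atom fun _ g => ⟨none, .right, g, .stay, none⟩)))))
      ⟨min i (x.length + 1), 0, digitTape B (digitList l.base s i), o⟩ (some true)
      ⟨i', 0, digitTape B (List.replicate s 0), o ++ (List.range' i (m + 1)).flatMap f⟩ := by
    intro m
    induction m with
    | zero =>
      intro i o hi
      refine ⟨min i (x.length + 1), ?_⟩
      have hlt : i < l.base ^ s := by omega
      have h1 := Exec.guarded (g := l.guard) (exec_writeTemplate (fun o => exec_writeDigits (x := x)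
        (i := min i (x.length + 1)) (S := S) (o := o) (l := digitList l.base s i)
        (by rw [digitList_length]; exact hS)
        (fun d hd => (digitList_lt h0 _ _ d hd).trans_le hB)) l.pre o)
      have h2 := exec_incTape (x := x) (i := min i (x.length + 1)) (S := S) (b := l.base)
        (l := digitList l.base s i)
        (o := o ++ if l.guard (inputAt x (min i (x.length + 1))) then
          fillTemplate (digitCode (digitList l.base s i)) l.pre else [])
        (by rw [digitList_length]; exact hS)
        (fun d hd => (digitList_lt h0 _ _ d hd).trans_le hB)
      rw [incDigits_digitList h0 s hlt, if_neg (show ¬ i + 1 < l.base ^ s by omega)] at h2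
      have h3 := Exec.guarded (g := l.guard) (exec_writeTemplate (P := .leave (some true)) (w := [])
        (exec_skip (x := x) (S := S) (i := min i (x.length + 1))
          (t := digitTape B (List.replicate s 0))) l.post
          (o ++ if l.guard (inputAt x (min i (x.length + 1))) then
          fillTemplate (digitCode (digitList l.base s i)) l.pre else []))
      refine .loop_exit ?_
      convert Exec.seq h1 (.ite_true h2 h3) using 2
      rw [zero_add, List.range'_one]
      simp only [List.flatMap_cons, List.flatMap_nil, List.append_nil, f, inputAt_min, indexCode,
        hlt, if_true]
      rw [if_neg (show ¬ i + 1 < l.base ^ s by omega)]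
      split_ifs <;> simp
    | succ m ih =>
      intro i o hi
      have hlt : i < l.base ^ s := by omega
      have hlt' : i + 1 < l.base ^ s := by omega
      have h1 := Exec.guarded (g := l.guard) (exec_writeTemplate (fun o => exec_writeDigits (x := x)
        (i := min i (x.length + 1)) (S := S) (o := o) (l := digitList l.base s i)
        (by rw [digitList_length]; exact hS)
        (fun d hd => (digitList_lt h0 _ _ d hd).trans_le hB)) l.pre o)
      have h2 := exec_incTape (x := x) (i := min i (x.length + 1)) (S := S) (b := l.base)
        (l := digitList l.base s i)
        (o := o ++ if l.guard (inputAt x (min i (x.length + 1))) then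
          fillTemplate (digitCode (digitList l.base s i)) l.pre else [])
        (by rw [digitList_length]; exact hS)
        (fun d hd => (digitList_lt h0 _ _ d hd).trans_le hB)
      rw [incDigits_digitList h0 s hlt, if_pos hlt'] at h2
      have h3 := Exec.guarded (g := l.guard) (exec_writeTemplate (fun o => exec_writeDigits (x := x)
        (i := min i (x.length + 1)) (S := S) (o := o) (l := digitList l.base s (i + 1))
        (by rw [digitList_length]; exact hS)
        (fun d hd => (digitList_lt h0 _ _ d hd).trans_le hB)) l.post
        (o ++ if l.guard (inputAt x (min i (x.length + 1))) then
          fillTemplate (digitCode (digitList l.base s i)) l.pre else []))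
      obtain ⟨i', h4⟩ := ih (i + 1) (o ++ f i) (by omega)
      refine ⟨i', .loop_next (Exec.seq h1 (.ite_false h2 (.seq h3
        (.atom_of_eq (a := ⟨none, .right, digitTape B (digitList l.base s (i + 1)) 0, .stay, none⟩)
        (by simp) rfl rfl rfl)))) ?_⟩
      convert h4 using 1
      · simp only [Store.act, Move.onInput, Move.toInt, inputAt_min, indexCode, hlt, hlt', if_true,
          add_zero, Function.update_eq_self, Option.toList_none, List.append_nil, Store.mk.injEq,
          true_and, f]
        refine ⟨by omega, ?_⟩
        split_ifs <;> simp
      · rw [List.range'_succ (s := i)]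
        simp
  obtain ⟨i', h⟩ := key (l.base ^ s - 1) 0 o (by omega)
  rw [Nat.sub_add_cancel hpos, ← List.range_eq_range', digitList_zero] at h
  simp only [Nat.zero_le, inf_of_le_left] at h
  exact .seq h (exec_rewindInput (by simp) i')

/-- Add one to the binary number on the work tape, which may grow. -/
def growTape : Prog α (Fin B) Token :=
  (Prog.loop (.atom fun _ g => if g = none ∨ g = some (Fin.ofNat B 0) then
    ⟨some true, .stay, some (Fin.ofNat B 1), .stay, none⟩
    else ⟨none, .stay, some (Fin.ofNat B 0), .right, none⟩)).seq rewindTape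

theorem exec_growTape {x : List α} {S : ℕ} {i : ℕ} {l : List ℕ} {o : List Token}
    (hS : (growDigits l).length + 1 ≤ S) (hl : ∀ d ∈ l, d < B) :
    Exec x S growTape ⟨i, 0, digitTape B l, o⟩ (some true)
      ⟨i, 0, digitTape B (growDigits l), o⟩ := by
  have key : ∀ (r p : List ℕ), p.length + (growDigits r).length + 1 ≤ S → (∀ d ∈ r, d < B) →
      ∃ j : ℕ, j ≤ (p ++ growDigits r).length ∧
      Exec x S (Prog.loop (.atom fun _ g => if g = none ∨ g = some (Fin.ofNat B 0) then
        ⟨some true, .stay, some (Fin.ofNat B 1), .stay, none⟩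
        else ⟨none, .stay, some (Fin.ofNat B 0), .right, none⟩))
        ⟨i, p.length, digitTape B (p ++ r), o⟩ (some true)
        ⟨i, (j : ℤ) - 1, digitTape B (p ++ growDigits r), o⟩ := by
    intro r
    induction r with
    | nil =>
      intro p h1 _
      have hb : |(p.length : ℤ)| ≤ (S : ℤ) := by simp at h1 ⊢; omega
      refine ⟨p.length + 1, by simp [growDigits], .loop_exit (.atom_of_eq
        (a := ⟨some true, .stay, some (Fin.ofNat B 1), .stay, none⟩) hb ?_ rfl ?_)⟩
      · simp [digitTape_end]
      · simp only [Store.act, List.append_nil, digitTape_append]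
        simp [Move.onInput, Move.toInt, growDigits]
    | cons d r ih =>
      intro p h1 h2
      have hb : |(p.length : ℤ)| ≤ (S : ℤ) := by simp at h1 ⊢; omega
      have hd : d < B := h2 d (by simp)
      by_cases hd0 : d = 0
      · refine ⟨p.length + 1, by simp [growDigits, hd0], .loop_exit (.atom_of_eq
          (a := ⟨some true, .stay, some (Fin.ofNat B 1), .stay, none⟩) hb ?_ rfl ?_)⟩
        · rw [digitTape_at, hd0, if_pos (Or.inr rfl)]
        · simp only [Store.act, digitTape_update]
          simp [Move.onInput, Move.toInt, growDigits, hd0]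
      · have e2 : growDigits (d :: r) = 0 :: growDigits r := by simp [growDigits, hd0]
        rw [e2] at h1 ⊢
        obtain ⟨j, hj, ih⟩ := ih (p ++ [0]) (by simp at h1 ⊢; omega)
          (fun d hd => h2 d (by simp [hd]))
        refine ⟨j, by simpa using hj, ?_⟩
        have e1 : ∀ r : List ℕ, p ++ [0] ++ r = p ++ 0 :: r := by simp
        rw [e1, e1] at ih
        refine .loop_next (.atom_of_eq
          (a := ⟨none, .stay, some (Fin.ofNat B 0), .right, none⟩) hb ?_ rfl ?_) ih
        · rw [digitTape_at, if_neg]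
          rintro (h | h)
          · cases h
          · have := congrArg Fin.val (Option.some.inj h)
            simp only [Fin.ofNat, Nat.zero_mod, Nat.mod_eq_of_lt hd] at this
            exact hd0 this
        · simp only [Store.act, digitTape_update]
          simp [Move.onInput, Move.toInt]
  obtain ⟨j, hj, h⟩ := key l [] (by simpa using hS) hl
  exact .seq (by simpa using h) (exec_rewindTape hS j (by simpa using hj))

/-- Overwrite all digits by zero. -/
def clearTape : Prog α (Fin B) Token :=
  (Prog.loop (.atom fun _ g => match g with
    | none => ⟨some true, .stay, none, .left, none⟩
    | some _ => ⟨none, .stay, some (Fin.ofNat B 0), .right, none⟩)).seq rewindTape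

theorem exec_clearTape {x : List α} {S : ℕ} {i : ℕ} {l : List ℕ} {o : List Token}
    (hS : l.length + 1 ≤ S) :
    Exec x S clearTape ⟨i, 0, digitTape B l, o⟩ (some true)
      ⟨i, 0, digitTape B (List.replicate l.length 0), o⟩ := by
  have key : ∀ (r p : List ℕ), p.length + r.length + 1 ≤ S →
      Exec x S (Prog.loop (.atom fun _ g => match g with
        | none => ⟨some true, .stay, none, .left, none⟩
        | some _ => ⟨none, .stay, some (Fin.ofNat B 0), .right, none⟩))
        ⟨i, p.length, digitTape B (p ++ r), o⟩ (some true)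
        ⟨i, ((p ++ r).length : ℤ) - 1, digitTape B (p ++ List.replicate r.length 0), o⟩ := by
    intro r
    induction r with
    | nil =>
      intro p h1
      have hb : |(p.length : ℤ)| ≤ (S : ℤ) := by simp at h1 ⊢; omega
      refine .loop_exit (.atom_of_eq (a := ⟨some true, .stay, none, .left, none⟩) hb ?_ rfl ?_)
      · simp [digitTape_end]
      · simp only [Store.act, Move.onInput, Move.toInt, List.append_nil, List.length_nil,
          List.replicate_zero, Option.toList_none, Store.mk.injEq, true_and, and_true]
        refine ⟨rfl, ?_⟩
        rw [Function.update_eq_self_iff, digitTape_end]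
    | cons d r ih =>
      intro p h1
      have hb : |(p.length : ℤ)| ≤ (S : ℤ) := by simp at h1 ⊢; omega
      have ih := ih (p ++ [0]) (by simp at h1 ⊢; omega)
      have e1 : ∀ r : List ℕ, p ++ [0] ++ r = p ++ 0 :: r := by simp
      rw [e1, e1] at ih
      refine .loop_next (.atom_of_eq
        (a := ⟨none, .stay, some (Fin.ofNat B 0), .right, none⟩) hb ?_ rfl ?_)
        (by simpa [List.replicate_succ] using ih)
      · rw [digitTape_at]
      · simp only [Store.act, digitTape_update]
        simp [Move.onInput, Move.toInt]
  have h := key l [] (by simpa using hS)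
  have h' := exec_rewindTape (B := B) (x := x) (i := i) (o := o) (l := List.replicate l.length 0)
    (by simpa using hS) l.length (by simp)
  exact .seq (by simpa using h) h'

/-- Lay out the cells of the counter: as many as the binary numeral of `|x| + 2` has digits. -/
def layout : Prog α (Fin B) Token :=
  (Prog.loop (growTape.seq (.atom fun a g => match a with
    | .rightEnd => ⟨some true, .stay, g, .stay, none⟩
    | _ => ⟨none, .right, g, .stay, none⟩))).seq (clearTape.seq rewindInput)

theorem inputAt_eq_rightEnd {x : List α} {i : ℕ} (h : x.length < i) :
    inputAt x i = .rightEnd := by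
  obtain ⟨j, rfl⟩ : ∃ j, i = j + 1 := ⟨i - 1, by omega⟩
  simp only [inputAt]
  rw [List.getElem?_eq_none (by omega)]

theorem inputAt_ne_rightEnd {x : List α} {i : ℕ} (h : i ≤ x.length) :
    inputAt x i ≠ .rightEnd := by
  cases i with
  | zero => simp [inputAt]
  | succ j =>
    simp only [inputAt]
    rw [List.getElem?_eq_getElem (by omega)]
    simp

theorem exec_layout (hB : 2 ≤ B) {x : List α} {S : ℕ} (hS : Nat.size (x.length + 2) + 1 ≤ S) :
    Exec x S (layout (B := B)) ⟨0, 0, fun _ => none, []⟩ (some true)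
      ⟨0, 0, digitTape B (List.replicate (Nat.size (x.length + 2)) 0), []⟩ := by
  have hlen : ∀ m, (growDigits^[m] []).length = Nat.size m := by
    intro m
    rw [iterate_growDigits, List.length_map, Nat.size_eq_bits_len]
  have hdig : ∀ m, ∀ d ∈ growDigits^[m] [], d < B := by
    intro m d hd
    rw [iterate_growDigits] at hd
    simp only [List.mem_map] at hd
    obtain ⟨c, -, rfl⟩ := hd
    split_ifs <;> omega
  have key : ∀ m i, i + m = x.length + 1 →
      Exec x S (Prog.loop (growTape.seq (.atom fun a g => match a with
        | .rightEnd => ⟨some true, .stay, g, .stay, none⟩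
        | _ => ⟨none, .right, g, .stay, none⟩)))
      ⟨i, 0, digitTape B (growDigits^[i] []), []⟩ (some true)
      ⟨x.length + 1, 0, digitTape B (growDigits^[x.length + 2] []), []⟩ := by
    intro m
    induction m with
    | zero =>
      intro i hi
      have hi : i = x.length + 1 := hi
      subst hi
      have h1 := exec_growTape (x := x) (i := x.length + 1) (B := B) (S := S) (o := [])
        (l := growDigits^[x.length + 1] [])
        (by rw [← Function.iterate_succ_apply' growDigits, hlen]; exact hS) (hdig _)
      rw [← Function.iterate_succ_apply' growDigits] at h1
      refine .loop_exit (.seq h1 (.atom_of_eq (by simp) rfl ?_ ?_)) <;>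
        simp [inputAt_eq_rightEnd, Store.act, Move.onInput, Move.toInt]
    | succ m ih =>
      intro i hi
      have h1 := exec_growTape (x := x) (i := i) (B := B) (S := S) (o := [])
        (l := growDigits^[i] [])
        (by
          rw [← Function.iterate_succ_apply' growDigits, hlen]
          exact (Nat.succ_le_succ (Nat.size_le_size (by omega))).trans hS) (hdig _)
      rw [← Function.iterate_succ_apply' growDigits] at h1
      refine .loop_next (.seq h1 (.atom_of_eq
        (a := ⟨none, .right, digitTape B (growDigits^[i + 1] []) 0, .stay, none⟩)
        (by simp) ?_ rfl ?_)) (ih (i + 1) (by omega))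
      · have := inputAt_ne_rightEnd (x := x) (i := i) (by omega)
        split <;> simp_all
      · simp [Store.act, Move.onInput, Move.toInt]
        omega
  have h1 := key (x.length + 1) 0 (by omega)
  have h2 := exec_clearTape (x := x) (S := S) (B := B) (i := x.length + 1)
    (l := growDigits^[x.length + 2] []) (o := []) (by rw [hlen]; exact hS)
  rw [hlen] at h2
  refine .seq (b := true)
    (σ₁ := ⟨x.length + 1, 0, digitTape B (growDigits^[x.length + 2] []), []⟩) ?_
    (.seq h2 (exec_rewindInput (by simp) _))
  convert h1 using 2
  funext i
  simp [digitTape]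

/-- Run the programs one after the other. -/
def Prog.sequence : List (Prog α (Fin B) Token) → Prog α (Fin B) Token
  | [] => .leave (some true)
  | P :: l => P.seq (sequence l)

end Programs

/-- The number of digits of the counter for inputs of length `n`. -/
def counterWidth (n : ℕ) : ℕ := Nat.size (n + 2)

theorem lt_two_pow_counterWidth (n : ℕ) : n + 2 < 2 ^ counterWidth n := Nat.lt_size_self _

theorem counterWidth_pos (n : ℕ) : 0 < counterWidth n := Nat.size_pos.2 (by omega)

/-- What a list of loops writes can be computed in logarithmic space. -/
theorem logspaceComputable_loops (P : List (Loop α)) (hP : ∀ l ∈ P, 0 < l.base) :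
    LogspaceComputable fun x : List α =>
      P.flatMap fun l => l.output x (counterWidth x.length) := by
  obtain ⟨B, hB2, hB⟩ : ∃ B, 2 ≤ B ∧ ∀ l ∈ P, l.base ≤ B := by
    clear hP
    induction P with
    | nil => exact ⟨2, le_rfl, by simp⟩
    | cons a P ih =>
      obtain ⟨B, h1, h2⟩ := ih
      refine ⟨max B a.base, by omega, ?_⟩
      intro l hl
      rcases List.mem_cons.1 hl with rfl | hl
      · exact le_max_right _ _
      · exact (h2 l hl).trans (le_max_left _ _)
  have : NeZero B := ⟨by omega⟩
  refine logspaceComputable_of_exec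
    ((layout (B := B)).seq (Prog.sequence (P.map fun l => l.prog))) _ 4 fun x => ?_
  set S : ℕ := 4 * (Nat.log 2 x.length + 1) with hSdef
  have hS : counterWidth x.length + 1 ≤ S := by
    have h1 : counterWidth x.length ≤ Nat.log 2 x.length + 3 := by
      rw [counterWidth, Nat.size_le]
      have := Nat.lt_pow_succ_log_self (b := 2) one_lt_two x.length
      rw [show Nat.log 2 x.length + 3 = (Nat.log 2 x.length + 1) + 2 by ring, pow_add]
      have : 0 < 2 ^ (Nat.log 2 x.length + 1) := by positivity
      omega
    omega
  have hS' : ((4 : ℕ) : ℤ) * ((Nat.log 2 x.length : ℤ) + 1) = (S : ℤ) := by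
    rw [hSdef]; push_cast; ring
  rw [hS']
  have key : ∀ Q : List (Loop α), (∀ l ∈ Q, l ∈ P) → ∀ o,
      Exec x S (Prog.sequence (Q.map fun l => l.prog (B := B)))
        ⟨0, 0, digitTape B (List.replicate (counterWidth x.length) 0), o⟩ (some true)
        ⟨0, 0, digitTape B (List.replicate (counterWidth x.length) 0),
          o ++ Q.flatMap fun l => l.output x (counterWidth x.length)⟩ := by
    intro Q
    induction Q with
    | nil => intro _ o; simpa [Prog.sequence] using Exec.leave (by simp)
    | cons l Q ih =>
      intro h o
      have h1 := l.exec (x := x) hS (hP l (h l (by simp))) (hB l (h l (by simp))) o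
      have h2 := ih (fun l hl => h l (by simp [hl])) (o ++ l.output x (counterWidth x.length))
      simpa [Prog.sequence] using h1.seq h2
  exact ⟨_, _, (exec_layout hB2 hS).seq (key P (fun _ h => h) []), by simp, by simp⟩

end PosParikhHardness

namespace PosParikhHardness

/-! ### Computations written as words -/

namespace NTM

variable {α : Type} (M : NTM α)

/-- The tape alphabet, including the blank. -/
abbrev Sym := Option (α ⊕ M.Γ)

/-- New state, letter to write, head movement. -/
abbrev Tr := M.Q × M.Sym × Move

/-- The letters of words that describe computations: a cell of the tape, which also tells the state
and the next transition if the head is there (`none` if the machine has halted), or a marker that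
acts like a head that is about to move to the right into the initial state. -/
inductive Cell (M : NTM α) where
  | start
  | plain (a : M.Sym)
  | head (q : M.Q) (a : M.Sym) (ch : Option M.Tr)

variable {M}

/-- The effect of a choice; after halting nothing changes. -/
def effect (q : M.Q) (a : M.Sym) (ch : Option M.Tr) : M.Tr := ch.getD (q, a, .stay)

/-- The choice `ch` is possible in state `q` when `a` is read; `none` is possible if and only if the
machine halts. -/
def Possible (q : M.Q) (a : M.Sym) : Option M.Tr → Prop
  | none => M.δ q a = ∅
  | some t => t ∈ M.δ q a

theorem exists_possible (q : M.Q) (a : M.Sym) : ∃ ch, Possible q a ch := by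
  rcases Set.eq_empty_or_nonempty (M.δ q a) with h | ⟨t, h⟩
  · exact ⟨none, h⟩
  · exact ⟨some t, h⟩

/-- The configuration after a choice. -/
def Cfg.apply (c : M.Cfg) (ch : Option M.Tr) : M.Cfg :=
  ⟨(effect c.state (c.tape c.head) ch).1,
    c.head + (effect c.state (c.tape c.head) ch).2.2.toInt,
    Function.update c.tape c.head (effect c.state (c.tape c.head) ch).2.1⟩

/-- The choice is possible in a configuration. -/
def Cfg.Ok (c : M.Cfg) (ch : Option M.Tr) : Prop := Possible c.state (c.tape c.head) ch

/-- The configurations that result from a sequence of choices. -/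
def run (M : NTM α) (x : List α) (ch : ℕ → Option M.Tr) : ℕ → M.Cfg
  | 0 => M.init x
  | t + 1 => (run M x ch t).apply (ch t)

/-- The infinite computations on input `x`, given by the sequence of choices; a halted machine stays
in its last configuration for ever. -/
def runs (M : NTM α) (x : List α) : Set (ℕ → Option M.Tr) :=
  {ch | ∀ t, (M.run x ch t).Ok (ch t)}

/-- The letter that a cell contains one step later. -/
def Cell.letter : M.Cell → M.Sym
  | .start => none
  | .plain a => a
  | .head q a ch => (effect q a ch).2.1

/-- The new state, if the head moves by `k` away from this cell. -/
def Cell.leaving (k : ℤ) : M.Cell → Option M.Q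
  | .start => if k = 1 then some M.start else none
  | .plain _ => none
  | .head q a ch => if (effect q a ch).2.2.toInt = k then some (effect q a ch).1 else none

/-- The state in which the head arrives at a cell `m` with neighbours `l` and `r`, if it does. -/
def incoming (l m r : M.Cell) : Option M.Q :=
  (l.leaving 1).or ((m.leaving 0).or (r.leaving (-1)))

/-- The cell `c` is possible one step after the cell `m` with neighbours `l` and `r`. -/
def Allowed (l m r c : M.Cell) : Prop :=
  match incoming l m r with
  | none => c = .plain m.letter
  | some q => ∃ ch, Possible q m.letter ch ∧ c = .head q m.letter ch

/-- The cells of a configuration. -/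
def Cfg.cell (c : M.Cfg) (ch : Option M.Tr) (i : ℤ) : M.Cell :=
  if i = c.head then .head c.state (c.tape i) ch else .plain (c.tape i)

/-- Row `r + 1` is the configuration at time `r`; row `0` is the input with a start marker. -/
def row (M : NTM α) (x : List α) (ch : ℕ → Option M.Tr) : ℕ → ℤ → M.Cell
  | 0, i => if i = -1 then .start else .plain ((M.init x).tape i)
  | r + 1, i => (M.run x ch r).cell (ch r) i

theorem letter_row (x : List α) (ch : ℕ → Option M.Tr) (r : ℕ) (i : ℤ) :
    (M.row x ch r i).letter = (M.run x ch r).tape i := by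
  cases r with
  | zero =>
    simp only [row, run]
    split_ifs with h
    · simp [h, Cell.letter, init]
    · rfl
  | succ r =>
    simp only [row, run, Cfg.cell, Cfg.apply]
    split_ifs with h
    · simp [h, Cell.letter]
    · simp [h, Cell.letter]

theorem incoming_row (x : List α) (ch : ℕ → Option M.Tr) (r : ℕ) (i : ℤ) :
    incoming (M.row x ch r (i - 1)) (M.row x ch r i) (M.row x ch r (i + 1)) =
      if i = (M.run x ch r).head then some (M.run x ch r).state else none := by
  cases r with
  | zero =>
    have e1 : (M.run x ch 0).head = 0 := rfl
    have e2 : (M.run x ch 0).state = M.start := rfl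
    simp only [incoming, row, e1, e2]
    by_cases h : i = 0
    · subst h
      simp [Cell.leaving]
    · rw [if_neg (by omega), if_neg h]
      split_ifs <;> simp [Cell.leaving]
  | succ r =>
    set c := M.run x ch r with hc
    have key : ∀ (k j : ℤ), (M.row x ch (r + 1) j).leaving k =
        if j = c.head ∧ (effect c.state (c.tape c.head) (ch r)).2.2.toInt = k then
          some (effect c.state (c.tape c.head) (ch r)).1 else none := by
      intro k j
      simp only [row, Cfg.cell, ← hc]
      by_cases h : j = c.head
      · subst h
        simp [Cell.leaving]
      · simp [h, Cell.leaving]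
    simp only [incoming, key]
    have e1 : (M.run x ch (r + 1)).head =
      c.head + (effect c.state (c.tape c.head) (ch r)).2.2.toInt := rfl
    have e2 : (M.run x ch (r + 1)).state = (effect c.state (c.tape c.head) (ch r)).1 := rfl
    simp only [e1, e2]
    have hm : ∀ m : Move, m.toInt = -1 ∨ m.toInt = 0 ∨ m.toInt = 1 := by
      intro m
      cases m <;> simp [Move.toInt]
    rcases hm (effect c.state (c.tape c.head) (ch r)).2.2 with h | h | h <;>
      simp only [h]
    · by_cases hi : i = c.head + -1
      · simp [hi]
      · simp [hi, show ¬ i + 1 = c.head by omega]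
    · by_cases hi : i = c.head
      · simp [hi]
      · simp [hi]
    · by_cases hi : i = c.head + 1
      · simp [hi]
      · simp [hi, show ¬ i - 1 = c.head by omega]

/-- The local rule describes what is possible in the next row. -/
theorem allowed_row_iff (x : List α) (ch : ℕ → Option M.Tr) (r : ℕ) (i : ℤ) (c : M.Cell) :
    Allowed (M.row x ch r (i - 1)) (M.row x ch r i) (M.row x ch r (i + 1)) c ↔
      ∃ a, (i = (M.run x ch r).head → (M.run x ch r).Ok a) ∧ c = (M.run x ch r).cell a i := by
  unfold Allowed
  rw [incoming_row, letter_row]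
  by_cases h : i = (M.run x ch r).head
  · simp only [h, if_true, Cfg.cell, Cfg.Ok, true_imp_iff]
  · simp only [h, if_false, Cfg.cell, false_imp_iff, true_and, exists_const]

variable {x : List α} {S T G : ℕ}

theorem tape_run_of_lt {ch : ℕ → Option M.Tr} (hS : ∀ t, |(M.run x ch t).head| ≤ S) (t : ℕ) {i : ℤ}
    (hi : (S + x.length : ℕ) < |i|) : (M.run x ch t).tape i = none := by
  induction t with
  | zero =>
    simp only [run, init]
    split_ifs with h
    · lift i to ℕ using h
      rw [Nat.abs_cast] at hi
      rw [List.getElem?_eq_none]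
      · rfl
      · simp only [Int.toNat_natCast]
        omega
    · rfl
  | succ t ih =>
    simp only [run, Cfg.apply]
    rw [Function.update_of_ne, ih]
    rintro rfl
    have := hS t
    push_cast at hi
    omega

/-- The number of columns to the left of the origin that count as part of a row. -/
def margin (S n : ℕ) : ℕ := S + n + 2

theorem row_blank {ch : ℕ → Option M.Tr} (hS : ∀ t, |(M.run x ch t).head| ≤ S) (r : ℕ) {i : ℤ}
    (hi : (margin S x.length : ℤ) ≤ |i|) : M.row x ch r i = .plain none := by
  unfold margin at hi
  cases r with
  | zero =>
    have h := tape_run_of_lt hS 0 (i := i) (by push_cast at hi ⊢; omega)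
    simp only [run] at h
    simp only [row, h]
    rw [if_neg]
    rintro rfl
    simp at hi
    omega
  | succ r =>
    have h := tape_run_of_lt hS r (i := i) (by push_cast at hi ⊢; omega)
    simp only [row, Cfg.cell, h]
    rw [if_neg]
    rintro rfl
    have := hS r
    push_cast at hi
    omega

/-- The letter at position `p` of the word that describes a computation. After an additional start
marker, the rows are written one after the other: the cell in column `i` of row `r` is at position
`r * (G + 2) + i + 2`, so that cells with the same column in successive rows have distance
`G + 2`. -/
def layoutCell (M : NTM α) (x : List α) (S G : ℕ) (ch : ℕ → Option M.Tr) (p : ℕ) : M.Cell :=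
  if p = 0 then .start else
    M.row x ch ((((p : ℤ) - 2 + margin S x.length) / (G + 2 : ℕ)).toNat)
      (((p : ℤ) - 2 + margin S x.length) % (G + 2 : ℕ) - margin S x.length)

theorem layoutCell_base {ch : ℕ → Option M.Tr} {p r : ℕ} {i : ℤ} (hp : 1 ≤ p)
    (h : (p : ℤ) = r * (G + 2 : ℕ) + i + 2) (h1 : -(margin S x.length : ℤ) ≤ i)
    (h2 : i < (G + 2 : ℕ) - margin S x.length) :
    M.layoutCell x S G ch p = M.row x ch r i := by
  unfold layoutCell
  rw [if_neg (by omega)]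
  have e : (p : ℤ) - 2 + margin S x.length = (i + margin S x.length) + (G + 2 : ℕ) * r := by
    rw [h]; ring
  rw [e, Int.add_mul_ediv_left _ _ (by positivity), Int.add_mul_emod_self_left,
    Int.ediv_eq_zero_of_lt (by omega) (by omega), Int.emod_eq_of_lt (by omega) (by omega)]
  simp

/-- Rows overlap in blank cells, so that columns outside the row proper can be read as well. -/
theorem layoutCell_eq {ch : ℕ → Option M.Tr} (hS : ∀ t, |(M.run x ch t).head| ≤ S)
    {p r : ℕ} {i : ℤ} (hp : 1 ≤ p)
    (h : (p : ℤ) = r * (G + 2 : ℕ) + i + 2) (h1 : -((G + 2 : ℕ) : ℤ) + margin S x.length ≤ i)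
    (h2 : i ≤ (G + 2 : ℕ) - margin S x.length) (hG : 2 * margin S x.length ≤ G) :
    M.layoutCell x S G ch p = M.row x ch r i := by
  have hm : 2 ≤ margin S x.length := by unfold margin; omega
  rcases lt_or_ge i (-(margin S x.length : ℤ)) with h3 | h3
  · cases r with
    | zero => simp at h; omega
    | succ r =>
      rw [layoutCell_base (r := r) (i := i + (G + 2 : ℕ)) hp (by rw [h]; push_cast; ring)
        (by omega) (by omega)]
      rw [row_blank hS _ (by rw [abs_of_nonneg] <;> omega),
        row_blank hS _ (by rw [abs_of_neg] <;> omega)]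
  · rcases lt_or_ge i ((G + 2 : ℕ) - margin S x.length : ℤ) with h4 | h4
    · exact layoutCell_base hp h h3 h4
    · rw [layoutCell_base (r := r + 1) (i := i - (G + 2 : ℕ)) hp (by rw [h]; push_cast; ring)
        (by omega) (by omega)]
      rw [row_blank hS _ (by rw [abs_of_neg] <;> omega),
        row_blank hS _ (by rw [abs_of_nonneg] <;> omega)]

/-- Every position belongs to a row. -/
theorem exists_row (S n : ℕ) {p : ℕ} (hp : 1 ≤ p) : ∃ (r : ℕ) (i : ℤ),
    (p : ℤ) = r * (G + 2 : ℕ) + i + 2 ∧ -(margin S n : ℤ) ≤ i ∧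
      i < (G + 2 : ℕ) - margin S n := by
  have hm : 2 ≤ margin S n := by unfold margin; omega
  have hpos : (0 : ℤ) < ((G + 2 : ℕ) : ℤ) := by positivity
  refine ⟨(((p : ℤ) - 2 + margin S n) / (G + 2 : ℕ)).toNat,
    ((p : ℤ) - 2 + margin S n) % (G + 2 : ℕ) - margin S n, ?_, ?_, ?_⟩
  · have h0 : 0 ≤ ((p : ℤ) - 2 + margin S n) / (G + 2 : ℕ) := Int.ediv_nonneg (by omega) hpos.le
    rw [Int.toNat_of_nonneg h0]
    have := Int.mul_ediv_add_emod ((p : ℤ) - 2 + margin S n) (G + 2 : ℕ)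
    linarith
  · have := Int.emod_nonneg ((p : ℤ) - 2 + margin S n) hpos.ne'
    omega
  · have := Int.emod_lt_of_pos ((p : ℤ) - 2 + margin S n) hpos
    omega

/-- The cell of the first row that belongs to a position of the input tape. -/
def expected (M : NTM α) : InputSymbol α → M.Cell
  | .leftEnd => .start
  | .letter a => .plain (some (.inl a))
  | .rightEnd => .plain none

theorem layoutCell_first {ch : ℕ → Option M.Tr} (hS : ∀ t, |(M.run x ch t).head| ≤ S)
    (hG : 2 * margin S x.length ≤ G) {j : ℕ} (hj : j ≤ G + 2) :
    M.layoutCell x S G ch (j + 1) = M.expected (inputAt x j) := by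
  have hm : 2 ≤ margin S x.length := by unfold margin; omega
  have h0 : M.row x ch 0 ((j : ℤ) - 1) = M.expected (inputAt x j) := by
    simp only [row, init]
    cases j with
    | zero => simp [inputAt, expected]
    | succ j =>
      rw [if_neg (by push_cast; omega)]
      simp only [Nat.cast_add, Nat.cast_one, add_sub_cancel_right, Nat.cast_nonneg, if_true,
        Int.toNat_natCast, inputAt]
      cases x[j]? <;> rfl
  rw [← h0]
  rcases le_or_gt ((j : ℤ) - 1) ((G + 2 : ℕ) - margin S x.length) with h | h
  · exact layoutCell_eq hS (by omega) (by push_cast; ring) (by push_cast at *; omega) h hG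
  · rw [layoutCell_eq hS (r := 1) (i := (j : ℤ) - 1 - (G + 2 : ℕ)) (by omega)
      (by push_cast; ring) (by push_cast at *; omega) (by push_cast at *; omega) hG]
    rw [row_blank hS 0 (by rw [abs_of_nonneg] <;> push_cast at * <;> omega)]
    have hne : (j : ℤ) - 1 - (G + 2 : ℕ) ≠ (M.run x ch 0).head := by
      simp only [run, init]
      push_cast
      omega
    simp only [row, Cfg.cell, if_neg hne]
    simp only [run, init]
    rw [if_neg (by push_cast; omega)]

theorem allowed_layoutCell_iff {ch : ℕ → Option M.Tr} (hS : ∀ t, |(M.run x ch t).head| ≤ S)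
    (hG : 2 * margin S x.length ≤ G) {q r : ℕ} {i : ℤ} (hq : 1 ≤ q)
    (h : (q : ℤ) = r * (G + 2 : ℕ) + i + 1) (h1 : -(margin S x.length : ℤ) ≤ i)
    (h2 : i < (G + 2 : ℕ) - margin S x.length) (c : M.Cell) :
    Allowed (M.layoutCell x S G ch q) (M.layoutCell x S G ch (q + 1))
      (M.layoutCell x S G ch (q + 2)) c ↔
      ∃ a, (i = (M.run x ch r).head → (M.run x ch r).Ok a) ∧ c = (M.run x ch r).cell a i := by
  have hm : 2 ≤ margin S x.length := by unfold margin; omega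
  rw [layoutCell_eq hS (r := r) (i := i - 1) hq (by rw [h]; ring) (by push_cast; omega) (by omega)
      hG,
    layoutCell_eq hS (r := r) (i := i) (by omega) (by push_cast; rw [h]; push_cast; ring)
      (by push_cast; omega) (by omega) hG,
    layoutCell_eq hS (r := r) (i := i + 1) (by omega) (by push_cast; rw [h]; push_cast; ring)
      (by push_cast; omega) (by omega) hG]
  exact allowed_row_iff x ch r i c

/-- The words that obey the rules: the first row is the input, and the later ones follow the local
rule. -/
structure Valid (M : NTM α) (x : List α) (G : ℕ) (w : List M.Cell) : Prop where
  zero : w[0]? = some .start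
  first : ∀ j ≤ G + 2, w[j + 1]? = some (M.expected (inputAt x j))
  next : ∀ q ≥ 1, ∀ a b c d, w[q]? = some a → w[q + 1]? = some b → w[q + 2]? = some c →
    w[q + 3 + G]? = some d → Allowed a b c d

/-- A prefix of the word that describes a computation. -/
def layoutWord (M : NTM α) (x : List α) (S G L : ℕ) (ch : ℕ → Option M.Tr) : List M.Cell :=
  (List.range L).map (M.layoutCell x S G ch)

theorem getElem?_layoutWord {L p : ℕ} (ch : ℕ → Option M.Tr) (hp : p < L) :
    (M.layoutWord x S G L ch)[p]? = some (M.layoutCell x S G ch p) := by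
  simp [layoutWord, hp]

theorem valid_layoutWord {L : ℕ} {ch : ℕ → Option M.Tr} (hch : ch ∈ M.runs x)
    (hS : ∀ t, |(M.run x ch t).head| ≤ S) (hG : 2 * margin S x.length ≤ G) (hL : G + 4 ≤ L) :
    M.Valid x G (M.layoutWord x S G L ch) where
  zero := by
    rw [getElem?_layoutWord _ (by omega)]
    simp [layoutCell]
  first j hj := by
    rw [getElem?_layoutWord _ (by omega), layoutCell_first hS hG hj]
  next q hq a b c d ha hb hc hd := by
    have hlt : q + 3 + G < L := by
      have := (List.getElem?_eq_some_iff.1 hd).1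
      simpa [layoutWord] using this
    rw [getElem?_layoutWord _ (by omega), Option.some.injEq] at ha hb hc hd
    subst ha hb hc hd
    obtain ⟨r, i, h1, h2, h3⟩ := exists_row (G := G) S x.length (p := q + 1) (by omega)
    rw [allowed_layoutCell_iff hS hG (r := r) hq (by push_cast at h1 ⊢; linarith) h2 h3]
    refine ⟨ch r, fun _ => hch r, ?_⟩
    rw [layoutCell_eq hS (r := r + 1) (i := i) (by omega) (by push_cast at h1 ⊢; linarith)
      (by push_cast; omega) (by omega) hG]
    rfl

/-- Every word that obeys the rules describes a computation: the choices can be read off the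
cells with the head. -/
theorem exists_run_of_valid {L : ℕ} {w : List M.Cell} (hw : M.Valid x G w) (hlen : w.length = L)
    (hS : ∀ ch ∈ M.runs x, ∀ t, |(M.run x ch t).head| ≤ S) (hG : 2 * margin S x.length ≤ G) :
    ∃ ch ∈ M.runs x, w = M.layoutWord x S G L ch := by
  classical
  have hm : 2 ≤ margin S x.length := by unfold margin; omega
  -- the choice that the word contains at time `t` for the configuration `c`, if it is possible
  let pick : ℕ → M.Cfg → Option M.Tr := fun t c =>
    if h : ∃ a, c.Ok a ∧ w[((t + 1 : ℕ) * (G + 2 : ℕ) + c.head + 2 : ℤ).toNat]? =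
      some (c.cell a c.head) then h.choose else (exists_possible c.state (c.tape c.head)).choose
  let cfg : ℕ → M.Cfg := fun t => Nat.rec (M.init x) (fun t c => c.apply (pick t c)) t
  let ch : ℕ → Option M.Tr := fun t => pick t (cfg t)
  have hrun : ∀ t, M.run x ch t = cfg t := by
    intro t
    induction t with
    | zero => rfl
    | succ t ih => simp only [run, ih]; rfl
  have hok : ∀ t (c : M.Cfg), c.Ok (pick t c) := by
    intro t c
    by_cases h : ∃ a, c.Ok a ∧ w[((t + 1 : ℕ) * (G + 2 : ℕ) + c.head + 2 : ℤ).toNat]? =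
      some (c.cell a c.head)
    · simp only [pick, dif_pos h]
      exact h.choose_spec.1
    · simp only [pick, dif_neg h]
      exact (exists_possible c.state (c.tape c.head)).choose_spec
  have hch : ch ∈ M.runs x := by
    intro t
    rw [hrun]
    exact hok _ _
  have hS := hS ch hch
  have key : ∀ p, p < L → w[p]? = some (M.layoutCell x S G ch p) := by
    intro p
    induction p using Nat.strong_induction_on with
    | _ p ih =>
      intro hp
      rcases Nat.eq_zero_or_pos p with rfl | hp0
      · rw [hw.zero]
        simp [layoutCell]
      · rcases le_or_gt p (G + 3) with hp1 | hp1
        · obtain ⟨j, rfl⟩ : ∃ j, p = j + 1 := ⟨p - 1, by omega⟩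
          rw [hw.first j (by omega), layoutCell_first hS hG (by omega)]
        · obtain ⟨q, rfl⟩ : ∃ q, p = q + 3 + G := ⟨p - 3 - G, by omega⟩
          obtain ⟨r, i, h1, h2, h3⟩ := exists_row (G := G) S x.length (p := q + 1) (by omega)
          obtain ⟨d, hd⟩ : ∃ d, w[q + 3 + G]? = some d :=
            ⟨w[q + 3 + G], List.getElem?_eq_getElem (by omega)⟩
          have hall := hw.next q (by omega) _ _ _ d (ih q (by omega) (by omega))
            (ih (q + 1) (by omega) (by omega)) (ih (q + 2) (by omega) (by omega)) hd
          rw [allowed_layoutCell_iff hS hG (r := r) (by omega) (by push_cast at h1 ⊢; linarith) h2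
            h3] at hall
          obtain ⟨a, ha, rfl⟩ := hall
          rw [layoutCell_eq hS (r := r + 1) (i := i) (by omega) (by push_cast at h1 ⊢; linarith)
            (by push_cast; omega) (by omega) hG]
          simp only [row]
          by_cases hi : i = (M.run x ch r).head
          · have hex : ∃ a, (cfg r).Ok a ∧
                w[((r + 1 : ℕ) * (G + 2 : ℕ) + (cfg r).head + 2 : ℤ).toNat]? =
                  some ((cfg r).cell a (cfg r).head) := by
              refine ⟨a, by rw [← hrun]; exact ha hi, ?_⟩
              rw [← hrun, ← hi, ← hd]
              congr 1
              push_cast at h1 ⊢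
              zify
              rw [Int.toNat_of_nonneg (by linarith)]
              linarith
            have e : ch r = hex.choose := by simp only [ch, pick, dif_pos hex]
            have h4 := hex.choose_spec.2
            rw [← e, ← hrun, ← hi] at h4
            rw [hd, ← h4, ← hd]
            congr 1
            push_cast at h1 ⊢
            zify
            rw [Int.toNat_of_nonneg (by linarith)]
            linarith
          · rw [hd]
            simp only [Cfg.cell, if_neg hi]
  refine ⟨ch, hch, List.ext_getElem? fun p => ?_⟩
  rcases lt_or_ge p L with hp | hp
  · rw [key p hp, getElem?_layoutWord _ hp]
  · rw [List.getElem?_eq_none (by omega), List.getElem?_eq_none (by simpa [layoutWord] using hp)]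

theorem run_congr {ch ch' : ℕ → Option M.Tr} {t : ℕ} (h : ∀ u < t, ch u = ch' u) :
    M.run x ch t = M.run x ch' t := by
  induction t with
  | zero => rfl
  | succ t ih => rw [run, run, ih (fun u hu => h u (by omega)), h t (by omega)]

theorem Possible.eq_none {q : M.Q} {a : M.Sym} {ch : Option M.Tr} (h : Possible q a ch)
    (h0 : M.δ q a = ∅) : ch = none := by
  cases ch with
  | none => rfl
  | some t =>
    change t ∈ M.δ q a at h
    simp [h0] at h

theorem apply_none (c : M.Cfg) : c.apply none = c := by
  ext1
  · rfl
  · simp [Cfg.apply, effect, Move.toInt]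
  · simp [Cfg.apply, effect]

theorem run_eq_of_halted {ch : ℕ → Option M.Tr} (hch : ch ∈ M.runs x) {T : ℕ}
    (hT : M.Halted (M.run x ch T)) : ∀ {t}, T ≤ t → M.run x ch t = M.run x ch T := by
  intro t ht
  induction t, ht using Nat.le_induction with
  | base => rfl
  | succ t ht ih =>
    have h := hch t
    rw [run, ih]
    rw [ih] at h
    rw [Possible.eq_none h hT, apply_none]

theorem choice_eq_none_of_halted {ch : ℕ → Option M.Tr} (hch : ch ∈ M.runs x) {T : ℕ}
    (hT : M.Halted (M.run x ch T)) {t : ℕ} (ht : T ≤ t) : ch t = none := by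
  have h := hch t
  rw [run_eq_of_halted hch hT ht] at h
  exact Possible.eq_none h hT

/-- The cells with the head show the choices, so a long enough word determines the computation. -/
theorem injOn_layoutWord {L : ℕ} (hS : ∀ ch ∈ M.runs x, ∀ t, |(M.run x ch t).head| ≤ S)
    (hG : 2 * margin S x.length ≤ G)
    (hT : ∀ ch ∈ M.runs x, M.Halted (M.run x ch T)) (hL : (T + 3) * (G + 2) ≤ L) :
    Set.InjOn (M.layoutWord x S G L) (M.runs x) := by
  intro ch hch ch' hch' h
  funext t
  induction t using Nat.strong_induction_on with
  | _ t ih =>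
    rcases le_or_gt T t with ht | ht
    · rw [choice_eq_none_of_halted hch (hT _ hch) ht, choice_eq_none_of_halted hch' (hT _ hch') ht]
    · have hr := run_congr (M := M) (x := x) ih
      have hb := hS ch hch t
      rw [abs_le] at hb
      obtain ⟨p, hp⟩ : ∃ p : ℕ, (p : ℤ) =
          (t + 1 : ℕ) * (G + 2 : ℕ) + (M.run x ch t).head + 2 := by
        refine ⟨((t + 1 : ℕ) * (G + 2 : ℕ) + (M.run x ch t).head + 2 : ℤ).toNat,
          Int.toNat_of_nonneg ?_⟩
        unfold margin at hG
        push_cast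
        nlinarith
      unfold margin at hG
      have hp1 : 1 ≤ p := by
        zify
        rw [hp]
        push_cast
        nlinarith
      have hpL : p < L := by
        have : ((t + 3 : ℕ) : ℤ) * (G + 2 : ℕ) ≤ L := by
          have : (t + 3) * (G + 2) ≤ (T + 3) * (G + 2) := Nat.mul_le_mul_right _ (by omega)
          exact_mod_cast this.trans hL
        zify
        rw [hp]
        push_cast at this ⊢
        nlinarith
      have h1 := congrArg (fun l => l[p]?) h
      simp only [getElem?_layoutWord _ hpL, Option.some.injEq] at h1
      rw [layoutCell_eq (hS ch hch) hp1 hp (by unfold margin; push_cast; omega)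
        (by unfold margin; push_cast; omega) (by unfold margin; omega),
        layoutCell_eq (hS ch' hch') hp1 hp (by unfold margin; push_cast; omega)
        (by unfold margin; push_cast; omega) (by unfold margin; omega)] at h1
      simp only [row, ← hr, Cfg.cell, if_true, Cell.head.injEq] at h1
      exact h1.2.2

/-- The cells of halted configurations with a state in `P`. -/
def haltCells (P : Set M.Q) : Set M.Cell := {c | ∃ q ∈ P, ∃ a, c = .head q a none}

theorem layoutWord_mem_haltCells_iff {L : ℕ} {ch : ℕ → Option M.Tr} (hch : ch ∈ M.runs x)
    (hS : ∀ t, |(M.run x ch t).head| ≤ S) (hG : 2 * margin S x.length ≤ G)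
    (hT : M.Halted (M.run x ch T)) (hL : (T + 3) * (G + 2) ≤ L) (P : Set M.Q) :
    (∃ c ∈ M.layoutWord x S G L ch, c ∈ haltCells P) ↔ (M.run x ch T).state ∈ P := by
  have hm : 2 ≤ margin S x.length := by unfold margin; omega
  constructor
  · rintro ⟨c, hc, q, hq, a, rfl⟩
    simp only [layoutWord, List.mem_map, List.mem_range] at hc
    obtain ⟨p, hp, hc⟩ := hc
    rcases Nat.eq_zero_or_pos p with rfl | hp0
    · simp [layoutCell] at hc
    · obtain ⟨r, i, h1, h2, h3⟩ := exists_row (G := G) S x.length hp0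
      rw [layoutCell_base hp0 h1 h2 h3] at hc
      cases r with
      | zero =>
        simp only [row] at hc
        split_ifs at hc
      | succ r =>
        simp only [row, Cfg.cell] at hc
        split_ifs at hc with hi
        simp only [Cell.head.injEq] at hc
        obtain ⟨rfl, -, h0⟩ := hc
        have hh : M.Halted (M.run x ch r) := by
          have := hch r
          rwa [h0] at this
        rcases le_total r T with hrT | hrT
        · rwa [run_eq_of_halted hch hh hrT]
        · rwa [← run_eq_of_halted hch hT hrT]
  · intro hP
    have hb := hS T
    rw [abs_le] at hb
    unfold margin at hG
    obtain ⟨p, hp⟩ : ∃ p : ℕ, (p : ℤ) =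
        (T + 1 : ℕ) * (G + 2 : ℕ) + (M.run x ch T).head + 2 := by
      refine ⟨((T + 1 : ℕ) * (G + 2 : ℕ) + (M.run x ch T).head + 2 : ℤ).toNat,
        Int.toNat_of_nonneg ?_⟩
      push_cast
      nlinarith
    have hp1 : 1 ≤ p := by
      zify
      rw [hp]
      push_cast
      nlinarith
    have hpL : p < L := by
      zify at hL ⊢
      rw [hp]
      push_cast
      nlinarith
    refine ⟨M.layoutCell x S G ch p, ?_, (M.run x ch T).state, hP,
      (M.run x ch T).tape (M.run x ch T).head, ?_⟩
    · exact List.mem_map.2 ⟨p, List.mem_range.2 hpL, rfl⟩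
    · rw [layoutCell_eq hS hp1 hp (by unfold margin; push_cast; omega)
        (by unfold margin; push_cast; omega) (by unfold margin; omega)]
      simp only [row, Cfg.cell, if_true, Cell.head.injEq, true_and]
      exact choice_eq_none_of_halted hch hT le_rfl

/-- Words that obey the rules and contain no halted configuration with a state in `P` correspond
to computations whose final state is not in `P`. -/
theorem ncard_valid {L : ℕ} (hS : ∀ ch ∈ M.runs x, ∀ t, |(M.run x ch t).head| ≤ S)
    (hG : 2 * margin S x.length ≤ G)
    (hT : ∀ ch ∈ M.runs x, M.Halted (M.run x ch T)) (hL : (T + 3) * (G + 2) ≤ L)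
    (P : Set M.Q) :
    {w : List M.Cell | w.length = L ∧ M.Valid x G w ∧ ∀ c ∈ w, c ∉ haltCells P}.ncard =
      {ch ∈ M.runs x | (M.run x ch T).state ∉ P}.ncard := by
  rw [← Set.InjOn.ncard_image ((injOn_layoutWord hS hG hT hL).mono (Set.sep_subset _ _))]
  congr 1
  ext w
  simp only [Set.mem_ofPred_eq, Set.mem_image]
  constructor
  · rintro ⟨h1, h2, h3⟩
    obtain ⟨ch, hch, rfl⟩ := exists_run_of_valid h2 h1 hS hG
    refine ⟨ch, ⟨hch, fun hP => ?_⟩, rfl⟩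
    obtain ⟨c, hc, hc'⟩ :=
      (layoutWord_mem_haltCells_iff hch (hS ch hch) hG (hT ch hch) hL P).2 hP
    exact h3 c hc hc'
  · rintro ⟨ch, ⟨hch, hP⟩, rfl⟩
    refine ⟨by simp [layoutWord], valid_layoutWord hch (hS ch hch) hG (by nlinarith),
      fun c hc hc' => hP ?_⟩
    exact (layoutWord_mem_haltCells_iff hch (hS ch hch) hG (hT ch hch) hL P).1 ⟨c, hc, hc'⟩

end NTM

end PosParikhHardness

namespace PosParikhHardness

/-! ### Violations of the rules -/

section Errors

variable {α C : Type}

/-- The data of the rules for words that describe a computation: the expected first row,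
depending on the input, the blank,
the forbidden combinations of three neighbouring cells and the cell in the next row, and the cells
that must not occur at all. -/
structure Rules (α C : Type) where
  marker : C
  blank : C
  expected : InputSymbol α → C
  Forbidden : C → C → C → C → Prop
  Avoid : C → Prop

variable (R : Rules α C) (x : List α)

/-- A wrong cell in the first row; the word begins in column `i`, and the columns below `N` are
examined. -/
def WrongPrefix (N i : ℕ) (u : List C) : Prop :=
  ∃ a d t, u = a ++ d :: t ∧ i + a.length < N ∧ d ≠ R.expected (inputAt x (i + a.length))

/-- A blank that is not followed by a blank, after at most `m` cells. -/
def WrongBlank (m : ℕ) (u : List C) : Prop :=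
  ∃ a d t, u = a ++ R.blank :: d :: t ∧ a.length ≤ m ∧ d ≠ R.blank

/-- After exactly `m` cells there is one that is forbidden in combination with `a`, `b`, `c`. -/
def WrongAfter (m : ℕ) (a b c : C) (u : List C) : Prop :=
  ∃ g v t, u = g ++ v :: t ∧ g.length = m ∧ R.Forbidden a b c v

/-- Somewhere the local rule is violated, or there is a cell that must be avoided. -/
def WrongInside (G : ℕ) (u : List C) : Prop :=
  ∃ p u', u = p ++ u' ∧ ((∃ a b c t, u' = a :: b :: c :: t ∧ WrongAfter R G a b c t) ∨
    ∃ d t, u' = d :: t ∧ R.Avoid d)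

/-- Some rule is violated. -/
def Wrong (N G : ℕ) (u : List C) : Prop :=
  ∃ c t, u = c :: t ∧ (c ≠ R.marker ∨ WrongPrefix R x N 0 t ∨
    (∃ c' t', t = c' :: t' ∧ WrongBlank R G t') ∨ WrongInside R G t)

variable {R} {x}

theorem WrongPrefix.cons {N i : ℕ} {u : List C} (h : WrongPrefix R x N (i + 1) u) (c : C) :
    WrongPrefix R x N i (c :: u) := by
  obtain ⟨a, d, t, rfl, h1, h2⟩ := h
  have e : i + (c :: a).length = i + 1 + a.length := by simp; omega
  exact ⟨c :: a, d, t, rfl, by rwa [e], by rwa [e]⟩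

theorem WrongBlank.cons {m : ℕ} {u : List C} (h : WrongBlank R m u) (c : C) :
    WrongBlank R (m + 1) (c :: u) := by
  obtain ⟨a, d, t, rfl, h1, h2⟩ := h
  exact ⟨c :: a, d, t, rfl, by simpa using h1, h2⟩

theorem WrongAfter.cons {m : ℕ} {a b c : C} {u : List C} (h : WrongAfter R m a b c u) (d : C) :
    WrongAfter R (m + 1) a b c (d :: u) := by
  obtain ⟨g, v, t, rfl, h1, h2⟩ := h
  exact ⟨d :: g, v, t, rfl, by simpa using h1, h2⟩

theorem WrongInside.cons {G : ℕ} {u : List C} (h : WrongInside R G u) (c : C) :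
    WrongInside R G (c :: u) := by
  obtain ⟨p, u', rfl, h⟩ := h
  exact ⟨c :: p, u', rfl, h⟩

theorem exists_eq_append_cons {u : List C} {p : ℕ} {d : C} (h : u[p]? = some d) :
    ∃ a t, u = a ++ d :: t ∧ a.length = p := by
  obtain ⟨hp, rfl⟩ := List.getElem?_eq_some_iff.1 h
  exact ⟨u.take p, u.drop (p + 1), by simp, by simp; omega⟩

end Errors

/-- The rules for the computations of `M`. -/
def NTM.rules {α : Type} (M : NTM α) (Avoid : Set M.Cell) : Rules α M.Cell where
  marker := .start
  blank := .plain none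
  expected := M.expected
  Forbidden a b c d := ¬ NTM.Allowed a b c d
  Avoid := (· ∈ Avoid)

theorem NTM.not_wrong_iff {α : Type} {M : NTM α} {x : List α} {Avoid : Set M.Cell}
    (hA : .start ∉ Avoid) {N G : ℕ} (hN : x.length + 2 ≤ N) (hG : N ≤ G + 3) {u : List M.Cell}
    (hu : G + 4 ≤ u.length) :
    ¬ Wrong (M.rules Avoid) x N G u ↔ M.Valid x G u ∧ ∀ c ∈ u, c ∉ Avoid := by
  obtain ⟨c, t, rfl⟩ : ∃ c t, u = c :: t := by
    cases u with
    | nil => simp at hu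
    | cons c t => exact ⟨c, t, rfl⟩
  have hblank : ∀ j, x.length < j → M.expected (inputAt x j) = .plain none := by
    intro j hj
    rw [inputAt_eq_rightEnd hj]
    rfl
  simp only [List.length_cons] at hu
  constructor
  · intro h
    have hc : c = .start := by
      by_contra hc
      exact h ⟨c, t, rfl, Or.inl hc⟩
    subst hc
    have first : ∀ j ≤ G + 2, t[j]? = some (M.expected (inputAt x j)) := by
      intro j hj
      induction j with
      | zero =>
        obtain ⟨d, hd⟩ : ∃ d, t[0]? = some d := ⟨t[0], List.getElem?_eq_getElem (by omega)⟩
        rw [hd]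
        by_contra hne
        obtain ⟨a, t', rfl, ha⟩ := exists_eq_append_cons hd
        refine h ⟨_, _, rfl, Or.inr (Or.inl ⟨a, d, t', rfl, by omega, ?_⟩)⟩
        rw [ha]
        exact fun e => hne (congrArg some e)
      | succ j ih =>
        have ih := ih (by omega)
        obtain ⟨d, hd⟩ : ∃ d, t[j + 1]? = some d :=
          ⟨t[j + 1], List.getElem?_eq_getElem (by omega)⟩
        rw [hd]
        by_contra hne
        rcases lt_or_ge (j + 1) N with hjN | hjN
        · obtain ⟨a, t', rfl, ha⟩ := exists_eq_append_cons hd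
          refine h ⟨_, _, rfl, Or.inr (Or.inl ⟨a, d, t', rfl, by omega, ?_⟩)⟩
          rw [zero_add, ha]
          exact fun e => hne (congrArg some e)
        · rw [hblank j (by omega)] at ih
          rw [hblank (j + 1) (by omega)] at hne
          obtain ⟨a, t', rfl, ha⟩ := exists_eq_append_cons ih
          obtain ⟨c', a, rfl⟩ : ∃ c' a', a = c' :: a' := by
            cases a with
            | nil => simp at ha; omega
            | cons c' a' => exact ⟨c', a', rfl⟩
          rw [List.getElem?_append_right (by omega), ha,
            show j + 1 - j = 0 + 1 by omega, List.getElem?_cons_succ] at hd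
          obtain ⟨e, t', rfl⟩ : ∃ e t'', t' = e :: t'' := by
            cases t' with
            | nil => simp at hd
            | cons e t' => exact ⟨e, t', rfl⟩
          simp only [List.getElem?_cons_zero, Option.some.injEq] at hd
          subst hd
          simp only [List.length_cons] at ha
          exact h ⟨_, _, rfl, Or.inr (Or.inr (Or.inl ⟨c', _, rfl, a, e, t', rfl, by omega,
            fun he => hne (congrArg some he)⟩))⟩
    refine ⟨⟨rfl, fun j hj => by simpa using first j hj, ?_⟩, ?_⟩
    · intro q hq a b c d ha hb hc hd
      by_contra hall
      obtain ⟨q, rfl⟩ : ∃ q', q = q' + 1 := ⟨q - 1, by omega⟩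
      simp only [show q + 1 + 1 = (q + 1) + 1 by omega, show q + 1 + 2 = (q + 2) + 1 by omega,
        show q + 1 + 3 + G = (q + 3 + G) + 1 by omega, List.getElem?_cons_succ] at ha hb hc hd
      obtain ⟨p, t, rfl, hp⟩ := exists_eq_append_cons ha
      rw [List.getElem?_append_right (by omega), hp] at hb hc hd
      rw [show q + 1 - q = 0 + 1 by omega, List.getElem?_cons_succ] at hb
      rw [show q + 2 - q = 1 + 1 by omega, List.getElem?_cons_succ] at hc
      rw [show q + 3 + G - q = (G + 2) + 1 by omega, List.getElem?_cons_succ] at hd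
      obtain ⟨p', t, rfl, hp'⟩ := exists_eq_append_cons hb
      obtain rfl : p' = [] := List.length_eq_zero_iff.1 hp'
      simp only [List.nil_append, List.getElem?_cons_succ] at hc hd
      obtain ⟨p', t, rfl, hp'⟩ := exists_eq_append_cons hc
      obtain rfl : p' = [] := List.length_eq_zero_iff.1 hp'
      simp only [List.nil_append, List.getElem?_cons_succ] at hd
      obtain ⟨g, t, rfl, hg⟩ := exists_eq_append_cons hd
      exact h ⟨_, _, rfl, Or.inr (Or.inr (Or.inr ⟨p, _, rfl,
        Or.inl ⟨a, b, c, _, rfl, g, d, t, rfl, hg, hall⟩⟩))⟩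
    · intro c hc hcA
      rcases List.mem_cons.1 hc with rfl | hc
      · exact hA hcA
      · obtain ⟨p, t, rfl⟩ := List.append_of_mem hc
        exact h ⟨_, _, rfl, Or.inr (Or.inr (Or.inr ⟨p, _, rfl, Or.inr ⟨c, t, rfl, hcA⟩⟩))⟩
  · rintro ⟨hv, hav⟩ ⟨c', t', e, h⟩
    obtain ⟨rfl, rfl⟩ := List.cons.inj e
    rcases h with h | ⟨a, d, t, rfl, h1, h2⟩ | ⟨c', t', rfl, a, d, t, rfl, h1, h2⟩ | ⟨p, u', rfl, h⟩
    · have := hv.zero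
      simp only [List.getElem?_cons_zero, Option.some.injEq] at this
      exact h this
    · have := hv.first a.length (by omega)
      simp only [List.getElem?_cons_succ, List.getElem?_append_right le_rfl, Nat.sub_self,
        List.getElem?_cons_zero, Option.some.injEq] at this
      rw [zero_add] at h2
      exact h2 this
    · have e1 := hv.first (a.length + 1) (by omega)
      have e2 := hv.first (a.length + 2) (by omega)
      simp only [List.getElem?_cons_succ, List.getElem?_append_right le_rfl, Nat.sub_self,
        List.getElem?_cons_zero, Option.some.injEq] at e1
      rw [List.getElem?_cons_succ, List.getElem?_cons_succ,
        List.getElem?_append_right (by omega), show a.length + 1 - a.length = 0 + 1 by omega,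
        List.getElem?_cons_succ, List.getElem?_cons_zero, Option.some.injEq] at e2
      have hlt : x.length < a.length + 1 := by
        by_contra hle
        have := inputAt_ne_rightEnd (x := x) (i := a.length + 1) (by omega)
        have e1 : Cell.plain none = M.expected (inputAt x (a.length + 1)) := e1
        revert this e1
        cases inputAt x (a.length + 1) <;> simp [expected]
      rw [hblank _ (by omega)] at e2
      exact h2 e2
    · rcases h with ⟨a, b, c, t, rfl, g, v, t, rfl, hg, hF⟩ | ⟨d, t, rfl, hd⟩
      · refine hF (hv.next (p.length + 1) (by omega) a b c v ?_ ?_ ?_ ?_)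
        · simp
        · rw [List.getElem?_cons_succ, List.getElem?_append_right (by omega)]
          simp
        · rw [show p.length + 1 + 2 = p.length + 2 + 1 by omega, List.getElem?_cons_succ,
            List.getElem?_append_right (by omega), show p.length + 2 - p.length = 2 by omega]
          simp
        · rw [show p.length + 1 + 3 + G = (p.length + 3 + G) + 1 by omega,
            List.getElem?_cons_succ, List.getElem?_append_right (by omega),
            show p.length + 3 + G - p.length = G + 1 + 1 + 1 by omega]
          simp [← hg]
      · exact hav d (by simp) hd

end PosParikhHardness

namespace PosParikhHardness

/-! ### Words over a finite alphabet as binary words -/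

section Coding

variable {C : Type} [Fintype C]

/-- A letter of a finite alphabet `C` as a word of length `|C|` with a single letter `1`, so that
all letters have the same Parikh image. -/
noncomputable def cellCode (c : C) : List Bool :=
  List.replicate (Fintype.equivFin C c) false ++
    true :: List.replicate (Fintype.card C - 1 - Fintype.equivFin C c) false

/-- The binary word for a word over `C`. -/
noncomputable def codeWord (u : List C) : List Bool := u.flatMap cellCode

@[simp] theorem codeWord_nil : codeWord ([] : List C) = [] := rfl

@[simp] theorem codeWord_cons (c : C) (u : List C) : codeWord (c :: u) = cellCode c ++ codeWord u :=
  rfl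

@[simp] theorem codeWord_append (u v : List C) : codeWord (u ++ v) = codeWord u ++ codeWord v := by
  simp [codeWord]

theorem cellCode_ne_nil (c : C) : cellCode c ≠ [] := by simp [cellCode]

theorem codeWord_ne_nil {u : List C} (h : u ≠ []) : codeWord u ≠ [] := by
  cases u with
  | nil => exact absurd rfl h
  | cons c u => simp [cellCode_ne_nil]

theorem count_true_codeWord (u : List C) : (codeWord u).count true = u.length := by
  induction u with
  | nil => rfl
  | cons c u ih => simp [cellCode, List.count_replicate, ih, add_comm]

theorem count_false_codeWord (u : List C) :
    (codeWord u).count false = (Fintype.card C - 1) * u.length := by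
  induction u with
  | nil => rfl
  | cons c u ih =>
    have h1 := (Fintype.equivFin C c).isLt
    have h2 : (cellCode c).count false = Fintype.card C - 1 := by
      rw [cellCode, List.count_append, List.count_replicate_self, List.count_cons_of_ne (by simp),
        List.count_replicate_self]
      omega
    rw [codeWord_cons, List.count_append, ih, h2, List.length_cons]
    ring

theorem codeWord_injective : Function.Injective (codeWord (C := C)) := by
  intro u
  induction u with
  | nil =>
    intro v h
    cases v with
    | nil => rfl
    | cons d v => exact absurd h.symm (codeWord_ne_nil (by simp))
  | cons c u ih =>
    intro v h
    cases v with
    | nil => exact absurd h (codeWord_ne_nil (by simp))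
    | cons d v =>
      simp only [codeWord_cons, cellCode, List.append_assoc, List.cons_append] at h
      obtain ⟨h1, h2⟩ := replicate_append_cons_inj (by simp) h
      obtain rfl : c = d := (Fintype.equivFin C).injective (Fin.ext h1)
      rw [ih (List.append_cancel_left h2)]

/-- The Parikh image of the binary words for words of length `L` over `C`. -/
def codeVector (C : Type) [Fintype C] (L : ℕ) : Bool → ℕ
  | false => (Fintype.card C - 1) * L
  | true => L

theorem parikh_codeWord_iff {u : List C} {L : ℕ} :
    parikh (codeWord u) = codeVector C L ↔ u.length = L := by
  constructor
  · intro h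
    have := congrFun h true
    simpa [parikh, count_true_codeWord, codeVector] using this
  · rintro rfl
    funext b
    cases b <;> simp [parikh, count_true_codeWord, count_false_codeWord, codeVector]

theorem parikhCount_codeVector {A : Language Bool} {P : List C → Prop}
    (h : ∀ w, w ∈ A ↔ ∃ u, w = codeWord u ∧ P u) (L : ℕ) :
    parikhCount A (codeVector C L) = {u | u.length = L ∧ P u}.ncard := by
  rw [← Set.ncard_image_of_injective _ (codeWord_injective (C := C)), parikhCount]
  congr 1
  ext w
  simp only [Set.mem_ofPred_eq, Set.mem_image]
  constructor
  · rintro ⟨h1, h2⟩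
    obtain ⟨u, rfl, hu⟩ := (h w).1 h1
    exact ⟨u, ⟨parikh_codeWord_iff.1 h2, hu⟩, rfl⟩
  · rintro ⟨u, ⟨h1, h2⟩, rfl⟩
    exact ⟨(h _).2 ⟨u, rfl, h2⟩, parikh_codeWord_iff.2 h1⟩

end Coding

/-! ### Indexed names and the loops that write them -/

section Rows

variable {κ α : Type}

/-- The name of the state (or nonterminal) of kind `k` with index `i`. States without an index get
the index `b ^ s`, which is written as the empty word. -/
def stateName (enc : κ → ℕ) (b s : ℕ) (k : κ) (i : ℕ) : Name :=
  List.replicate (enc k) true ++ false :: indexCode b s i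

theorem stateName_inj {enc : κ → ℕ} (henc : Function.Injective enc) {b s : ℕ} (hs : 0 < s)
    {k k' : κ} {i i' : ℕ} (hi : i ≤ b ^ s) (hi' : i' ≤ b ^ s)
    (h : stateName enc b s k i = stateName enc b s k' i') : k = k' ∧ i = i' := by
  obtain ⟨h1, h2⟩ := replicate_append_cons_inj (by simp) h
  exact ⟨henc h1, indexCode_injOn hs hi hi' h2⟩

/-- A part of the text that describes an acceptor: a token or a name, with or without index. -/
inductive Item (κ : Type) where
  | token (t : Token)
  | name (k : κ) (indexed : Bool)

/-- The text of an item if the current index is `i`. -/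
def Item.text (enc : κ → ℕ) (b s i : ℕ) : Item κ → List Token
  | token t => [t]
  | name k indexed => encodeName (stateName enc b s k (if indexed then i else b ^ s))

/-- The template for an item. -/
def Item.template (enc : κ → ℕ) : Item κ → List (Option Token)
  | token t => [some t]
  | name k indexed => List.replicate (enc k) (some (.bit true)) ++
      some (.bit false) :: ((if indexed then [none] else []) ++ [some .comma])

theorem fillTemplate_append (w : List Bool) (l l' : List (Option Token)) :
    fillTemplate w (l ++ l') = fillTemplate w l ++ fillTemplate w l' := by
  simp [fillTemplate]

theorem fillTemplate_map_some (w : List Bool) (l : List Token) :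
    fillTemplate w (l.map some) = l := by
  simp [fillTemplate, List.flatMap_map]

theorem fillTemplate_items (enc : κ → ℕ) (b s i : ℕ) (l : List (Item κ)) :
    fillTemplate (indexCode b s i) (l.flatMap (Item.template enc)) =
      l.flatMap (Item.text enc b s i) := by
  induction l with
  | nil => rfl
  | cons a l ih =>
    rw [List.flatMap_cons, List.flatMap_cons, fillTemplate_append, ih]
    congr 1
    cases a with
    | token t => simp [Item.template, Item.text, fillTemplate]
    | name k indexed =>
      rw [Item.template, fillTemplate_append, ← List.map_replicate, fillTemplate_map_some]
      cases indexed <;>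
        simp [Item.text, encodeName, stateName, fillTemplate, indexCode]

/-- A piece of text for every index `i`, subject to a condition on the symbol at position `i` of the
input; in `post` the index is `i + 1` instead of `i`. -/
structure Row (κ α : Type) where
  guard : InputSymbol α → Bool
  pre : List (Item κ)
  post : List (Item κ)

/-- The loop that writes a row. -/
def Row.loop (enc : κ → ℕ) (b : ℕ) (r : Row κ α) : Loop α :=
  ⟨b, r.guard, r.pre.flatMap (Item.template enc), r.post.flatMap (Item.template enc)⟩

theorem Row.output_loop (enc : κ → ℕ) (b s : ℕ) (r : Row κ α) (x : List α) :
    (r.loop enc b).output x s = (List.range (b ^ s)).flatMap fun i =>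
      if r.guard (inputAt x i) then
        r.pre.flatMap (Item.text enc b s i) ++ r.post.flatMap (Item.text enc b s (i + 1))
      else [] := by
  simp only [Loop.output, Row.loop, fillTemplate_items]

end Rows

/-! ### Automata given by families of edges -/

section Automata

variable {κ C α : Type}

/-- A family of edges of an automaton that reads words over `C`: for every `i < N` for which the
guard admits the symbol at position `i` of the input, there is an edge with label `word`. The source
has index `i` or no index, and the target has no index (`none`), index `i` (`some false`) or index
`i + 1` (`some true`). -/
structure Edge (κ C α : Type) where
  guard : InputSymbol α → Bool
  src : κ
  srcIndexed : Bool
  word : List C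
  dst : κ
  dstIndex : Option Bool

/-- The index that the target of an edge has. -/
def targetIndex (N i : ℕ) : Option Bool → ℕ
  | none => N
  | some false => i
  | some true => i + 1

/-- The edge with index `i` of a family. -/
def Edge.inst (N i : ℕ) (e : Edge κ C α) : (κ × ℕ) × List C × (κ × ℕ) :=
  ((e.src, if e.srcIndexed then i else N), e.word, (e.dst, targetIndex N i e.dstIndex))

/-- All edges of a list of families. -/
def edgeInsts (x : List α) (N : ℕ) (E : List (Edge κ C α)) : List ((κ × ℕ) × List C × (κ × ℕ)) :=
  E.flatMap fun e => (List.range N).flatMap fun i =>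
    if e.guard (inputAt x i) then [e.inst N i] else []

theorem mem_edgeInsts {x : List α} {N : ℕ} {E : List (Edge κ C α)}
    {t : (κ × ℕ) × List C × (κ × ℕ)} :
    t ∈ edgeInsts x N E ↔ ∃ e ∈ E, ∃ i < N, e.guard (inputAt x i) = true ∧ t = e.inst N i := by
  simp only [edgeInsts, List.mem_flatMap, List.mem_range]
  refine exists_congr fun e => and_congr_right fun _ => exists_congr fun i =>
    and_congr_right fun _ => ?_
  split_ifs with h <;> simp [h]

/-- `Run I f q u`: there is a path from `q` to `f` with label `u`. -/
inductive Run (I : List ((κ × ℕ) × List C × (κ × ℕ))) (f : κ × ℕ) : κ × ℕ → List C → Prop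
  | nil : Run I f f []
  | cons {p u q v} : (p, u, q) ∈ I → Run I f q v → Run I f p (u ++ v)

/-- Transitions that spell a binary word on the way from `p` to `q`. An intermediate state consists
of `q` and of the letters that are still to be read. -/
def spell (q : κ × ℕ) : (List Bool × κ) × ℕ → List Bool →
    List (((List Bool × κ) × ℕ) × Bool × ((List Bool × κ) × ℕ))
  | _, [] => []
  | p, a :: v => (p, a, ((v, q.1), q.2)) :: spell q ((v, q.1), q.2) v

/-- The name of a state. -/
def pairName (enc : List Bool × κ → ℕ) (b s : ℕ) (p : (List Bool × κ) × ℕ) : Name :=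
  stateName enc b s p.1 p.2

variable [Fintype C]

/-- The automaton that reads the binary words for the labels of the paths from `q₀` to `f`. -/
noncomputable def pathNFA (enc : List Bool × κ → ℕ) (b s : ℕ)
    (I : List ((κ × ℕ) × List C × (κ × ℕ))) (q₀ f : κ × ℕ) : NFAData where
  init := pairName enc b s (([], q₀.1), q₀.2)
  final := [pairName enc b s (([], f.1), f.2)]
  trans := I.flatMap fun e => (spell e.2.2 (([], e.1.1), e.1.2) (codeWord e.2.1)).map fun t =>
    (pairName enc b s t.1, t.2.1, pairName enc b s t.2.2)

/-- Acceptance from a state. -/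
def NFAData.AcceptsFrom (A : NFAData) : Name → List Bool → Prop
  | q, [] => q ∈ A.final
  | q, a :: w => ∃ q', (q, a, q') ∈ A.trans ∧ A.AcceptsFrom q' w

theorem NFAData.mem_language_iff (A : NFAData) (w : List Bool) :
    w ∈ A.language ↔ A.AcceptsFrom A.init w := by
  have key : ∀ (w : List Bool) (S : Set Name),
      (∃ q ∈ A.toNFA.accept, q ∈ A.toNFA.evalFrom S w) ↔ ∃ q ∈ S, A.AcceptsFrom q w := by
    intro w
    induction w with
    | nil =>
      intro S
      simp only [NFA.evalFrom_nil, AcceptsFrom, toNFA, Set.mem_ofPred_eq]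
      exact exists_congr fun q => and_comm
    | cons a w ih =>
      intro S
      rw [NFA.evalFrom_cons, ih]
      simp only [NFA.mem_stepSet, AcceptsFrom]
      constructor
      · rintro ⟨q', ⟨q, hq, h⟩, h'⟩
        exact ⟨q, hq, q', h, h'⟩
      · rintro ⟨q, hq, q', h, h'⟩
        exact ⟨q', ⟨q, hq, h⟩, h'⟩
  have h := key w {A.init}
  simp only [Set.mem_singleton_iff, exists_eq_left] at h
  exact h

theorem mem_spell {q : κ × ℕ} {v : List Bool} {p : (List Bool × κ) × ℕ}
    {t : ((List Bool × κ) × ℕ) × Bool × ((List Bool × κ) × ℕ)} (h : t ∈ spell q p v) :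
    (t.1 = p ∧ ∃ v', v = t.2.1 :: v' ∧ t.2.2 = ((v', q.1), q.2)) ∨
      ∃ v', t.1 = ((t.2.1 :: v', q.1), q.2) ∧ t.2.2 = ((v', q.1), q.2) := by
  induction v generalizing p with
  | nil => simp [spell] at h
  | cons a v ih =>
    rcases List.mem_cons.1 h with rfl | h
    · exact Or.inl ⟨rfl, v, rfl, rfl⟩
    · rcases ih h with ⟨h1, v', rfl, h2⟩ | h
      · exact Or.inr ⟨v', h1, h2⟩
      · exact Or.inr h

theorem mem_language_pathNFA {enc : List Bool × κ → ℕ} (henc : Function.Injective enc) {b s : ℕ}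
    (hs : 0 < s) {I : List ((κ × ℕ) × List C × (κ × ℕ))}
    (hI : ∀ e ∈ I, e.1.2 ≤ b ^ s ∧ e.2.1 ≠ [] ∧ e.2.2.2 ≤ b ^ s) {q₀ f : κ × ℕ}
    (hq₀ : q₀.2 ≤ b ^ s) (hf : f.2 ≤ b ^ s) (w : List Bool) :
    w ∈ (pathNFA enc b s I q₀ f).language ↔ ∃ u, w = codeWord u ∧ Run I f q₀ u := by
  rw [NFAData.mem_language_iff]
  have hinj : ∀ {p p' : (List Bool × κ) × ℕ}, p.2 ≤ b ^ s → p'.2 ≤ b ^ s →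
      pairName enc b s p = pairName enc b s p' → p = p' := by
    intro p p' h h' e
    obtain ⟨e1, e2⟩ := stateName_inj henc hs h h' e
    exact Prod.ext e1 e2
  constructor
  · have key : ∀ (w : List Bool) (p : (List Bool × κ) × ℕ), p.2 ≤ b ^ s →
        (pathNFA enc b s I q₀ f).AcceptsFrom (pairName enc b s p) w →
        ∃ u, w = p.1.1 ++ codeWord u ∧ Run I f (p.1.2, p.2) u := by
      intro w
      induction w with
      | nil =>
        intro p hp h
        simp only [NFAData.AcceptsFrom, pathNFA, List.mem_singleton] at h
        obtain rfl := hinj hp hf h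
        exact ⟨[], rfl, .nil⟩
      | cons a w ih =>
        rintro p hp ⟨n, h, h'⟩
        simp only [pathNFA, List.mem_flatMap, List.mem_map, Prod.mk.injEq] at h
        obtain ⟨e, he, t, ht, h1, rfl, rfl⟩ := h
        obtain ⟨he1, -, he3⟩ := hI e he
        rcases mem_spell ht with ⟨e1, v, e2, e3⟩ | ⟨v, e1, e3⟩
        · rw [e1] at h1
          obtain rfl := hinj (p := (([], e.1.1), e.1.2)) he1 hp h1
          rw [e3] at h'
          obtain ⟨u, rfl, hu⟩ := ih _ (by exact he3) h'
          refine ⟨e.2.1 ++ u, ?_, .cons he hu⟩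
          simp [e2]
        · rw [e1] at h1
          obtain rfl := hinj (p := ((t.2.1 :: v, e.2.2.1), e.2.2.2)) he3 hp h1
          rw [e3] at h'
          obtain ⟨u, rfl, hu⟩ := ih _ (by exact he3) h'
          exact ⟨u, rfl, hu⟩
    intro h
    exact key w (([], q₀.1), q₀.2) hq₀ h
  · rintro ⟨u, rfl, hu⟩
    have key : ∀ (q : κ × ℕ) (w v : List Bool) (p : (List Bool × κ) × ℕ), v ≠ [] →
        (∀ t ∈ spell q p v, (pairName enc b s t.1, t.2.1, pairName enc b s t.2.2) ∈
          (pathNFA enc b s I q₀ f).trans) →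
        (pathNFA enc b s I q₀ f).AcceptsFrom (pairName enc b s (([], q.1), q.2)) w →
        (pathNFA enc b s I q₀ f).AcceptsFrom (pairName enc b s p) (v ++ w) := by
      intro q w v
      induction v with
      | nil => intro p h; exact absurd rfl h
      | cons a v ih =>
        intro p _ ht h
        refine ⟨_, ht _ (List.mem_cons_self ..), ?_⟩
        rcases eq_or_ne v [] with rfl | hv
        · exact h
        · exact ih _ hv (fun t h => ht t (List.mem_cons_of_mem _ h)) h
    clear hq₀
    suffices h : ∀ q u, Run I f q u → (pathNFA enc b s I q₀ f).AcceptsFrom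
        (pairName enc b s (([], q.1), q.2)) (codeWord u) from h q₀ u hu
    intro q u hu
    induction hu with
    | nil => simp [NFAData.AcceptsFrom, pathNFA]
    | @cons p u q v he _ ih =>
      rw [codeWord_append]
      refine key q _ _ _ (codeWord_ne_nil (hI _ he).2.1) (fun t ht => ?_) ih
      simp only [pathNFA, List.mem_flatMap, List.mem_map]
      exact ⟨_, he, t, ht, rfl⟩

/-- The items of the transitions that spell the rest of a label. -/
def spellItems (k : κ) (indexed : Bool) : List Bool → List (Item (List Bool × κ))
  | [] => []
  | a :: v => .name (a :: v, k) indexed :: .token (.letter a) :: .name (v, k) indexed ::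
      spellItems k indexed v

/-- The row with the transitions of a family of edges. -/
noncomputable def Edge.row (e : Edge κ C α) : Row (List Bool × κ) α :=
  match codeWord e.word with
  | [] => ⟨e.guard, [], []⟩
  | a :: v =>
    let l := .name (v, e.dst) e.dstIndex.isSome :: spellItems e.dst e.dstIndex.isSome v
    ⟨e.guard, .name ([], e.src) e.srcIndexed :: .token (.letter a) ::
      (if e.dstIndex = some true then [] else l), if e.dstIndex = some true then l else []⟩

theorem text_spellItems (enc : List Bool × κ → ℕ) (b s i : ℕ) (k : κ) (indexed : Bool)
    (v : List Bool) :
    (spellItems k indexed v).flatMap (Item.text enc b s i) =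
      ((spell (k, if indexed then i else b ^ s) ((v, k), if indexed then i else b ^ s) v).map
        fun t => (pairName enc b s t.1, t.2.1, pairName enc b s t.2.2)).flatMap encodeTrans := by
  induction v with
  | nil => rfl
  | cons a v ih =>
    simp only [spellItems, spell, List.flatMap_cons, List.map_cons, ih]
    simp [Item.text, encodeTrans, pairName]

theorem Edge.guard_row (e : Edge κ C α) : e.row.guard = e.guard := by
  unfold Edge.row
  split <;> rfl

theorem Edge.text_row (enc : List Bool × κ → ℕ) (b s i : ℕ) (e : Edge κ C α) :
    e.row.pre.flatMap (Item.text enc b s i) ++ e.row.post.flatMap (Item.text enc b s (i + 1)) =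
      ((spell (e.inst (b ^ s) i).2.2 (([], (e.inst (b ^ s) i).1.1), (e.inst (b ^ s) i).1.2)
        (codeWord (e.inst (b ^ s) i).2.1)).map fun t =>
          (pairName enc b s t.1, t.2.1, pairName enc b s t.2.2)).flatMap encodeTrans := by
  unfold Edge.row
  simp only [Edge.inst]
  rcases codeWord e.word with _ | ⟨a, v⟩
  · rfl
  · rcases e.dstIndex with _ | _ | _ <;>
      simp [text_spellItems, spell, Item.text, encodeTrans, pairName, targetIndex]

/-- The loops of the families write the transitions of the automaton. -/
theorem output_edges (enc : List Bool × κ → ℕ) (b s : ℕ) (x : List α) (E : List (Edge κ C α))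
    (q₀ f : κ × ℕ) :
    (E.map fun e => e.row.loop enc b).flatMap (fun l => l.output x s) =
      (pathNFA enc b s (edgeInsts x (b ^ s) E) q₀ f).trans.flatMap encodeTrans := by
  simp only [pathNFA, edgeInsts, List.flatMap_map, List.flatMap_assoc, Row.output_loop]
  congr 1
  funext e
  congr 1
  funext i
  rw [e.guard_row]
  split_ifs
  · rw [e.text_row]
    simp [List.flatMap_map]
  · rfl

end Automata

end PosParikhHardness

namespace PosParikhHardness

/-! ### An automaton that finds violations of the rules -/

/-- The guard that admits index `0` only. -/
def onlyFirst {α : Type} : InputSymbol α → Bool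
  | .leftEnd => true
  | _ => false

theorem onlyFirst_inputAt {α : Type} (x : List α) (i : ℕ) :
    onlyFirst (inputAt x i) = true ↔ i = 0 := by
  cases i with
  | zero => simp [inputAt, onlyFirst]
  | succ i =>
    have := inputAt_succ_ne x i
    revert this
    cases inputAt x (i + 1) <;> simp [onlyFirst]

/-- The kinds of states of the automaton. In `sink` a violation has been found, in `idle` the cells
are skipped, in `gap a b c` the automaton waits for the cell below `b`, in `first` it compares the
first row with the input, and in `blanks` it looks for a blank followed by another cell. -/
inductive NKind (C : Type) where
  | init
  | idle
  | sink
  | gap (a b c : C)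
  | first
  | blanks

instance {C : Type} [Countable C] : Countable (NKind C) := by
  let f : NKind C → ℕ × Option (C × C × C) := fun k => match k with
    | .init => (0, none)
    | .idle => (1, none)
    | .sink => (2, none)
    | .gap a b c => (3, some (a, b, c))
    | .first => (4, none)
    | .blanks => (5, none)
  refine Function.Injective.countable (f := f) ?_
  intro k k' h
  cases k <;> cases k' <;> simp_all [f]

section Search

variable {α C : Type} [Fintype C]

open Classical in
/-- The families of edges of the automaton that finds violations of the rules. -/
noncomputable def searchEdges (R : Rules α C) : List (Edge (NKind C) C α) :=
  (Finset.univ : Finset (C × C × C × C)).toList.flatMap fun (a, b, c, d) =>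
    [⟨fun _ => true, .init, false, [a], .idle, none⟩,
     ⟨onlyFirst, .init, false, [a], .first, some false⟩,
     ⟨onlyFirst, .init, false, [a, b], .blanks, some false⟩,
     ⟨fun _ => a ≠ R.marker, .init, false, [a], .sink, none⟩,
     ⟨fun _ => true, .idle, false, [a], .idle, none⟩,
     ⟨fun _ => R.Avoid a, .idle, false, [a], .sink, none⟩,
     ⟨onlyFirst, .idle, false, [a, b, c], .gap a b c, some false⟩,
     ⟨fun _ => true, .gap a b c, true, [d], .gap a b c, some true⟩,
     ⟨fun _ => R.Forbidden a b c d, .gap a b c, false, [d], .sink, none⟩,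
     ⟨fun _ => true, .blanks, true, [a], .blanks, some true⟩,
     ⟨fun _ => a ≠ R.blank, .blanks, true, [R.blank, a], .sink, none⟩,
     ⟨fun _ => a ≠ R.blank, .blanks, false, [R.blank, a], .sink, none⟩,
     ⟨fun _ => true, .first, true, [a], .first, some true⟩,
     ⟨fun y => a ≠ R.expected y, .first, true, [a], .sink, none⟩,
     ⟨fun _ => true, .sink, false, [a], .sink, none⟩]

/-- The words that are accepted from a state. -/
def SearchLang (R : Rules α C) (x : List α) (N : ℕ) : NKind C × ℕ → List C → Prop
  | (.init, _), u => Wrong R x N N u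
  | (.idle, _), u => WrongInside R N u
  | (.sink, _), _ => True
  | (.gap a b c, i), u => WrongAfter R (N - i) a b c u
  | (.first, i), u => WrongPrefix R x N i u
  | (.blanks, i), u => WrongBlank R (N - i) u

variable {R : Rules α C} {x : List α} {N : ℕ}

theorem searchLang_of_run {q : NKind C × ℕ} {u : List C}
    (h : Run (edgeInsts x N (searchEdges R)) (.sink, N) q u) : SearchLang R x N q u := by
  induction h with
  | nil => trivial
  | @cons p u q v he _ ih =>
    simp only [mem_edgeInsts, searchEdges, List.mem_flatMap, Finset.mem_toList, Finset.mem_univ,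
      true_and, List.mem_cons, List.not_mem_nil, or_false] at he
    obtain ⟨e, ⟨⟨a, b, c, d⟩, he⟩, i, hi, hg, hinst⟩ := he
    dsimp only at he
    rcases he with rfl | rfl | rfl | rfl | rfl | rfl | rfl | rfl | rfl | rfl | rfl | rfl | rfl | rfl
        | rfl <;>
      simp only [Edge.inst, targetIndex, if_true, Bool.false_eq_true, if_false, Prod.mk.injEq,
        onlyFirst_inputAt, decide_eq_true_eq] at hinst hg <;>
      obtain ⟨rfl, rfl, rfl⟩ := hinst <;>
      simp only [SearchLang, List.cons_append, List.nil_append] at ih ⊢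
    · exact ⟨a, v, rfl, Or.inr (Or.inr (Or.inr ih))⟩
    · subst hg
      exact ⟨a, v, rfl, Or.inr (Or.inl ih)⟩
    · subst hg
      exact ⟨a, _, rfl, Or.inr (Or.inr (Or.inl ⟨b, v, rfl, ih⟩))⟩
    · exact ⟨a, v, rfl, Or.inl hg⟩
    · exact ih.cons a
    · exact ⟨[], _, rfl, Or.inr ⟨a, v, rfl, hg⟩⟩
    · subst hg
      exact ⟨[], _, rfl, Or.inl ⟨a, b, c, v, rfl, ih⟩⟩
    · have := ih.cons d
      rwa [show N - (i + 1) + 1 = N - i by omega] at this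
    · exact ⟨[], d, v, rfl, by simp, hg⟩
    · have := ih.cons a
      rwa [show N - (i + 1) + 1 = N - i by omega] at this
    · exact ⟨[], a, v, rfl, by simp, hg⟩
    · exact ⟨[], a, v, rfl, by simp, hg⟩
    · exact ih.cons a
    · exact ⟨[], a, v, rfl, by simpa using hi, by simpa using hg⟩

open Classical in
theorem run_of_wrong (hN : 0 < N) {u : List C} (h : Wrong R x N N u) :
    Run (edgeInsts x N (searchEdges R)) (.sink, N) (.init, N) u := by
  set I := edgeInsts x N (searchEdges R) with hI
  have step : ∀ (e : Edge (NKind C) C α) (i : ℕ) {q q' : NKind C × ℕ} {w v u : List C},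
      e ∈ searchEdges R → i < N → e.guard (inputAt x i) = true →
      e.inst N i = (q, w, q') → Run I (.sink, N) q' v → u = w ++ v → Run I (.sink, N) q u := by
    rintro e i q q' w v _ he hi hg hinst hv rfl
    have := mem_edgeInsts.2 ⟨e, he, i, hi, hg, rfl⟩
    rw [hinst] at this
    exact .cons this hv
  have quad : ∀ (a b c d : C) (e : Edge (NKind C) C α), _ → e ∈ searchEdges R :=
    fun a b c d e h => List.mem_flatMap.2 ⟨(a, b, c, d), by simp, h⟩
  have hfirst : ∀ i, i = 0 → onlyFirst (inputAt x i) = true := fun i => (onlyFirst_inputAt x i).2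
  have hsink : ∀ u, Run I (.sink, N) (.sink, N) u := by
    intro u
    induction u with
    | nil => exact .nil
    | cons a u ih =>
      exact step ⟨fun _ => true, .sink, false, [a], .sink, none⟩ 0 (quad a a a a _ (by simp)) hN
        rfl rfl ih rfl
  have hidle : ∀ p u, Run I (.sink, N) (.idle, N) u → Run I (.sink, N) (.idle, N) (p ++ u) := by
    intro p u hu
    induction p with
    | nil => exact hu
    | cons a p ih =>
      exact step ⟨fun _ => true, .idle, false, [a], .idle, none⟩ 0 (quad a a a a _ (by simp)) hN
        rfl rfl ih rfl
  have hgap : ∀ a b c v t, R.Forbidden a b c v → ∀ g i, i + g.length = N →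
      Run I (.sink, N) (.gap a b c, i) (g ++ v :: t) := by
    intro a b c v t hF g
    induction g with
    | nil =>
      intro i hi
      obtain rfl : i = N := hi
      exact step ⟨fun _ => R.Forbidden a b c v, .gap a b c, false, [v], .sink, none⟩ 0
        (quad a b c v _ (by simp)) hN (by simpa using hF) rfl (hsink t) rfl
    | cons d g ih =>
      intro i hi
      simp only [List.length_cons] at hi
      exact step ⟨fun _ => true, .gap a b c, true, [d], .gap a b c, some true⟩ i
        (quad a b c d _ (by simp)) (by omega) rfl rfl (ih (i + 1) (by omega)) rfl
  have hblanks : ∀ d t, d ≠ R.blank → ∀ a i, i + a.length ≤ N →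
      Run I (.sink, N) (.blanks, i) (a ++ R.blank :: d :: t) := by
    intro d t hd a
    induction a with
    | nil =>
      intro i hi
      rcases eq_or_lt_of_le hi with hi | hi
      · obtain rfl : i = N := hi
        exact step ⟨fun _ => d ≠ R.blank, .blanks, false, [R.blank, d], .sink, none⟩ 0
          (quad d d d d _ (by simp)) hN (by simpa using hd) rfl (hsink t) rfl
      · exact step ⟨fun _ => d ≠ R.blank, .blanks, true, [R.blank, d], .sink, none⟩ i
          (quad d d d d _ (by simp)) hi (by simpa using hd) rfl (hsink t) rfl
    | cons c a ih =>
      intro i hi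
      simp only [List.length_cons] at hi
      exact step ⟨fun _ => true, .blanks, true, [c], .blanks, some true⟩ i
        (quad c c c c _ (by simp)) (by omega) rfl rfl (ih (i + 1) (by omega)) rfl
  have hrow : ∀ d t a i, i + a.length < N → d ≠ R.expected (inputAt x (i + a.length)) →
      Run I (.sink, N) (.first, i) (a ++ d :: t) := by
    intro d t a
    induction a with
    | nil =>
      intro i hi hd
      exact step ⟨fun y => d ≠ R.expected y, .first, true, [d], .sink, none⟩ i
        (quad d d d d _ (by simp)) hi (by simpa using hd) rfl (hsink t) rfl
    | cons c a ih =>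
      intro i hi hd
      have e : i + 1 + a.length = i + (c :: a).length := by simp; omega
      exact step ⟨fun _ => true, .first, true, [c], .first, some true⟩ i
        (quad c c c c _ (by simp)) (by omega) rfl rfl (ih (i + 1) (by omega) (by rwa [e])) rfl
  obtain ⟨c, t, rfl, h | ⟨a, d, t, rfl, h1, h2⟩ | ⟨c', t, rfl, a, d, t, rfl, h1, h2⟩ |
    ⟨p, u', rfl, h⟩⟩ := h
  · exact step ⟨fun _ => c ≠ R.marker, .init, false, [c], .sink, none⟩ 0
      (quad c c c c _ (by simp)) hN (by simpa using h) rfl (hsink t) rfl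
  · exact step ⟨onlyFirst, .init, false, [c], .first, some false⟩ 0 (quad c c c c _ (by simp)) hN
      (hfirst 0 rfl) rfl (hrow d t a 0 h1 h2) rfl
  · exact step ⟨onlyFirst, .init, false, [c, c'], .blanks, some false⟩ 0
      (quad c c' c c _ (by simp)) hN (hfirst 0 rfl) rfl (hblanks d t h2 a 0 (by omega)) rfl
  · refine step ⟨fun _ => true, .init, false, [c], .idle, none⟩ 0
      (quad c c c c _ (by simp)) hN rfl rfl (hidle p u' ?_) rfl
    rcases h with ⟨a, b, c, t, rfl, g, v, t, rfl, hg, hF⟩ | ⟨d, t, rfl, hd⟩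
    · exact step ⟨onlyFirst, .idle, false, [a, b, c], .gap a b c, some false⟩ 0
        (quad a b c c _ (by simp)) hN (hfirst 0 rfl) rfl (hgap a b c v t hF g 0 (by omega)) rfl
    · exact step ⟨fun _ => R.Avoid d, .idle, false, [d], .sink, none⟩ 0
        (quad d d d d _ (by simp)) hN (by simpa using hd) rfl (hsink t) rfl

/-- An injective numbering of the states. -/
noncomputable def numbering (κ : Type) [Countable κ] : κ → ℕ :=
  (Countable.exists_injective_nat κ).choose

theorem numbering_injective (κ : Type) [Countable κ] : Function.Injective (numbering κ) :=
  (Countable.exists_injective_nat κ).choose_spec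

/-- The automaton that finds violations of the rules. -/
noncomputable def searchNFA (R : Rules α C) (b s : ℕ) (x : List α) : NFAData :=
  pathNFA (numbering _) b s (edgeInsts x (b ^ s) (searchEdges R)) (.init, b ^ s) (.sink, b ^ s)

theorem mem_language_searchNFA {b s : ℕ} (hb : 0 < b) (hs : 0 < s) (w : List Bool) :
    w ∈ (searchNFA R b s x).language ↔ ∃ u, w = codeWord u ∧ Wrong R x (b ^ s) (b ^ s) u := by
  have hN : 0 < b ^ s := Nat.pow_pos hb
  rw [searchNFA, mem_language_pathNFA (numbering_injective _) hs _ le_rfl le_rfl]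
  · refine exists_congr fun u => and_congr_right fun _ => ⟨searchLang_of_run, run_of_wrong hN⟩
  · intro e he
    simp only [mem_edgeInsts, searchEdges, List.mem_flatMap, Finset.mem_toList, Finset.mem_univ,
      true_and] at he
    obtain ⟨e, ⟨⟨a, b, c, d⟩, he⟩, i, hi, hg, rfl⟩ := he
    refine ⟨?_, ?_, ?_⟩
    · simp only [Edge.inst]
      split_ifs <;> omega
    · simp only [List.mem_cons, List.not_mem_nil, or_false] at he
      rcases he with rfl | rfl | rfl | rfl | rfl | rfl | rfl | rfl | rfl | rfl | rfl | rfl | rfl |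
        rfl | rfl <;> simp [Edge.inst]
    · simp only [Edge.inst]
      rcases e.dstIndex with _ | _ | _ <;> simp only [targetIndex] <;> omega

/-- A loop that writes a fixed text once. -/
def textLoop (l : List Token) : Loop α := ⟨1, fun _ => true, l.map some, []⟩

theorem output_textLoop (l : List Token) (s : ℕ) : (textLoop l : Loop α).output x s = l := by
  simp [textLoop, Loop.output, fillTemplate, List.flatMap_map]

/-- The loops that write the automaton. -/
noncomputable def searchNFALoops (R : Rules α C) (b : ℕ) : List (Loop α) :=
  textLoop (encodeName
      (List.replicate (numbering (List Bool × NKind C) ([], .init)) true ++ [false]) ++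
    encodeList encodeName
      [List.replicate (numbering (List Bool × NKind C) ([], .sink)) true ++ [false]]) ::
  ((searchEdges R).map fun e => e.row.loop (numbering _) b) ++ [textLoop [.semi]]

theorem output_searchNFALoops (R : Rules α C) (b s : ℕ) :
    (searchNFALoops R b).flatMap (fun l => l.output x s) = encodeNFA (searchNFA R b s x) := by
  rw [searchNFALoops, List.cons_append, List.flatMap_cons, List.flatMap_append,
    output_edges (numbering _) b s x (searchEdges R) (.init, b ^ s) (.sink, b ^ s)]
  simp [output_textLoop, encodeNFA, encodeList, searchNFA, pathNFA, pairName, stateName, indexCode]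

theorem base_searchNFALoops {b : ℕ} (hb : 0 < b) : ∀ l ∈ searchNFALoops R b, 0 < l.base := by
  intro l hl
  simp only [searchNFALoops, List.cons_append, List.mem_cons, List.mem_append, List.mem_map,
    List.not_mem_nil, or_false] at hl
  rcases hl with rfl | ⟨e, -, rfl⟩ | rfl
  · exact Nat.one_pos
  · exact hb
  · exact Nat.one_pos

end Search

end PosParikhHardness

namespace PosParikhHardness

/-! ### Grammars given by families of productions -/

section Grammars

variable {κ C α : Type}

/-- A family of productions of a grammar that generates words over `C`: there is a production for
every `i < N` for which the guard admits the symbol at position `i` of the input. The left-hand side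
has index `i` or no index. A nonterminal `(k, true)` of the right-hand side has an index, which is
`i + 1` if `shift` holds and `i` otherwise. -/
structure Production (κ C α : Type) where
  guard : InputSymbol α → Bool
  src : κ
  srcIndexed : Bool
  out : List (C ⊕ κ × Bool)
  shift : Bool

/-- A symbol of the right-hand side of the production with index `i` of a family. -/
def outSymbol (N i : ℕ) (shift : Bool) : C ⊕ κ × Bool → C ⊕ κ × ℕ
  | .inl c => .inl c
  | .inr (k, indexed) => .inr (k, if indexed then (if shift then i + 1 else i) else N)

/-- The production with index `i` of a family. -/
def Production.inst (N i : ℕ) (e : Production κ C α) : (κ × ℕ) × List (C ⊕ κ × ℕ) :=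
  ((e.src, if e.srcIndexed then i else N), e.out.map (outSymbol N i e.shift))

/-- All productions of a list of families. -/
def prodInsts (x : List α) (N : ℕ) (P : List (Production κ C α)) :
    List ((κ × ℕ) × List (C ⊕ κ × ℕ)) :=
  P.flatMap fun e => (List.range N).flatMap fun i =>
    if e.guard (inputAt x i) then [e.inst N i] else []

theorem mem_prodInsts {x : List α} {N : ℕ} {P : List (Production κ C α)}
    {t : (κ × ℕ) × List (C ⊕ κ × ℕ)} :
    t ∈ prodInsts x N P ↔ ∃ e ∈ P, ∃ i < N, e.guard (inputAt x i) = true ∧ t = e.inst N i := by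
  simp only [prodInsts, List.mem_flatMap, List.mem_range]
  refine exists_congr fun e => and_congr_right fun _ => exists_congr fun i =>
    and_congr_right fun _ => ?_
  split_ifs with h <;> simp [h]

/-- `Gen I l u`: the productions `I` derive the word `u` from the sentential form `l`. -/
inductive Gen (I : List ((κ × ℕ) × List (C ⊕ κ × ℕ))) : List (C ⊕ κ × ℕ) → List C → Prop
  | nil : Gen I [] []
  | cell {c l u} : Gen I l u → Gen I (.inl c :: l) (c :: u)
  | expand {p o l u v} : (p, o) ∈ I → Gen I o u → Gen I l v → Gen I (.inr p :: l) (u ++ v)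

/-- A word is obtained from a sentential form if words from the languages `V` are substituted for
the nonterminals. -/
def Matches (V : κ × ℕ → List C → Prop) : List (C ⊕ κ × ℕ) → List C → Prop
  | [], u => u = []
  | .inl c :: l, u => ∃ v, u = c :: v ∧ Matches V l v
  | .inr p :: l, u => ∃ u₁ u₂, u = u₁ ++ u₂ ∧ V p u₁ ∧ Matches V l u₂

variable {I : List ((κ × ℕ) × List (C ⊕ κ × ℕ))}

/-- Languages that are closed under the productions contain the derived words. -/
theorem Gen.matches {V : κ × ℕ → List C → Prop}
    (hV : ∀ p o, (p, o) ∈ I → ∀ u, Matches V o u → V p u) {l : List (C ⊕ κ × ℕ)} {u : List C}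
    (h : Gen I l u) : Matches V l u := by
  induction h with
  | nil => rfl
  | cell _ ih => exact ⟨_, rfl, ih⟩
  | expand he _ _ ih1 ih2 => exact ⟨_, _, rfl, hV _ _ he _ ih1, ih2⟩

theorem Gen.append {l l' : List (C ⊕ κ × ℕ)} {u v : List C} (h : Gen I l u) (h' : Gen I l' v) :
    Gen I (l ++ l') (u ++ v) := by
  induction h with
  | nil => exact h'
  | cell _ ih => exact .cell ih
  | expand he h1 _ _ ih2 =>
    rw [List.append_assoc]
    exact .expand he h1 ih2

theorem Gen.exists_of_append {l l' : List (C ⊕ κ × ℕ)} {u : List C} (h : Gen I (l ++ l') u) :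
    ∃ u₁ u₂, u = u₁ ++ u₂ ∧ Gen I l u₁ ∧ Gen I l' u₂ := by
  induction l generalizing u with
  | nil => exact ⟨[], u, rfl, .nil, h⟩
  | cons a l ih =>
    rcases h with _ | h | ⟨he, h1, h2⟩
    · obtain ⟨u₁, u₂, rfl, h1, h2⟩ := ih h
      exact ⟨_, _, rfl, .cell h1, h2⟩
    · obtain ⟨u₁, u₂, rfl, h3, h4⟩ := ih h2
      exact ⟨_, _, (List.append_assoc ..).symm, .expand he h1 h3, h4⟩

theorem gen_of_matches {l : List (C ⊕ κ × ℕ)} {u : List C}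
    (h : Matches (fun p => Gen I [.inr p]) l u) : Gen I l u := by
  induction l generalizing u with
  | nil =>
    obtain rfl : u = [] := h
    exact .nil
  | cons a l ih =>
    rcases a with c | p
    · obtain ⟨v, rfl, h⟩ := h
      exact .cell (ih h)
    · obtain ⟨u₁, u₂, rfl, h1, h2⟩ := h
      exact h1.append (ih h2)

/-- The languages of the nonterminals are closed under the productions. -/
theorem Gen.of_mem {p : κ × ℕ} {o : List (C ⊕ κ × ℕ)} (he : (p, o) ∈ I) {u : List C}
    (h : Matches (fun p => Gen I [.inr p]) o u) : Gen I [.inr p] u := by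
  rw [← List.append_nil u]
  exact .expand he (gen_of_matches h) .nil

/-- The name of a nonterminal. -/
def ntName (enc : κ → ℕ) (b s : ℕ) (p : κ × ℕ) : Name := stateName enc b s p.1 p.2

variable [Fintype C]

/-- A sentential form over the letters `0`, `1` and the names of the nonterminals. -/
noncomputable def codeSymbols (enc : κ → ℕ) (b s : ℕ) (l : List (C ⊕ κ × ℕ)) :
    List (Symbol Bool Name) :=
  l.flatMap fun a => match a with
    | .inl c => (cellCode c).map .terminal
    | .inr p => [.nonterminal (ntName enc b s p)]

/-- The grammar that generates the binary words for the words derived by the productions `I`. -/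
noncomputable def codeCFG (enc : κ → ℕ) (b s : ℕ) (I : List ((κ × ℕ) × List (C ⊕ κ × ℕ)))
    (q₀ : κ × ℕ) : CFGData where
  start := ntName enc b s q₀
  prods := I.map fun e => ⟨ntName enc b s e.1, codeSymbols enc b s e.2⟩

theorem CFGData.mem_rules_iff (G : CFGData) (r : ContextFreeRule Bool Name) :
    r ∈ G.toGrammar.rules ↔ r ∈ G.prods := List.mem_toFinset

theorem codeSymbols_append (enc : κ → ℕ) (b s : ℕ) (l l' : List (C ⊕ κ × ℕ)) :
    codeSymbols enc b s (l ++ l') = codeSymbols enc b s l ++ codeSymbols enc b s l' := by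
  simp [codeSymbols]

theorem codeSymbols_cons (enc : κ → ℕ) (b s : ℕ) (a : C ⊕ κ × ℕ) (l : List (C ⊕ κ × ℕ)) :
    codeSymbols enc b s (a :: l) = codeSymbols enc b s [a] ++ codeSymbols enc b s l := by
  simp [codeSymbols]

theorem exists_of_map_terminal_append {t : List Bool} {r p q : List (Symbol Bool Name)} {n : Name}
    (h : t.map Symbol.terminal ++ r = p ++ .nonterminal n :: q) :
    ∃ p', p = t.map Symbol.terminal ++ p' ∧ r = p' ++ .nonterminal n :: q := by
  induction t generalizing p with
  | nil => exact ⟨p, rfl, h⟩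
  | cons a t ih =>
    cases p with
    | nil => simp at h
    | cons y p =>
      simp only [List.map_cons, List.cons_append, List.cons.injEq] at h
      obtain ⟨rfl, h⟩ := h
      obtain ⟨p', rfl, h'⟩ := ih h
      exact ⟨p', by simp, h'⟩

theorem exists_of_codeSymbols_eq {enc : κ → ℕ} {b s : ℕ} {l : List (C ⊕ κ × ℕ)}
    {p q : List (Symbol Bool Name)} {n : Name}
    (h : codeSymbols enc b s l = p ++ .nonterminal n :: q) :
    ∃ l₁ r l₂, l = l₁ ++ .inr r :: l₂ ∧ p = codeSymbols enc b s l₁ ∧ ntName enc b s r = n ∧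
      q = codeSymbols enc b s l₂ := by
  induction l generalizing p with
  | nil => simp [codeSymbols] at h
  | cons a l ih =>
    rw [codeSymbols_cons] at h
    rcases a with c | r
    · have e : codeSymbols enc b s [(.inl c : C ⊕ κ × ℕ)] = (cellCode c).map .terminal := by
        simp [codeSymbols]
      rw [e] at h
      obtain ⟨p', rfl, h'⟩ := exists_of_map_terminal_append h
      obtain ⟨l₁, r, l₂, rfl, rfl, hr, rfl⟩ := ih h'
      exact ⟨.inl c :: l₁, r, l₂, rfl, by rw [codeSymbols_cons, e], hr, rfl⟩
    · have e : codeSymbols enc b s [(.inr r : C ⊕ κ × ℕ)] =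
          [.nonterminal (ntName enc b s r)] := by simp [codeSymbols]
      rw [e] at h
      cases p with
      | nil =>
        simp only [List.cons_append, List.nil_append, List.cons.injEq,
          Symbol.nonterminal.injEq] at h
        exact ⟨[], r, l, rfl, rfl, h.1, h.2.symm⟩
      | cons y p =>
        simp only [List.cons_append, List.nil_append, List.cons.injEq] at h
        obtain ⟨rfl, h⟩ := h
        obtain ⟨l₁, r', l₂, rfl, rfl, hr, rfl⟩ := ih h
        exact ⟨.inr r :: l₁, r', l₂, rfl, by rw [codeSymbols_cons, e]; rfl, hr, rfl⟩

theorem gen_of_map_terminal_eq {enc : κ → ℕ} {b s : ℕ} {l : List (C ⊕ κ × ℕ)} {w : List Bool}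
    (h : codeSymbols enc b s l = w.map .terminal) : ∃ u, w = codeWord u ∧ Gen I l u := by
  induction l generalizing w with
  | nil =>
    have : w = [] := by simpa [codeSymbols] using h.symm
    exact ⟨[], this, .nil⟩
  | cons a l ih =>
    rcases a with c | r
    · obtain ⟨w₁, w₂, rfl, h1, h2⟩ := List.map_eq_append_iff.1 h.symm
      obtain ⟨u, rfl, hu⟩ := ih (w := w₂) h2.symm
      obtain rfl := List.map_injective_iff.2 (fun _ _ e => Symbol.terminal.inj e) h1
      exact ⟨c :: u, by simp, .cell hu⟩
    · cases w <;> simp [codeSymbols] at h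

theorem mem_language_codeCFG {enc : κ → ℕ} (henc : Function.Injective enc) {b s : ℕ} (hs : 0 < s)
    (hI : ∀ p o, (p, o) ∈ I → p.2 ≤ b ^ s ∧ ∀ r, .inr r ∈ o → r.2 ≤ b ^ s) {q₀ : κ × ℕ}
    (hq₀ : q₀.2 ≤ b ^ s) (w : List Bool) :
    w ∈ (codeCFG enc b s I q₀).language ↔ ∃ u, w = codeWord u ∧ Gen I [.inr q₀] u := by
  have hinj : ∀ {p p' : κ × ℕ}, p.2 ≤ b ^ s → p'.2 ≤ b ^ s →
      ntName enc b s p = ntName enc b s p' → p = p' := by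
    intro p p' h h' e
    obtain ⟨e1, e2⟩ := stateName_inj henc hs h h' e
    exact Prod.ext e1 e2
  rw [CFGData.language, ContextFreeGrammar.mem_language_iff]
  have e0 : ([.nonterminal (ntName enc b s q₀)] : List (Symbol Bool Name)) =
      codeSymbols enc b s ([.inr q₀] : List (C ⊕ κ × ℕ)) := by simp [codeSymbols]
  constructor
  · intro h
    have key : ∀ β : List (Symbol Bool Name),
        (codeCFG enc b s I q₀).toGrammar.Derives β (w.map .terminal) →
        ∀ l : List (C ⊕ κ × ℕ), (∀ r, .inr r ∈ l → r.2 ≤ b ^ s) → codeSymbols enc b s l = β →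
        ∃ u, w = codeWord u ∧ Gen I l u := by
      intro β hβ
      induction hβ using Relation.ReflTransGen.head_induction_on with
      | refl => exact fun l _ h => gen_of_map_terminal_eq h
      | @head β γ hp _ ih =>
        rintro l hl rfl
        obtain ⟨r, hr, hp⟩ := hp
        obtain ⟨p, q, e1, e2⟩ := hp.exists_parts
        obtain ⟨⟨p', o⟩, he, rfl⟩ := List.mem_map.1 ((CFGData.mem_rules_iff _ _).1 hr)
        rw [List.append_assoc] at e1
        obtain ⟨l₁, r, l₂, rfl, rfl, hn, rfl⟩ := exists_of_codeSymbols_eq e1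
        obtain rfl := hinj (hl r (by simp)) (hI _ _ he).1 hn
        obtain ⟨u, rfl, hu⟩ := ih (l₁ ++ o ++ l₂) (by
          intro r' hr'
          simp only [List.mem_append] at hr'
          rcases hr' with (h | h) | h
          · exact hl r' (by simp [h])
          · exact (hI _ _ he).2 r' h
          · exact hl r' (by simp [h])) (by rw [codeSymbols_append, codeSymbols_append, e2]; rfl)
        rw [List.append_assoc] at hu
        obtain ⟨u₁, u₂, rfl, h1, h2⟩ := hu.exists_of_append
        obtain ⟨u₂, u₃, rfl, h2, h3⟩ := h2.exists_of_append
        exact ⟨_, rfl, h1.append (.expand he h2 h3)⟩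
    refine key _ h [.inr q₀] (fun r hr => ?_) e0.symm
    simp only [List.mem_singleton, Sum.inr.injEq] at hr
    rwa [hr]
  · rintro ⟨u, rfl, hu⟩
    suffices key : ∀ l u, Gen I l u → (codeCFG enc b s I q₀).toGrammar.Derives
        (codeSymbols enc b s l) ((codeWord u).map .terminal) by
      have := key _ _ hu
      rw [← e0] at this
      exact this
    intro l u h
    induction h with
    | nil => exact Relation.ReflTransGen.refl
    | @cell c l u _ ih =>
      rw [codeSymbols_cons, codeWord_cons, List.map_append]
      have e : codeSymbols enc b s [(.inl c : C ⊕ κ × ℕ)] = (cellCode c).map .terminal := by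
        simp [codeSymbols]
      rw [e]
      exact ih.append_left _
    | @expand p o l u v he _ _ ih1 ih2 =>
      have e : codeSymbols enc b s [(.inr p : C ⊕ κ × ℕ)] =
          [.nonterminal (ntName enc b s p)] := by simp [codeSymbols]
      rw [codeSymbols_cons, codeWord_append, List.map_append, e]
      have h1 : (codeCFG enc b s I q₀).toGrammar.Produces
          [.nonterminal (ntName enc b s p)] (codeSymbols enc b s o) := by
        exact ⟨⟨ntName enc b s p, codeSymbols enc b s o⟩,
          (CFGData.mem_rules_iff _ _).2 (List.mem_map.2 ⟨_, he, rfl⟩),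
          ContextFreeRule.Rewrites.input_output⟩
      exact (((h1.trans_derives ih1).append_right _)).trans (ih2.append_left _)

/-- The items for the right-hand side of a production. -/
noncomputable def outItems (o : List (C ⊕ κ × Bool)) : List (Item κ) :=
  (o.flatMap fun a => match a with
    | .inl c => (cellCode c).map fun a => .token (.letter a)
    | .inr (k, indexed) => [.name k indexed]) ++ [.token .semi]

/-- The row with the productions of a family. -/
noncomputable def Production.row (e : Production κ C α) : Row κ α :=
  ⟨e.guard, .name e.src e.srcIndexed :: (if e.shift then [] else outItems e.out),
    if e.shift then outItems e.out else []⟩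

theorem text_outItems (enc : κ → ℕ) (b s i : ℕ) (shift : Bool) (o : List (C ⊕ κ × Bool)) :
    (outItems o).flatMap (Item.text enc b s (if shift then i + 1 else i)) =
      encodeList encodeSymbol (codeSymbols enc b s (o.map (outSymbol (b ^ s) i shift))) := by
  rw [outItems, encodeList, List.flatMap_append]
  congr 1
  induction o with
  | nil => rfl
  | cons a o ih =>
    rw [List.flatMap_cons, List.flatMap_append, ih, List.map_cons, codeSymbols_cons,
      List.flatMap_append]
    congr 1
    rcases a with c | ⟨k, indexed⟩
    · simp only [outSymbol, codeSymbols, List.flatMap_cons, List.flatMap_nil, List.append_nil,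
        List.flatMap_map, Item.text, encodeSymbol]
    · simp [outSymbol, codeSymbols, Item.text, encodeSymbol, ntName]

theorem Production.text_row (enc : κ → ℕ) (b s i : ℕ) (e : Production κ C α) :
    e.row.pre.flatMap (Item.text enc b s i) ++ e.row.post.flatMap (Item.text enc b s (i + 1)) =
      encodeProd ⟨ntName enc b s (e.inst (b ^ s) i).1,
        codeSymbols enc b s (e.inst (b ^ s) i).2⟩ := by
  have h := text_outItems enc b s i e.shift e.out
  unfold Production.row
  simp only [encodeProd, Production.inst]
  rw [← h]
  cases e.shift <;> simp [Item.text, ntName]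

/-- The loops of the families write the productions of the grammar. -/
theorem output_prods (enc : κ → ℕ) (b s : ℕ) (x : List α) (P : List (Production κ C α))
    (q₀ : κ × ℕ) :
    (P.map fun e => e.row.loop enc b).flatMap (fun l => l.output x s) =
      (codeCFG enc b s (prodInsts x (b ^ s) P) q₀).prods.flatMap encodeProd := by
  simp only [codeCFG, prodInsts, List.flatMap_map, List.flatMap_assoc, Row.output_loop]
  congr 1
  funext e
  congr 1
  funext i
  have hg : e.row.guard = e.guard := rfl
  rw [hg]
  split_ifs
  · rw [e.text_row]
    simp
  · rfl

end Grammars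

end PosParikhHardness

namespace PosParikhHardness

/-! ### A grammar that finds violations of the rules -/

/-- The kinds of nonterminals of the grammar. From `sink` all words are derived, from `power` with
index `i` the words of length `2 ^ (N - i)`, and from `atMost` with index `i` the words of length at
most `2 ^ (N - i)`. From `init`, `idle` and `first` the violations are derived. -/
inductive GKind where
  | init
  | idle
  | sink
  | first
  | power
  | atMost

/-- A numbering of the kinds. -/
def GKind.toNat : GKind → ℕ
  | .init => 0
  | .idle => 1
  | .sink => 2
  | .first => 3
  | .power => 4
  | .atMost => 5

theorem GKind.toNat_injective : Function.Injective GKind.toNat := by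
  intro k k' h
  cases k <;> cases k' <;> simp_all [GKind.toNat]

section Search

variable {α C : Type} [Fintype C]

open Classical in
/-- The families of productions of the grammar that finds violations of the rules. The nonterminals
`power` and `atMost` with index `N` have the index that unindexed symbols get. -/
noncomputable def searchProds (R : Rules α C) : List (Production GKind C α) :=
  (Finset.univ : Finset (C × C × C × C)).toList.flatMap fun (a, b, c, d) =>
    [⟨fun _ => true, .init, false, [.inl a, .inr (.idle, false)], false⟩,
     ⟨onlyFirst, .init, false, [.inl a, .inr (.first, true)], false⟩,
     ⟨fun y => onlyFirst y && decide (d ≠ R.blank), .init, false,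
       [.inl a, .inl b, .inr (.atMost, true), .inl R.blank, .inl d, .inr (.sink, false)], false⟩,
     ⟨fun _ => a ≠ R.marker, .init, false, [.inl a, .inr (.sink, false)], false⟩,
     ⟨fun _ => true, .idle, false, [.inl a, .inr (.idle, false)], false⟩,
     ⟨fun _ => R.Avoid a, .idle, false, [.inl a, .inr (.sink, false)], false⟩,
     ⟨fun y => onlyFirst y && decide (R.Forbidden a b c d), .idle, false,
       [.inl a, .inl b, .inl c, .inr (.power, true), .inl d, .inr (.sink, false)], false⟩,
     ⟨fun _ => true, .first, true, [.inl a, .inr (.first, true)], true⟩,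
     ⟨fun y => a ≠ R.expected y, .first, true, [.inl a, .inr (.sink, false)], false⟩,
     ⟨fun _ => true, .sink, false, [.inl a, .inr (.sink, false)], false⟩,
     ⟨fun _ => true, .sink, false, [], false⟩,
     ⟨fun _ => true, .power, true, [.inr (.power, true), .inr (.power, true)], true⟩,
     ⟨fun _ => true, .power, false, [.inl a], false⟩,
     ⟨fun _ => true, .atMost, true, [.inr (.atMost, true), .inr (.atMost, true)], true⟩,
     ⟨fun _ => true, .atMost, false, [.inl a], false⟩,
     ⟨fun _ => true, .atMost, false, [], false⟩]

/-- The words that are derived from a nonterminal. -/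
def GenLang (R : Rules α C) (x : List α) (N : ℕ) : GKind × ℕ → List C → Prop
  | (.init, _), u => Wrong R x N (2 ^ N) u
  | (.idle, _), u => WrongInside R (2 ^ N) u
  | (.sink, _), _ => True
  | (.first, i), u => WrongPrefix R x N i u
  | (.power, i), u => u.length = 2 ^ (N - i)
  | (.atMost, i), u => u.length ≤ 2 ^ (N - i)

variable {R : Rules α C} {x : List α} {N : ℕ}

theorem genLang_of_matches (p : GKind × ℕ) (o : List (C ⊕ GKind × ℕ))
    (he : (p, o) ∈ prodInsts x N (searchProds R)) (u : List C)
    (h : Matches (GenLang R x N) o u) : GenLang R x N p u := by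
  have pow : ∀ i < N, 2 ^ (N - i) = 2 ^ (N - (i + 1)) + 2 ^ (N - (i + 1)) := by
    intro i hi
    rw [show N - i = N - (i + 1) + 1 by omega, pow_succ]
    omega
  simp only [mem_prodInsts, searchProds, List.mem_flatMap, Finset.mem_toList, Finset.mem_univ,
    true_and, List.mem_cons, List.not_mem_nil, or_false] at he
  obtain ⟨e, ⟨⟨a, b, c, d⟩, he⟩, i, hi, hg, hinst⟩ := he
  dsimp only at he
  rcases he with rfl | rfl | rfl | rfl | rfl | rfl | rfl | rfl | rfl | rfl | rfl | rfl | rfl | rfl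
      | rfl | rfl <;>
    simp only [Production.inst, outSymbol, List.map_cons, List.map_nil, if_true,
      Bool.false_eq_true, if_false, Prod.mk.injEq, onlyFirst_inputAt, decide_eq_true_eq,
      Bool.and_eq_true] at hinst hg <;>
    obtain ⟨rfl, rfl⟩ := hinst <;>
    simp only [GenLang, Matches] at h ⊢
  · obtain ⟨_, rfl, v, _, rfl, h, rfl⟩ := h
    exact ⟨a, _, rfl, Or.inr (Or.inr (Or.inr (by simpa using h)))⟩
  · obtain ⟨_, rfl, v, _, rfl, h, rfl⟩ := h
    subst hg
    exact ⟨a, _, rfl, Or.inr (Or.inl (by simpa using h))⟩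
  · obtain ⟨_, rfl, _, rfl, v, _, rfl, h, _, rfl, _, rfl, t, _, rfl, -, rfl⟩ := h
    obtain ⟨rfl, hd⟩ := hg
    exact ⟨a, _, rfl, Or.inr (Or.inr (Or.inl ⟨b, _, rfl, v, d, t, by simp, by simpa using h, hd⟩))⟩
  · obtain ⟨_, rfl, v, _, rfl, h, rfl⟩ := h
    exact ⟨a, _, rfl, Or.inl hg⟩
  · obtain ⟨_, rfl, v, _, rfl, h, rfl⟩ := h
    simpa using h.cons a
  · obtain ⟨_, rfl, v, _, rfl, h, rfl⟩ := h
    exact ⟨[], _, rfl, Or.inr ⟨a, _, rfl, hg⟩⟩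
  · obtain ⟨_, rfl, _, rfl, _, rfl, v, _, rfl, h, _, rfl, t, _, rfl, -, rfl⟩ := h
    obtain ⟨rfl, hd⟩ := hg
    exact ⟨[], _, rfl, Or.inl ⟨a, b, c, _, rfl, v, d, t, by simp, by simpa using h, hd⟩⟩
  · obtain ⟨_, rfl, v, _, rfl, h, rfl⟩ := h
    simpa using h.cons a
  · obtain ⟨_, rfl, v, _, rfl, h, rfl⟩ := h
    exact ⟨[], a, v, by simp, by simpa using hi, by simpa using hg⟩
  · obtain ⟨v, w, rfl, h1, v', _, rfl, h2, rfl⟩ := h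
    simp only [List.append_nil, List.length_append]
    rw [pow i hi]
    omega
  · obtain ⟨_, rfl, rfl⟩ := h
    simp
  · obtain ⟨v, w, rfl, h1, v', _, rfl, h2, rfl⟩ := h
    simp only [List.append_nil, List.length_append]
    rw [pow i hi]
    omega
  · obtain ⟨_, rfl, rfl⟩ := h
    simp
  · subst h
    simp

open Classical in
theorem gen_of_wrong (hN : 0 < N) {u : List C} (h : Wrong R x N (2 ^ N) u) :
    Gen (prodInsts x N (searchProds R)) [.inr (.init, N)] u := by
  set I := prodInsts x N (searchProds R) with hI
  have step : ∀ (e : Production GKind C α) (i : ℕ) {q : GKind × ℕ} {o : List (C ⊕ GKind × ℕ)}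
      {u : List C}, e ∈ searchProds R → i < N → e.guard (inputAt x i) = true →
      e.inst N i = (q, o) → Matches (fun p => Gen I [.inr p]) o u → Gen I [.inr q] u := by
    intro e i q o u he hi hg hinst hv
    have := mem_prodInsts.2 ⟨e, he, i, hi, hg, rfl⟩
    rw [hinst] at this
    exact .of_mem this hv
  have quad : ∀ (a b c d : C) (e : Production GKind C α), _ → e ∈ searchProds R :=
    fun a b c d e h => List.mem_flatMap.2 ⟨(a, b, c, d), by simp, h⟩
  have hfirst : onlyFirst (inputAt x 0) = true := (onlyFirst_inputAt x 0).2 rfl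
  have hsink : ∀ u, Gen I [.inr (.sink, N)] u := by
    intro u
    induction u with
    | nil =>
      obtain ⟨c, -⟩ := h
      exact step ⟨fun _ => true, .sink, false, [], false⟩ 0 (quad c c c c _ (by simp)) hN rfl rfl
        rfl
    | cons a u ih =>
      exact step ⟨fun _ => true, .sink, false, [.inl a, .inr (.sink, false)], false⟩ 0
        (quad a a a a _ (by simp)) hN rfl rfl ⟨_, rfl, u, [], by simp, ih, rfl⟩
  have hidle : ∀ p u, Gen I [.inr (.idle, N)] u → Gen I [.inr (.idle, N)] (p ++ u) := by
    intro p u hu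
    induction p with
    | nil => exact hu
    | cons a p ih =>
      exact step ⟨fun _ => true, .idle, false, [.inl a, .inr (.idle, false)], false⟩ 0
        (quad a a a a _ (by simp)) hN rfl rfl ⟨_, rfl, _, [], by simp, ih, rfl⟩
  have hpower : ∀ m i, i + m = N → ∀ u : List C, u.length = 2 ^ m →
      Gen I [.inr (.power, i)] u := by
    intro m
    induction m with
    | zero =>
      rintro i rfl u hu
      obtain ⟨a, rfl⟩ := List.length_eq_one_iff.1 hu
      exact step ⟨fun _ => true, .power, false, [.inl a], false⟩ 0 (quad a a a a _ (by simp)) hN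
        rfl rfl ⟨_, rfl, rfl⟩
    | succ m ih =>
      intro i hi u hu
      obtain ⟨c, -⟩ := h
      rw [pow_succ] at hu
      exact step ⟨fun _ => true, .power, true, [.inr (.power, true), .inr (.power, true)], true⟩ i
        (quad c c c c _ (by simp)) (by omega) rfl rfl
        ⟨u.take (2 ^ m), u.drop (2 ^ m), by simp,
          ih (i + 1) (by omega) _ (by rw [List.length_take]; omega), u.drop (2 ^ m), [], by simp,
          ih (i + 1) (by omega) _ (by rw [List.length_drop]; omega), rfl⟩
  have hatMost : ∀ m i, i + m = N → ∀ u : List C, u.length ≤ 2 ^ m →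
      Gen I [.inr (.atMost, i)] u := by
    intro m
    induction m with
    | zero =>
      rintro i rfl u hu
      obtain ⟨c, -⟩ := h
      rcases u with _ | ⟨a, _ | ⟨a', u⟩⟩
      · exact step ⟨fun _ => true, .atMost, false, [], false⟩ 0 (quad c c c c _ (by simp)) hN
          rfl rfl rfl
      · exact step ⟨fun _ => true, .atMost, false, [.inl a], false⟩ 0 (quad a a a a _ (by simp)) hN
          rfl rfl ⟨_, rfl, rfl⟩
      · simp at hu
    | succ m ih =>
      intro i hi u hu
      obtain ⟨c, -⟩ := h
      rw [pow_succ] at hu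
      exact step ⟨fun _ => true, .atMost, true, [.inr (.atMost, true), .inr (.atMost, true)], true⟩
        i (quad c c c c _ (by simp)) (by omega) rfl rfl
        ⟨u.take (2 ^ m), u.drop (2 ^ m), by simp,
          ih (i + 1) (by omega) _ (by rw [List.length_take]; omega), u.drop (2 ^ m), [], by simp,
          ih (i + 1) (by omega) _ (by rw [List.length_drop]; omega), rfl⟩
  have hrow : ∀ d t a i, i + a.length < N → d ≠ R.expected (inputAt x (i + a.length)) →
      Gen I [.inr (.first, i)] (a ++ d :: t) := by
    intro d t a
    induction a with
    | nil =>
      intro i hi hd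
      exact step ⟨fun y => d ≠ R.expected y, .first, true, [.inl d, .inr (.sink, false)], false⟩ i
        (quad d d d d _ (by simp)) hi (by simpa using hd) rfl
        ⟨_, rfl, t, [], by simp, hsink t, rfl⟩
    | cons c a ih =>
      intro i hi hd
      have e : i + 1 + a.length = i + (c :: a).length := by simp; omega
      exact step ⟨fun _ => true, .first, true, [.inl c, .inr (.first, true)], true⟩ i
        (quad c c c c _ (by simp)) (by omega) rfl rfl
        ⟨_, rfl, _, [], by simp, ih (i + 1) (by omega) (by rwa [e]), rfl⟩
  obtain ⟨c, t, rfl, h | ⟨a, d, t, rfl, h1, h2⟩ | ⟨c', t, rfl, a, d, t, rfl, h1, h2⟩ |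
    ⟨p, u', rfl, h⟩⟩ := h
  · exact step ⟨fun _ => c ≠ R.marker, .init, false, [.inl c, .inr (.sink, false)], false⟩ 0
      (quad c c c c _ (by simp)) hN (by simpa using h) rfl ⟨_, rfl, t, [], by simp, hsink t, rfl⟩
  · exact step ⟨onlyFirst, .init, false, [.inl c, .inr (.first, true)], false⟩ 0
      (quad c c c c _ (by simp)) hN hfirst rfl ⟨_, rfl, _, [], by simp, hrow d t a 0 h1 h2, rfl⟩
  · exact step ⟨fun y => onlyFirst y && decide (d ≠ R.blank), .init, false,
       [.inl c, .inl c', .inr (.atMost, true), .inl R.blank, .inl d, .inr (.sink, false)], false⟩ 0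
      (quad c c' c d _ (by simp)) hN (by simpa [hfirst] using h2) rfl
      ⟨_, rfl, _, rfl, a, _, rfl, hatMost N 0 (by omega) a h1, _, rfl, _, rfl, t, [], by simp,
        hsink t, rfl⟩
  · refine step ⟨fun _ => true, .init, false, [.inl c, .inr (.idle, false)], false⟩ 0
      (quad c c c c _ (by simp)) hN rfl rfl ⟨_, rfl, _, [], by simp, hidle p u' ?_, rfl⟩
    rcases h with ⟨a, b, c, t, rfl, g, v, t, rfl, hg, hF⟩ | ⟨d, t, rfl, hd⟩
    · exact step ⟨fun y => onlyFirst y && decide (R.Forbidden a b c v), .idle, false,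
        [.inl a, .inl b, .inl c, .inr (.power, true), .inl v, .inr (.sink, false)], false⟩ 0
        (quad a b c v _ (by simp)) hN (by simpa [hfirst] using hF) rfl
        ⟨_, rfl, _, rfl, _, rfl, g, _, rfl, hpower N 0 (by omega) g hg, _, rfl, t, [], by simp,
          hsink t, rfl⟩
    · exact step ⟨fun _ => R.Avoid d, .idle, false, [.inl d, .inr (.sink, false)], false⟩ 0
        (quad d d d d _ (by simp)) hN (by simpa using hd) rfl
        ⟨_, rfl, t, [], by simp, hsink t, rfl⟩

/-- The grammar that finds violations of the rules. -/
noncomputable def searchCFG (R : Rules α C) (b s : ℕ) (x : List α) : CFGData :=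
  codeCFG GKind.toNat b s (prodInsts x (b ^ s) (searchProds R)) (.init, b ^ s)

theorem mem_language_searchCFG {b s : ℕ} (hb : 0 < b) (hs : 0 < s) (w : List Bool) :
    w ∈ (searchCFG R b s x).language ↔
      ∃ u, w = codeWord u ∧ Wrong R x (b ^ s) (2 ^ b ^ s) u := by
  have hN : 0 < b ^ s := Nat.pow_pos hb
  rw [searchCFG, mem_language_codeCFG GKind.toNat_injective hs _ le_rfl]
  · refine exists_congr fun u => and_congr_right fun _ => ⟨fun h => ?_, gen_of_wrong hN⟩
    obtain ⟨v, _, rfl, hv, rfl⟩ := h.matches genLang_of_matches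
    rw [List.append_nil]
    exact hv
  · intro p o he
    obtain ⟨e, -, i, hi, -, h⟩ := mem_prodInsts.1 he
    obtain ⟨rfl, rfl⟩ := Prod.mk.inj h
    constructor
    · dsimp only
      split_ifs <;> omega
    · intro r hr
      obtain ⟨a, -, ha⟩ := List.mem_map.1 hr
      rcases a with c | ⟨k, _ | _⟩
      · simp [outSymbol] at ha
      · obtain rfl := Sum.inr.inj ha
        simp
      · obtain rfl := Sum.inr.inj ha
        simp only [if_true]
        split_ifs <;> omega

/-- The loops that write the grammar. -/
noncomputable def searchCFGLoops (R : Rules α C) (b : ℕ) : List (Loop α) :=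
  textLoop (encodeName [false]) ::
  ((searchProds R).map fun e => e.row.loop GKind.toNat b) ++ [textLoop [.semi]]

theorem output_searchCFGLoops (R : Rules α C) (b s : ℕ) :
    (searchCFGLoops R b).flatMap (fun l => l.output x s) = encodeCFG (searchCFG R b s x) := by
  rw [searchCFGLoops, List.cons_append, List.flatMap_cons, List.flatMap_append,
    output_prods GKind.toNat b s x (searchProds R) (.init, b ^ s)]
  simp [output_textLoop, encodeCFG, encodeList, searchCFG, codeCFG, ntName, stateName, indexCode,
    GKind.toNat]

theorem base_searchCFGLoops {b : ℕ} (hb : 0 < b) : ∀ l ∈ searchCFGLoops R b, 0 < l.base := by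
  intro l hl
  simp only [searchCFGLoops, List.cons_append, List.mem_cons, List.mem_append, List.mem_map,
    List.not_mem_nil, or_false] at hl
  rcases hl with rfl | ⟨e, -, rfl⟩ | rfl
  · exact Nat.one_pos
  · exact hb
  · exact Nat.one_pos

end Search

end PosParikhHardness

namespace PosParikhHardness

/-! ### Computation paths and bounds on the computations -/

namespace NTM

variable {α : Type} {M : NTM α} {x : List α}

theorem Cfg.apply_injective (c : M.Cfg) {t t' : M.Tr} (h : c.apply (some t) = c.apply (some t')) :
    t = t' := by
  have h1 := congrArg Cfg.state h
  have h2 := congrArg Cfg.head h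
  have h3 := congrFun (congrArg Cfg.tape h) c.head
  obtain ⟨q, a, m⟩ := t
  obtain ⟨q', a', m'⟩ := t'
  simp only [Cfg.apply, effect, Option.getD_some, Function.update_self, add_right_inj] at h1 h2 h3
  subst h1 h3
  congr 2
  cases m <;> cases m' <;> simp_all [Move.toInt]

/-- A choice leads to a computation step, unless the machine has halted. -/
theorem step_run {ch : ℕ → Option M.Tr} (hch : ch ∈ M.runs x) {t : ℕ}
    (ht : ¬ M.Halted (M.run x ch t)) :
    ∃ a ∈ M.δ (M.run x ch t).state ((M.run x ch t).tape (M.run x ch t).head),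
      ch t = some a ∧ M.Step (M.run x ch t) (M.run x ch (t + 1)) := by
  have h := hch t
  rcases e : ch t with _ | a
  · rw [e] at h
    exact absurd h ht
  · rw [e] at h
    refine ⟨a, h, rfl, a, h, ?_⟩
    rw [run, e]
    rfl

theorem not_halted_of_lt {ch : ℕ → Option M.Tr} (hch : ch ∈ M.runs x) {t T : ℕ} (ht : t ≤ T)
    (hT : ¬ M.Halted (M.run x ch T)) : ¬ M.Halted (M.run x ch t) := by
  intro h
  rw [run_eq_of_halted hch h ht] at hT
  exact hT h

/-- The configurations up to time `m`. -/
def pathUpTo (M : NTM α) (x : List α) (ch : ℕ → Option M.Tr) (m : ℕ) : List M.Cfg :=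
  (List.range (m + 1)).map (M.run x ch)

theorem pathUpTo_mem {ch : ℕ → Option M.Tr} (hch : ch ∈ M.runs x) {m : ℕ}
    (hm : ∀ t < m, ¬ M.Halted (M.run x ch t)) : M.pathUpTo x ch m ∈ M.partialPaths x := by
  refine ⟨by simp [pathUpTo, List.range_succ_eq_map, run], ?_⟩
  rw [List.isChain_iff_getElem]
  intro i hi
  simp only [pathUpTo, List.length_map, List.length_range] at hi
  simp only [pathUpTo, List.getElem_map, List.getElem_range]
  obtain ⟨-, -, -, h⟩ := step_run hch (hm i (by omega))
  exact h

theorem TimeBounded.halted {T : ℕ → ℕ} (h : M.TimeBounded T) {ch : ℕ → Option M.Tr}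
    (hch : ch ∈ M.runs x) : M.Halted (M.run x ch (T x.length)) := by
  by_contra hT
  have := h x _ (pathUpTo_mem hch (m := T x.length + 1)
    fun t ht => not_halted_of_lt hch (by omega) hT)
  simp [pathUpTo] at this

theorem abs_head_run_le (ch : ℕ → Option M.Tr) (t : ℕ) : |(M.run x ch t).head| ≤ t := by
  induction t with
  | zero => simp [run, init]
  | succ t ih =>
    have h : ∀ m : Move, |m.toInt| ≤ 1 := by
      intro m
      cases m <;> simp [Move.toInt]
    refine (abs_add_le _ _).trans ?_
    push_cast
    exact add_le_add ih (h _)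

theorem abs_head_le_of_halted {T : ℕ} (hT : ∀ ch ∈ M.runs x, M.Halted (M.run x ch T)) :
    ∀ ch ∈ M.runs x, ∀ t, |(M.run x ch t).head| ≤ T := by
  intro ch hch t
  rcases le_total t T with h | h
  · exact (abs_head_run_le ch t).trans (by exact_mod_cast h)
  · rw [run_eq_of_halted hch (hT ch hch) h]
    exact abs_head_run_le ch T

/-- Computation paths correspond to infinite computations: cut off after the first halting
configuration. -/
theorem ncard_paths {T : ℕ} (hT : ∀ ch ∈ M.runs x, M.Halted (M.run x ch T)) (P : Set M.Q) :
    {l ∈ M.partialPaths x | ∃ c, l.getLast? = some c ∧ M.Halted c ∧ c.state ∈ P}.ncard =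
      {ch ∈ M.runs x | (M.run x ch T).state ∈ P}.ncard := by
  classical
  have hex : ∀ ch ∈ M.runs x, ∃ m, M.Halted (M.run x ch m) ∧
      ∀ t < m, ¬ M.Halted (M.run x ch t) := by
    intro ch hch
    have h : ∃ m, M.Halted (M.run x ch m) := ⟨T, hT ch hch⟩
    exact ⟨Nat.find h, Nat.find_spec h, fun t ht => Nat.find_min h ht⟩
  choose! m hm1 hm2 using hex
  have hinj : Set.InjOn (fun ch => M.pathUpTo x ch (m ch)) (M.runs x) := by
    intro ch hch ch' hch' h
    have hlen : m ch = m ch' := by simpa [pathUpTo] using congrArg List.length h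
    have hrun : ∀ t ≤ m ch, M.run x ch t = M.run x ch' t := by
      intro t ht
      have := congrArg (fun l => l[t]?) h
      simpa [pathUpTo, ← hlen, Nat.lt_succ_of_le ht] using this
    funext t
    rcases lt_or_ge t (m ch) with ht | ht
    · obtain ⟨a, -, e, -⟩ := step_run hch (hm2 ch hch t ht)
      obtain ⟨a', -, e', -⟩ := step_run hch' (hm2 ch' hch' t (hlen ▸ ht))
      have h1 := hrun (t + 1) ht
      rw [run, run, hrun t ht.le, e, e'] at h1
      rw [e, e', Cfg.apply_injective _ h1]
    · rw [choice_eq_none_of_halted hch (hm1 ch hch) ht,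
        choice_eq_none_of_halted hch' (hm1 ch' hch') (hlen ▸ ht)]
  rw [← Set.InjOn.ncard_image (hinj.mono (Set.sep_subset _ _))]
  congr 1
  ext l
  simp only [Set.mem_ofPred_eq, Set.mem_image]
  constructor
  · rintro ⟨⟨h0, hl⟩, c, hc, hhalt, hP⟩
    rw [List.isChain_iff_getElem] at hl
    obtain ⟨k, hk⟩ : ∃ k, l.length = k + 1 := by
      cases l with
      | nil => simp at h0
      | cons c l => exact ⟨l.length, rfl⟩
    have hch : ∀ t, ∃ a : Option M.Tr, if h : t + 1 < l.length then
        Cfg.Ok l[t] a ∧ a.isSome ∧ l[t + 1] = l[t].apply a else a = none := by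
      intro t
      split_ifs with h
      · obtain ⟨a, ha, e⟩ := hl t h
        exact ⟨some a, ha, rfl, e⟩
      · exact ⟨none, rfl⟩
    choose ch hch using hch
    have hrun : ∀ t, (ht : t < l.length) → M.run x ch t = l[t] := by
      intro t
      induction t with
      | zero =>
        intro ht
        rw [List.head?_eq_getElem?, List.getElem?_eq_getElem ht] at h0
        exact (Option.some.inj h0).symm
      | succ t ih =>
        intro ht
        have := hch t
        rw [dif_pos ht] at this
        rw [run, ih (by omega), this.2.2]
    have hend : M.run x ch k = c := by
      rw [hrun k (by omega)]
      rw [List.getLast?_eq_getElem?, List.getElem?_eq_getElem (by omega)] at hc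
      simpa [hk] using hc
    have hstay : ∀ t, k ≤ t → M.run x ch t = c := by
      intro t ht
      induction t, ht using Nat.le_induction with
      | base => exact hend
      | succ t ht ih =>
        have := hch t
        rw [dif_neg (by omega)] at this
        rw [run, ih, this, apply_none]
    have hmem : ch ∈ M.runs x := by
      intro t
      have := hch t
      split_ifs at this with h
      · rw [hrun t (by omega)]
        exact this.1
      · rw [hstay t (by omega), this]
        exact hhalt
    have hmk : m ch = k := by
      refine le_antisymm (not_lt.1 fun h => hm2 ch hmem k h (hend ▸ hhalt)) (not_lt.1 fun h => ?_)
      have := hch (m ch)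
      rw [dif_pos (by omega)] at this
      rw [choice_eq_none_of_halted hmem (hm1 ch hmem) le_rfl] at this
      simp at this
    refine ⟨ch, ⟨hmem, ?_⟩, ?_⟩
    · have e : M.run x ch T = c := by
        rcases le_total T k with h | h
        · rw [← run_eq_of_halted hmem (hT ch hmem) h, hend]
        · exact hstay T h
      rwa [e]
    · refine List.ext_getElem (by simp [pathUpTo, hmk, hk]) fun i h1 h2 => ?_
      simp [pathUpTo, hrun i h2]
  · rintro ⟨ch, ⟨hch, hP⟩, rfl⟩
    refine ⟨pathUpTo_mem hch (hm2 ch hch), M.run x ch (m ch), ?_, hm1 ch hch, ?_⟩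
    · simp [pathUpTo, List.range_succ]
    · have hle : m ch ≤ T := not_lt.1 fun h => hm2 ch hch T h (hT ch hch)
      rwa [← run_eq_of_halted hch (hm1 ch hch) hle]

instance (M : NTM α) : Finite M.Q := M.finite_Q

instance (M : NTM α) : Finite M.Γ := M.finite_Γ

instance : Finite Move :=
  Finite.of_surjective (fun i : Fin 3 => if i = 0 then .left else if i = 1 then .stay else .right)
    fun m => by
      cases m
      · exact ⟨0, rfl⟩
      · exact ⟨1, rfl⟩
      · exact ⟨2, rfl⟩

instance [Finite α] (M : NTM α) : Finite M.Cell := by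
  let f : M.Cell → Option (M.Sym ⊕ M.Q × M.Sym × Option M.Tr) := fun c => match c with
    | .start => none
    | .plain a => some (.inl a)
    | .head q a ch => some (.inr (q, a, ch))
  refine Finite.of_injective f ?_
  intro c c' h
  cases c <;> cases c' <;> simp_all [f]

theorem finite_runs [Finite α] {T : ℕ} (hT : ∀ ch ∈ M.runs x, M.Halted (M.run x ch T)) :
    (M.runs x).Finite := by
  refine Set.Finite.of_finite_image (f := fun ch (i : Fin T) => ch i) (Set.toFinite _) ?_
  intro ch hch ch' hch' h
  funext t
  rcases lt_or_ge t T with ht | ht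
  · exact congrFun h ⟨t, ht⟩
  · rw [choice_eq_none_of_halted hch (hT _ hch) ht, choice_eq_none_of_halted hch' (hT _ hch') ht]

/-- Majority acceptance in terms of the numbers of computations with an accepting and with a
rejecting final state. -/
theorem majorityAccepts_iff [Finite α] {T : ℕ} (hT : ∀ ch ∈ M.runs x, M.Halted (M.run x ch T)) :
    M.MajorityAccepts x ↔ {ch ∈ M.runs x | (M.run x ch T).state ∉ M.accept}.ncard <
      {ch ∈ M.runs x | (M.run x ch T).state ∉ M.acceptᶜ}.ncard := by
  have h1 : (M.acceptingPaths x).ncard = {ch ∈ M.runs x | (M.run x ch T).state ∈ M.accept}.ncard :=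
    ncard_paths hT M.accept
  have h2 : (M.paths x).ncard = (M.runs x).ncard := by
    have := ncard_paths hT Set.univ
    simpa [paths] using this
  have h3 : {ch ∈ M.runs x | (M.run x ch T).state ∈ M.accept}.ncard +
      {ch ∈ M.runs x | (M.run x ch T).state ∉ M.accept}.ncard = (M.runs x).ncard := by
    rw [← Set.ncard_union_eq (Set.disjoint_left.2 (by
      rintro ch ⟨-, h⟩ ⟨-, h'⟩
      exact h' h)) ((finite_runs hT).subset (Set.sep_subset _ _))
      ((finite_runs hT).subset (Set.sep_subset _ _))]
    congr 1
    ext ch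
    simp only [Set.mem_union, Set.mem_ofPred_eq]
    tauto
  simp only [Set.mem_compl_iff, not_not]
  rw [MajorityAccepts, h1, h2, ← h3]
  omega

/-! ### Deterministic machines with bounded space -/

theorem runs_nonempty (M : NTM α) (x : List α) : (M.runs x).Nonempty := by
  choose f hf using fun c : M.Cfg => exists_possible c.state (c.tape c.head)
  let c : ℕ → M.Cfg := fun t => Nat.rec (M.init x) (fun _ c => c.apply (f c)) t
  have h : ∀ t, M.run x (fun t => f (c t)) t = c t := by
    intro t
    induction t with
    | zero => rfl
    | succ t ih => rw [run, ih]
  refine ⟨fun t => f (c t), fun t => ?_⟩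
  rw [h]
  exact hf _

theorem reachable_run {ch : ℕ → Option M.Tr} (hch : ch ∈ M.runs x) (t : ℕ) :
    M.Reachable x (M.run x ch t) := by
  induction t with
  | zero => exact .refl
  | succ t ih =>
    by_cases h : M.Halted (M.run x ch t)
    · rwa [run_eq_of_halted hch h (Nat.le_succ t)]
    · obtain ⟨-, -, -, hs⟩ := step_run hch h
      exact ih.tail hs

theorem Deterministic.possible_unique (hM : M.Deterministic) {q : M.Q} {a : M.Sym}
    {ch ch' : Option M.Tr} (h : Possible q a ch) (h' : Possible q a ch') : ch = ch' := by
  rcases ch with _ | t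
  · exact (h'.eq_none h).symm
  · rcases ch' with _ | t'
    · exact h.eq_none h'
    · exact congrArg some (hM q a h h')

theorem Deterministic.exists_run (hM : M.Deterministic) {ch : ℕ → Option M.Tr}
    (hch : ch ∈ M.runs x) {c : M.Cfg} (hc : M.Reachable x c) : ∃ t, M.run x ch t = c := by
  induction hc with
  | refl => exact ⟨0, rfl⟩
  | tail _ hs ih =>
    obtain ⟨t, rfl⟩ := ih
    obtain ⟨a, ha, rfl⟩ := hs
    refine ⟨t + 1, ?_⟩
    rw [run, hM.possible_unique (hch t) (ch' := some a) ha]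
    rfl

theorem Deterministic.runs_subsingleton (hM : M.Deterministic) : (M.runs x).Subsingleton := by
  intro ch hch ch' hch'
  funext t
  induction t using Nat.strong_induction_on with
  | _ t ih =>
    have h := hch t
    rw [run_congr ih] at h
    exact hM.possible_unique h (hch' t)

theorem Deterministic.run_add_eq (hM : M.Deterministic) {ch : ℕ → Option M.Tr}
    (hch : ch ∈ M.runs x) {t t' : ℕ} (h : M.run x ch t = M.run x ch t') (k : ℕ) :
    M.run x ch (t + k) = M.run x ch (t' + k) := by
  induction k with
  | zero => exact h
  | succ k ih =>
    have h1 := hch (t + k)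
    rw [ih] at h1
    rw [← add_assoc, ← add_assoc, run, run, ih, hM.possible_unique h1 (hch (t' + k))]

/-- A deterministic machine that halts does so before a configuration is repeated. -/
theorem Deterministic.halted_of_space (hM : M.Deterministic) [Finite α] {S k : ℕ}
    (hS : ∀ ch ∈ M.runs x, ∀ t, |(M.run x ch t).head| ≤ S) (hh : M.HaltsOn x)
    (hQ : Nat.card M.Q ≤ 2 ^ k) (hk : Nat.card M.Sym ≤ 2 ^ k) {ch : ℕ → Option M.Tr}
    (hch : ch ∈ M.runs x) :
    M.Halted (M.run x ch (2 ^ (k + ((2 * S + 1) + k * (2 * (S + x.length) + 1))))) := by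
  classical
  have hex : ∃ m, M.Halted (M.run x ch m) := by
    obtain ⟨c, hc, hc'⟩ := hh
    obtain ⟨t, rfl⟩ := hM.exists_run hch hc
    exact ⟨t, hc'⟩
  set m := Nat.find hex with hm
  have hm1 : M.Halted (M.run x ch m) := Nat.find_spec hex
  have hm2 : ∀ t < m, ¬ M.Halted (M.run x ch t) := fun t ht => Nat.find_min hex ht
  suffices hle : m ≤ 2 ^ (k + ((2 * S + 1) + k * (2 * (S + x.length) + 1))) by
    rwa [run_eq_of_halted hch hm1 hle]
  have hne : ∀ t t', t < t' → t' < m → M.run x ch t ≠ M.run x ch t' := by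
    intro t t' htt ht' h
    have := hM.run_add_eq hch h (m - t')
    rw [show t' + (m - t') = m by omega] at this
    exact hm2 (t + (m - t')) (by omega) (this ▸ hm1)
  let f : Fin m → M.Q × Fin (2 * S + 1) × (Fin (2 * (S + x.length) + 1) → M.Sym) := fun t =>
    ((M.run x ch t).state,
      ⟨((M.run x ch t).head + S).toNat, by have := abs_le.1 (hS ch hch t); omega⟩,
      fun j => (M.run x ch t).tape (j - (S + x.length : ℕ)))
  have hf : Function.Injective f := by
    have key : ∀ t t' : Fin m, f t = f t' → M.run x ch t = M.run x ch t' := by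
      intro t t' h
      simp only [f, Prod.mk.injEq, Fin.mk.injEq] at h
      obtain ⟨h1, h2, h3⟩ := h
      have b1 := abs_le.1 (hS ch hch t)
      have b2 := abs_le.1 (hS ch hch t')
      refine Cfg.ext h1 (by omega) ?_
      funext i
      rcases le_or_gt |i| (S + x.length : ℕ) with hi | hi
      · have hi := abs_le.1 hi
        have := congrFun h3 ⟨(i + (S + x.length : ℕ)).toNat, by omega⟩
        simp only at this
        rwa [Int.toNat_of_nonneg (by omega), add_sub_cancel_right] at this
      · rw [tape_run_of_lt (hS ch hch) t hi, tape_run_of_lt (hS ch hch) t' hi]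
    intro t t' h
    rcases lt_trichotomy t t' with hlt | rfl | hlt
    · exact absurd (key t t' h) (hne t t' hlt t'.2)
    · rfl
    · exact absurd (key t t' h).symm (hne t' t hlt t.2)
  have h := Nat.card_le_card_of_injective f hf
  rw [Nat.card_prod, Nat.card_prod, Nat.card_fun, Nat.card_fin, Nat.card_fin, Nat.card_fin] at h
  refine h.trans ?_
  rw [pow_add 2 k, pow_add 2 (2 * S + 1), pow_mul 2 k]
  exact Nat.mul_le_mul hQ (Nat.mul_le_mul Nat.lt_two_pow_self.le (Nat.pow_le_pow_left hk _))

/-- Acceptance by a deterministic machine in terms of the numbers of computations with an accepting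
and with a rejecting final state, which are `0` and `1`. -/
theorem Deterministic.accepts_iff (hM : M.Deterministic) {T : ℕ}
    (hT : ∀ ch ∈ M.runs x, M.Halted (M.run x ch T)) :
    M.Accepts x ↔ {ch ∈ M.runs x | (M.run x ch T).state ∉ M.accept}.ncard <
      {ch ∈ M.runs x | (M.run x ch T).state ∉ M.acceptᶜ}.ncard := by
  obtain ⟨ch, hch⟩ := M.runs_nonempty x
  have hruns : M.runs x = {ch} := hM.runs_subsingleton.eq_singleton_of_mem hch
  have hacc : M.Accepts x ↔ (M.run x ch T).state ∈ M.accept := by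
    constructor
    · rintro ⟨c, hc, hh, ha⟩
      obtain ⟨t, rfl⟩ := hM.exists_run hch hc
      rcases le_total t T with h | h
      · rwa [run_eq_of_halted hch hh h]
      · rwa [← run_eq_of_halted hch (hT ch hch) h]
    · intro h
      exact ⟨_, reachable_run hch T, hT ch hch, h⟩
  rw [hacc, hruns]
  by_cases h : (M.run x ch T).state ∈ M.accept
  · have e1 : {c ∈ ({ch} : Set (ℕ → Option M.Tr)) | (M.run x c T).state ∉ M.accept} = ∅ := by
      ext c
      simp only [Set.mem_singleton_iff, Set.mem_ofPred_eq, Set.mem_empty_iff_false, iff_false,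
        not_and, not_not]
      rintro rfl
      exact h
    have e2 : {c ∈ ({ch} : Set (ℕ → Option M.Tr)) | (M.run x c T).state ∉ M.acceptᶜ} = {ch} := by
      ext c
      simp only [Set.mem_singleton_iff, Set.mem_ofPred_eq, Set.mem_compl_iff, not_not,
        and_iff_left_iff_imp]
      rintro rfl
      exact h
    rw [e1, e2, Set.ncard_empty, Set.ncard_singleton]
    simpa using h
  · have e2 : {c ∈ ({ch} : Set (ℕ → Option M.Tr)) | (M.run x c T).state ∉ M.acceptᶜ} = ∅ := by
      ext c
      simp only [Set.mem_singleton_iff, Set.mem_ofPred_eq, Set.mem_compl_iff, not_not,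
        Set.mem_empty_iff_false, iff_false, not_and]
      rintro rfl
      exact h
    rw [e2, Set.ncard_empty]
    simpa using h

end NTM

end PosParikhHardness

namespace PosParikhHardness

/-! ### Comparing the numbers of words without violations -/

theorem NTM.start_notMem_haltCells {α : Type} {M : NTM α} (P : Set M.Q) :
    Cell.start ∉ haltCells P := by
  rintro ⟨q, -, a, h⟩
  cases h

/-- The number of words of a given length that violate the rules is the number of all words minus
the number of computations. -/
theorem parikhCount_gt_iff {α : Type} {M : NTM α} [Fintype M.Cell] {x : List α} {N G S T L : ℕ}
    {A B : Language Bool}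
    (hA : ∀ w, w ∈ A ↔ ∃ u, w = codeWord u ∧ Wrong (M.rules (NTM.haltCells M.accept)) x N G u)
    (hB : ∀ w, w ∈ B ↔ ∃ u, w = codeWord u ∧ Wrong (M.rules (NTM.haltCells M.acceptᶜ)) x N G u)
    (hN : x.length + 2 ≤ N) (hNG : N ≤ G + 3)
    (hS : ∀ ch ∈ M.runs x, ∀ t, |(M.run x ch t).head| ≤ S)
    (hG : 2 * NTM.margin S x.length ≤ G)
    (hT : ∀ ch ∈ M.runs x, M.Halted (M.run x ch T)) (hL : (T + 3) * (G + 2) ≤ L) :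
    parikhCount A (codeVector M.Cell L) > parikhCount B (codeVector M.Cell L) ↔
      {ch ∈ M.runs x | (M.run x ch T).state ∉ M.accept}.ncard <
        {ch ∈ M.runs x | (M.run x ch T).state ∉ M.acceptᶜ}.ncard := by
  have hfin : {u : List M.Cell | u.length = L}.Finite := List.finite_length_eq _ _
  have key : ∀ (P : Set M.Q) (D : Language Bool),
      (∀ w, w ∈ D ↔ ∃ u, w = codeWord u ∧ Wrong (M.rules (NTM.haltCells P)) x N G u) →
      parikhCount D (codeVector M.Cell L) + {ch ∈ M.runs x | (M.run x ch T).state ∉ P}.ncard =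
        {u : List M.Cell | u.length = L}.ncard := by
    intro P D hD
    have hnot : ∀ u : List M.Cell, u.length = L →
        (¬ Wrong (M.rules (NTM.haltCells P)) x N G u ↔
          M.Valid x G u ∧ ∀ c ∈ u, c ∉ NTM.haltCells P) := fun u hu =>
      NTM.not_wrong_iff (NTM.start_notMem_haltCells P) hN hNG (by rw [hu]; nlinarith)
    rw [parikhCount_codeVector hD, ← NTM.ncard_valid hS hG hT hL P, ← Set.ncard_union_eq
      (Set.disjoint_left.2 (by
        rintro u ⟨hu, h⟩ ⟨-, h'⟩
        exact (hnot u hu).2 h' h))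
      (hfin.subset fun u hu => hu.1) (hfin.subset fun u hu => hu.1)]
    congr 1
    ext u
    simp only [Set.mem_union, Set.mem_ofPred_eq, ← and_or_left, and_iff_left_iff_imp]
    intro hu
    rw [← hnot u hu]
    exact em _
  have h1 := key _ _ hA
  have h2 := key _ _ hB
  omega

/-! ### Writing the Parikh vector -/

section Vectors

variable {α : Type}

theorem flatMap_range_replicate {β : Type} (m k : ℕ) (a : β) :
    ((List.range m).flatMap fun _ => List.replicate k a) = List.replicate (k * m) a := by
  induction m with
  | zero => rfl
  | succ m ih =>
    rw [List.range_succ, List.flatMap_append, ih, Nat.mul_succ, List.replicate_add]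
    simp

/-- A loop that repeats a token `k * b ^ s` times. -/
def repeatLoop (b k : ℕ) (a : Token) : Loop α := ⟨b, fun _ => true, List.replicate k (some a), []⟩

theorem output_repeatLoop (b k s : ℕ) (a : Token) (x : List α) :
    (repeatLoop b k a).output x s = List.replicate (k * b ^ s) a := by
  rw [← flatMap_range_replicate]
  simp only [repeatLoop, Loop.output, if_true, ← List.map_replicate, fillTemplate_map_some]
  simp [fillTemplate]

variable (C : Type) [Fintype C]

/-- The loops that write the vector for length `b ^ s` in unary. -/
def unaryLoops (b : ℕ) : List (Loop α) :=
  [repeatLoop b (Fintype.card C - 1) (.bit true), textLoop [.comma],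
    repeatLoop b 1 (.bit true), textLoop [.comma]]

theorem output_unaryLoops (b s : ℕ) (x : List α) :
    (unaryLoops C b).flatMap (fun l => l.output x s) =
      encodeVector unary (codeVector C (b ^ s)) := by
  simp [unaryLoops, output_repeatLoop, output_textLoop, encodeVector, encodeName, unary, codeVector]

theorem binary_mul_two_pow {m : ℕ} (hm : m ≠ 0) (k : ℕ) :
    binary (m * 2 ^ k) = List.replicate k false ++ binary m := by
  induction k with
  | zero => simp
  | succ k ih =>
    have h : m * 2 ^ (k + 1) = Nat.bit false (m * 2 ^ k) := by
      rw [Nat.bit_false, pow_succ]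
      ring
    have hpos : 0 < m * 2 ^ k := Nat.mul_pos (Nat.pos_of_ne_zero hm) (by positivity)
    rw [binary, h, Nat.bits_append_bit _ _ (fun h0 => absurd h0 hpos.ne')]
    rw [List.replicate_succ, List.cons_append, ← ih, binary]

/-- The loops that write the vector for length `2 ^ (e * b ^ s)` in binary. -/
def binaryLoops (b e : ℕ) : List (Loop α) :=
  [repeatLoop b e (.bit false), textLoop (encodeName (binary (Fintype.card C - 1))),
    repeatLoop b e (.bit false), textLoop (encodeName (binary 1))]

theorem output_binaryLoops (hC : 2 ≤ Fintype.card C) (b e s : ℕ) (x : List α) :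
    (binaryLoops C b e).flatMap (fun l => l.output x s) =
      encodeVector binary (codeVector C (2 ^ (e * b ^ s))) := by
  have h1 := binary_mul_two_pow (m := Fintype.card C - 1) (by omega) (e * b ^ s)
  have h2 := binary_mul_two_pow one_ne_zero (e * b ^ s)
  rw [one_mul] at h2
  simp [binaryLoops, output_repeatLoop, output_textLoop, encodeVector, encodeName, codeVector, h1,
    h2]

variable {C}

theorem base_unaryLoops {b : ℕ} (hb : 0 < b) :
    ∀ l ∈ (unaryLoops C b : List (Loop α)), 0 < l.base := by
  simp [unaryLoops, repeatLoop, textLoop, hb]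

theorem base_binaryLoops {b : ℕ} (hb : 0 < b) (e : ℕ) :
    ∀ l ∈ (binaryLoops C b e : List (Loop α)), 0 < l.base := by
  simp [binaryLoops, repeatLoop, textLoop, hb]

end Vectors

/-! ### The reductions -/

/-- Every polynomial in the length of the input is bounded by a power of the form that the loops
count to. -/
theorem exists_eval_le (p : Polynomial ℕ) :
    ∃ c, ∀ n, p.eval n ≤ (2 ^ c) ^ counterWidth n := by
  suffices h : ∃ c, ∀ n, p.eval n ≤ (n + 2) ^ c by
    obtain ⟨c, h⟩ := h
    refine ⟨c, fun n => (h n).trans ?_⟩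
    rw [← pow_mul, mul_comm, pow_mul]
    exact Nat.pow_le_pow_left (lt_two_pow_counterWidth n).le c
  induction p using Polynomial.induction_on' with
  | add p q hp hq =>
    obtain ⟨c, hc⟩ := hp
    obtain ⟨d, hd⟩ := hq
    refine ⟨max c d + 1, fun n => ?_⟩
    have h1 : (n + 2) ^ c ≤ (n + 2) ^ max c d := Nat.pow_le_pow_right (by omega) (le_max_left _ _)
    have h2 : (n + 2) ^ d ≤ (n + 2) ^ max c d := Nat.pow_le_pow_right (by omega) (le_max_right _ _)
    have := hc n
    have := hd n
    rw [Polynomial.eval_add, pow_succ]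
    nlinarith
  | monomial k a =>
    refine ⟨a + k, fun n => ?_⟩
    rw [Polynomial.eval_monomial, pow_add]
    refine Nat.mul_le_mul ?_ (Nat.pow_le_pow_left (by omega) k)
    exact Nat.lt_two_pow_self.le.trans (Nat.pow_le_pow_left (by omega) a)

/-- A logspace reduction to PosParikh, for acceptors that find violations of the rules. -/
theorem exists_reduction {α X : Type} {M : NTM α} [Fintype M.Cell] {enc : X → List Token}
    {lang : X → Language Bool} {num : ℕ → List Bool} (henc : PrefixFree enc)
    (hnum : Function.Injective num) {b : ℕ} {G : ℕ → ℕ} (hNG : ∀ N, N ≤ G N + 3)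
    {acceptor : Rules α M.Cell → ℕ → List α → X} {loops : Rules α M.Cell → List (Loop α)}
    (hloops : ∀ R s x, (loops R).flatMap (fun l => l.output x s) = enc (acceptor R s x))
    (hbase : ∀ R, ∀ l ∈ loops R, 0 < l.base)
    (hlang : ∀ R s x, 0 < s → ∀ w, w ∈ lang (acceptor R s x) ↔
      ∃ u, w = codeWord u ∧ Wrong R x (b ^ s) (G (b ^ s)) u)
    {V : List (Loop α)} (hV : ∀ l ∈ V, 0 < l.base) {len : ℕ → ℕ}
    (hvec : ∀ s x, V.flatMap (fun l => l.output x s) = encodeVector num (codeVector M.Cell (len s)))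
    {L : Language α} (h : ∀ x : List α, ∃ S T : ℕ,
      (∀ ch ∈ M.runs x, ∀ t, |(M.run x ch t).head| ≤ S) ∧
      (∀ ch ∈ M.runs x, M.Halted (M.run x ch T)) ∧
      (x ∈ L ↔ {ch ∈ M.runs x | (M.run x ch T).state ∉ M.accept}.ncard <
        {ch ∈ M.runs x | (M.run x ch T).state ∉ M.acceptᶜ}.ncard) ∧
      x.length + 2 ≤ b ^ counterWidth x.length ∧
      2 * NTM.margin S x.length ≤ G (b ^ counterWidth x.length) ∧
      (T + 3) * (G (b ^ counterWidth x.length) + 2) ≤ len (counterWidth x.length)) :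
    ∃ f : List α → List Token, LogspaceComputable f ∧
      ∀ x, x ∈ L ↔ f x ∈ PosParikh enc lang num := by
  refine ⟨_, logspaceComputable_loops (loops (M.rules (NTM.haltCells M.accept)) ++
    loops (M.rules (NTM.haltCells M.acceptᶜ)) ++ V) ?_, fun x => ?_⟩
  · intro l hl
    rcases List.mem_append.1 hl with hl | hl
    · rcases List.mem_append.1 hl with hl | hl
      · exact hbase _ l hl
      · exact hbase _ l hl
    · exact hV l hl
  · obtain ⟨S, T, hS, hT, hx, hN, hG, hL⟩ := h x
    simp only [List.flatMap_append, hloops, hvec]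
    rw [mem_posParikh_iff henc lang hnum, hx]
    exact (parikhCount_gt_iff (hlang _ _ _ (counterWidth_pos _)) (hlang _ _ _ (counterWidth_pos _))
      hN (hNG _) hS hG hT hL).symm

theorem two_le_card_cell {α : Type} (M : NTM α) [Fintype M.Cell] : 2 ≤ Fintype.card M.Cell :=
  Fintype.one_lt_card_iff.2 ⟨.start, .plain none, by simp⟩

/-- Polynomial time, hence polynomially many rows of polynomial length. -/
theorem logspaceHard_PP :
    LogspaceHard PP (PosParikh encodeNFA NFAData.language unary) := by
  intro α _ L ⟨M, p, hM, hL⟩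
  have := Fintype.ofFinite M.Cell
  -- `N` is at least twice the margin; then words of length `N ^ 3` have room for all rows
  obtain ⟨c, hc⟩ := exists_eval_le (2 * (p + Polynomial.X + 2))
  have hb : 0 < 2 ^ c := by positivity
  refine exists_reduction (M := M) prefixFree_encodeNFA unary_injective (b := 2 ^ c) (G := id)
    (fun N => by simp) (fun R s x => output_searchNFALoops R (2 ^ c) s)
    (fun R => base_searchNFALoops hb) (fun R s x hs => mem_language_searchNFA hb hs)
    (base_unaryLoops (b := (2 ^ c) ^ 3) (by positivity)) (output_unaryLoops M.Cell _) fun x => ?_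
  have hT : ∀ ch ∈ M.runs x, M.Halted (M.run x ch (p.eval x.length)) := fun ch hch => hM.halted hch
  have h := hc x.length
  simp only [Polynomial.eval_mul, Polynomial.eval_add, Polynomial.eval_X, Polynomial.eval_ofNat]
    at h
  refine ⟨_, _, NTM.abs_head_le_of_halted hT, hT, (hL x).trans (NTM.majorityAccepts_iff hT), ?_, ?_,
    ?_⟩
  · omega
  · simpa [NTM.margin] using h
  · rw [pow_right_comm (2 ^ c) 3]
    simp only [id]
    set N := (2 ^ c) ^ counterWidth x.length
    calc (p.eval x.length + 3) * (N + 2) ≤ N * (N * N) :=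
          Nat.mul_le_mul (by omega) (by nlinarith)
      _ = N ^ 3 := by ring

theorem add_two_le_two_pow {n : ℕ} (h : 2 ≤ n) : n + 2 ≤ 2 ^ n := by
  induction n, h using Nat.le_induction with
  | base => norm_num
  | succ n h ih => rw [pow_succ]; omega

/-- Polynomial space, hence exponentially many rows of polynomial length. -/
theorem logspaceHard_PSPACE :
    LogspaceHard PSPACE (PosParikh encodeNFA NFAData.language binary) := by
  intro α _ L ⟨M, p, hdet, hM, hH, hL⟩
  have := Fintype.ofFinite M.Cell
  obtain ⟨k, hQ, hk⟩ : ∃ k, Nat.card M.Q ≤ 2 ^ k ∧ Nat.card M.Sym ≤ 2 ^ k :=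
    ⟨max (Nat.card M.Q) (Nat.card M.Sym), (le_max_left _ _).trans Nat.lt_two_pow_self.le,
      (le_max_right _ _).trans Nat.lt_two_pow_self.le⟩
  -- the first summand bounds the margins, the others the exponent of the running time
  obtain ⟨c, hc⟩ := exists_eval_le (2 * (p + Polynomial.X + 2) +
    (Polynomial.C k + ((2 * p + 1) + Polynomial.C k * (2 * (p + Polynomial.X) + 1))))
  have hb : 0 < 2 ^ c := by positivity
  refine exists_reduction (M := M) prefixFree_encodeNFA binary_injective (b := 2 ^ c) (G := id)
    (fun N => by simp) (fun R s x => output_searchNFALoops R (2 ^ c) s)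
    (fun R => base_searchNFALoops hb) (fun R s x hs => mem_language_searchNFA hb hs)
    (base_binaryLoops hb 3) (output_binaryLoops M.Cell (two_le_card_cell M) _ _) fun x => ?_
  have hS : ∀ ch ∈ M.runs x, ∀ t, |(M.run x ch t).head| ≤ (p.eval x.length : ℕ) :=
    fun ch hch t => hM x _ (NTM.reachable_run hch t)
  have hT := fun ch hch => hdet.halted_of_space hS (hH x) hQ hk (ch := ch) hch
  have h := hc x.length
  simp only [Polynomial.eval_mul, Polynomial.eval_add, Polynomial.eval_X, Polynomial.eval_ofNat,
    Polynomial.eval_C, Polynomial.eval_one] at h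
  refine ⟨_, _, hS, hT, (hL x).trans (hdet.accepts_iff hT), ?_, ?_, ?_⟩
  · omega
  · simp only [NTM.margin, id]
    omega
  · simp only [id]
    set N := (2 ^ c) ^ counterWidth x.length
    generalize k + (2 * p.eval x.length + 1 + k * (2 * (p.eval x.length + x.length) + 1)) = D at h ⊢
    have h1 : 2 ^ D + 3 ≤ 2 ^ N * 2 ^ N := by
      have e1 : 2 ^ D ≤ 2 ^ N := Nat.pow_le_pow_right (by omega) (by omega)
      have e2 : 2 ^ 2 ≤ 2 ^ N := Nat.pow_le_pow_right (by omega) (by omega)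
      nlinarith
    calc (2 ^ D + 3) * (N + 2) ≤ 2 ^ N * 2 ^ N * 2 ^ N :=
          Nat.mul_le_mul h1 (add_two_le_two_pow (by omega))
      _ = 2 ^ (3 * N) := by ring

/-- Exponential time, hence exponentially many rows of exponential length. -/
theorem logspaceHard_PEXP :
    LogspaceHard PEXP (PosParikh encodeCFG CFGData.language binary) := by
  intro α _ L ⟨M, p, hM, hL⟩
  have := Fintype.ofFinite M.Cell
  -- `2 ^ N` is at least twice the margin; then words of length `2 ^ (3 * N)` have room for all rows
  obtain ⟨c, hc⟩ := exists_eval_le (p + Polynomial.X + 4)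
  have hb : 0 < 2 ^ c := by positivity
  refine exists_reduction (M := M) prefixFree_encodeCFG binary_injective (b := 2 ^ c)
    (G := fun N => 2 ^ N) (fun N => Nat.lt_two_pow_self.le.trans (by omega))
    (fun R s x => output_searchCFGLoops R (2 ^ c) s)
    (fun R => base_searchCFGLoops hb) (fun R s x hs => mem_language_searchCFG hb hs)
    (base_binaryLoops hb 3) (output_binaryLoops M.Cell (two_le_card_cell M) _ _) fun x => ?_
  have hT : ∀ ch ∈ M.runs x, M.Halted (M.run x ch (2 ^ p.eval x.length)) :=
    fun ch hch => hM.halted hch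
  have h := hc x.length
  simp only [Polynomial.eval_add, Polynomial.eval_X, Polynomial.eval_ofNat] at h
  refine ⟨_, _, NTM.abs_head_le_of_halted hT, hT, (hL x).trans (NTM.majorityAccepts_iff hT), ?_, ?_,
    ?_⟩
  · omega
  · have e1 : 2 ^ (p.eval x.length + x.length + 4) ≤ 2 ^ (2 ^ c) ^ counterWidth x.length :=
      Nat.pow_le_pow_right (by omega) h
    have e2 := add_two_le_two_pow (n := x.length + 2) (by omega)
    have e3 : 2 ^ p.eval x.length ≤ 2 ^ (p.eval x.length + x.length + 2) :=
      Nat.pow_le_pow_right (by omega) (by omega)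
    have e4 : 2 ^ (x.length + 2) ≤ 2 ^ (p.eval x.length + x.length + 2) :=
      Nat.pow_le_pow_right (by omega) (by omega)
    have e5 : 2 ^ (p.eval x.length + x.length + 4) = 4 * 2 ^ (p.eval x.length + x.length + 2) := by
      ring
    unfold NTM.margin
    omega
  · set N := (2 ^ c) ^ counterWidth x.length
    have e1 : 2 ^ (p.eval x.length + 2) ≤ 2 ^ N := Nat.pow_le_pow_right (by omega) (by omega)
    have e2 : 2 ^ 2 ≤ 2 ^ N := Nat.pow_le_pow_right (by omega) (by omega)
    have e3 : 2 ^ (p.eval x.length + 2) = 4 * 2 ^ p.eval x.length := by ring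
    have e4 := Nat.one_le_two_pow (n := p.eval x.length)
    calc (2 ^ p.eval x.length + 3) * (2 ^ N + 2) ≤ 2 ^ N * (2 ^ N * 2 ^ N) :=
          Nat.mul_le_mul (by omega) (by nlinarith)
      _ = 2 ^ (3 * N) := by ring

end PosParikhHardness

theorem mainTheorem4 :
    PosParikhHardness.LogspaceHard PosParikhHardness.PP
      (PosParikhHardness.PosParikh PosParikhHardness.encodeNFA
        PosParikhHardness.NFAData.language PosParikhHardness.unary) ∧
    PosParikhHardness.LogspaceHard PosParikhHardness.PSPACE
      (PosParikhHardness.PosParikh PosParikhHardness.encodeNFA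
        PosParikhHardness.NFAData.language PosParikhHardness.binary) ∧
    PosParikhHardness.LogspaceHard PosParikhHardness.PEXP
      (PosParikhHardness.PosParikh PosParikhHardness.encodeCFG
        PosParikhHardness.CFGData.language PosParikhHardness.binary) :=
  ⟨PosParikhHardness.logspaceHard_PP, PosParikhHardness.logspaceHard_PSPACE,
    PosParikhHardness.logspaceHard_PEXP⟩
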